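/- **Setting.** Let $(Y_{i1},Y_{i2},X_i)$, $i\ge 1$, be i.i.d. copies of $(Y_1,Y_2,X)$. Assume that $Y_1,Y_2,X$ have absolutely continuous distributions, with distribution functions $F_{Y_1},F_{Y_2},F_X$, and that the conditional distributions of $Y_1$ and of $Y_2$ given $X=x$, with distribution functions $F_{1x},F_{2x}$, are absolutely continuous for almost every $x$. Put $U_{ij}=F_{jX_i}(Y_{ij})$, $V_i=F_X(X_i)$, and let $C(u_1,u_2,v)$ be the copula (joint distribution function) of $(U_{i1},U_{i2},V_i)$. Write $C_v(u_1,u_2|v)=\partial C(u_1,u_2,v)/\partial v$. **Estimator.** For a sample $z_1,\dots,z_n\in\mathbb R^d$ the empirical checkerboard copula is $$C_n^{\#}(u)=\frac1n\sum_{i=1}^n\prod_{k=1}^d\min\Big\{\max\Big\{\frac{nu_k-a_{ik}}{b_{ik}-a_{ik}},0\Big\},1\Big\},\quad a_{ik}=\#\{i':z_{i'k}<z_{ik}\},\ b_{ik}=\#\{i':z_{i'k}\le z_{ik}\}$$ (without ties $b_{ik}=a_{ik}+1$ is the rank), and the empirical checkerboard Bernstein copula (ECBC) with degrees $l_1,\dots,l_d$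 is its Bernstein polynomial $$\sum_{h_1=0}^{l_1}\cdots\sum_{h_d=0}^{l_d}C_n^{\#}\Big(\frac{h_1}{l_1},\dots,\frac{h_d}{l_d}\Big)\prod_{k=1}^d\binom{l_k}{h_k}u_k^{h_k}(1-u_k)^{l_k-h_k}.$$ For a sample in $\mathbb R^3$ with ECBC $C^{\#}(u_1,u_2,v)$ of degrees $(l_1,l_2,m)$, let $C^{\#(1)}(u_1,u_2|v)=\partial C^{\#}(u_1,u_2,v)/\partial v$, $F_1(t|v)=C^{\#(1)}(t,1|v)$, $F_2(t|v)=C^{\#(1)}(1,t|v)$, and define $$C^{\#}(u_1,u_2|v)=C^{\#(1)}\big(F_1^{-1}(u_1|v),F_2^{-1}(u_2|v)\,\big|\,v\big).$$ Let $\|g\|(v)=\sup_{(u_1,u_2)\in[0,1]^2}|g(u_1,u_2|v)|$, and let $E$ denote the expectation, for a fixed sample of size $n$, over independent degrees $l_1,l_2,m$ with $l_j\,|\,\alpha_j\sim\mathrm{Poisson}(n^{\alpha_j})+1$, $m\,|\,\alpha\sim\mathrm{Poisson}(n^{\alpha})+2$, where $\alpha_1,\alpha_2,\alpha$ are uniform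 on $(1/3,2/3)$. **Theorem.** Assume that $C$ is absolutely continuous and that $C_v$ exists and is Lipschitz continuous on $[0,1]^3$. Let $0<v<1$. (i) If $C^{\#}(\cdot,\cdot|v)$ is computed from the covariate-adjusted sample $(U_{i1},U_{i2},V_i)$, $i\le n$, then $$E\big(\|C^{\#}-C_v\|(v)\big)\to0\quad\text{almost surely as } n\to\infty.$$ (ii) The same holds if $C^{\#}(\cdot,\cdot|v)$ is computed from the pseudo-observations $(\hat U_{i1},\hat U_{i2},\hat V_i)$, $i\le n$. Here $\hat V_i=F_{nX}(X_i)$ and $\hat U_{ij}=\hat F_{jX_i}(Y_{ij})$, where $F_{nX}(x)=\frac1{n+1}\sum_{i\le n}\mathbf 1(X_i\le x)$, $F_{nY_j}$ is defined likewise, and $\hat F_{jx}(y)=\partial_vC_j^{\#}(w,v)$ at $w=F_{nY_j}(y)$, $v=F_{nX}(x)$, with $C_j^{\#}$ the bivariate ECBC, of degrees $(g_j,m_j)$, of $(F_{nY_j}(Y_{ij}),F_{nX}(X_i))$, $i\le n$. For (ii) it is assumed in addition that, for $j=1,2$, the copula $C_j(w,v)$ of $(Y_j,X)$ is differentiable in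 $v$ with $\partial C_j/\partial v$ continuous on $[0,1]\times(0,1)$, and that the (possibly data-dependent) degrees $g_j=g_j(n)$, $m_j=m_j(n)$ satisfy almost surely $g_j\to\infty$, $m_j\to\infty$ and $m_j\le n^{\beta}$ for some $\beta<1$ and all large $n$. -/

import Mathlib

open MeasureTheory ProbabilityTheory Filter Set
open scoped ENNReal NNReal Topology

noncomputable section

namespace ECBC

/-! ### The empirical checkerboard Bernstein copula (ECBC) of a finite sample -/

/-- The number of sample points that are strictly smaller than `t`. -/
def countLT {n : ℕ} (x : Fin n → ℝ) (t : ℝ) : ℕ := Nat.card {i : Fin n // x i < t}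

/-- The number of sample points that are at most `t`. -/
def countLE {n : ℕ} (x : Fin n → ℝ) (t : ℝ) : ℕ := Nat.card {i : Fin n // x i ≤ t}

/-- The modified empirical distribution function `(n + 1)⁻¹ ∑ᵢ 1(xᵢ ≤ t)`. -/
def modifiedECDF {n : ℕ} (x : Fin n → ℝ) (t : ℝ) : ℝ := (countLE x t : ℝ) / (n + 1)

/-- The distribution function of the uniform law on the cell of the `i`-th observation. If `x i` is
not tied with another observation and has rank `R`, this is `min (max (n t - R + 1) 0) 1`, the
uniform law on `[(R - 1) / n, R / n]`; observations that are tied share one longer cell. -/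
def cellCDF {n : ℕ} (x : Fin n → ℝ) (i : Fin n) (t : ℝ) : ℝ :=
  min (max ((n * t - countLT x (x i)) / (countLE x (x i) - countLT x (x i))) 0) 1

/-- The empirical checkerboard copula of a sample `z` of size `n` in dimension `d`. It depends on
the sample through the coordinatewise ranks only. -/
def checkerboard {n d : ℕ} (z : Fin n → Fin d → ℝ) (u : Fin d → ℝ) : ℝ :=
  (1 / n : ℝ) * ∑ i, ∏ k, cellCDF (fun i' => z i' k) i (u k)

/-- The Bernstein polynomial, of degree `l k` in the `k`-th variable, of a function `f` on the unit
cube. -/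
def bernsteinSmoothing {d : ℕ} (l : Fin d → ℕ) (f : (Fin d → ℝ) → ℝ) (u : Fin d → ℝ) : ℝ :=
  ∑ h ∈ Fintype.piFinset (fun k => Finset.range (l k + 1)),
    f (fun k => (h k : ℝ) / l k) * ∏ k, (bernsteinPolynomial ℝ (l k) (h k)).eval (u k)

/-- The empirical checkerboard Bernstein copula with degrees `l` of the sample `z`. -/
def ecbc {n d : ℕ} (l : Fin d → ℕ) (z : Fin n → Fin d → ℝ) : (Fin d → ℝ) → ℝ :=
  bernsteinSmoothing l (checkerboard z)

/-! ### The conditional copula estimator -/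

/-- `C^{#(1)}(u₁, u₂ | v)`: the derivative with respect to `v` of the trivariate ECBC. -/
def ecbcDeriv {n : ℕ} (l : Fin 3 → ℕ) (z : Fin n → Fin 3 → ℝ) (v u₁ u₂ : ℝ) : ℝ :=
  deriv (fun t => ecbc l z ![u₁, u₂, t]) v

/-- The inverse on `[0, 1]` of a distribution function `F` of a law on `[0, 1]`. -/
def quantile (F : ℝ → ℝ) (u : ℝ) : ℝ := sInf {t | t ∈ Icc (0 : ℝ) 1 ∧ u ≤ F t}

/-- The ECBC-based conditional copula estimator
`C^#(u₁, u₂ | v) = C^{#(1)}(F₁⁻¹(u₁ | v), F₂⁻¹(u₂ | v) | v)`, where `F₁(t | v) = C^{#(1)}(t, 1 | v)`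
and `F₂(t | v) = C^{#(1)}(1, t | v)`. -/
def estimator {n : ℕ} (l : Fin 3 → ℕ) (z : Fin n → Fin 3 → ℝ) (v u₁ u₂ : ℝ) : ℝ :=
  ecbcDeriv l z v (quantile (fun t => ecbcDeriv l z v t 1) u₁)
    (quantile (fun t => ecbcDeriv l z v 1 t) u₂)

/-! ### The empirical prior of the degrees -/

theorem measurable_poissonMeasure : Measurable poissonMeasure := by
  refine Measure.measurable_of_measurable_coe _ fun s hs => ?_
  simp only [poissonMeasure, Measure.sum_apply _ hs, Measure.smul_apply, smul_eq_mul]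
  refine Measurable.tsum fun k => Measurable.mul_const ?_ _
  fun_prop

/-- The conditional law of a degree given `α`: the law of `N + s` with `N ∼ Poisson(n ^ α)`. -/
def shiftedPoisson (n s : ℕ) : Kernel ℝ ℕ where
  toFun α := (poissonMeasure ((n : ℝ≥0) ^ α)).map (fun k => k + s)
  measurable' := by
    refine (Measure.measurable_map _ (by fun_prop)).comp (measurable_poissonMeasure.comp ?_)
    fun_prop

/-- The hierarchical shifted Poisson law: `α ∼ Unif(1/3, 2/3)` and, given `α`, the degree has the
law of `N + s` with `N ∼ Poisson(n ^ α)`. -/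
def degreeLaw (n s : ℕ) : Measure ℕ :=
  (cond volume (Icc (1 / 3 : ℝ) (2 / 3))).bind (shiftedPoisson n s)

/-- The empirical prior of `(l₁, l₂, m)` for sample size `n`: independent degrees, with shift `1`
for `l₁` and `l₂` and shift `2` for `m`. -/
def empiricalPrior (n : ℕ) : Measure (ℕ × ℕ × ℕ) :=
  (degreeLaw n 1).prod ((degreeLaw n 1).prod (degreeLaw n 2))

/-- The conditional supremum norm: the supremum of `|g|` over `[0, 1]²`. -/
def supNorm (g : ℝ → ℝ → ℝ) : ℝ≥0∞ :=
  ⨆ u₁ ∈ Icc (0 : ℝ) 1, ⨆ u₂ ∈ Icc (0 : ℝ) 1, ‖g u₁ u₂‖ₑ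

/-- `E(‖C^# - c‖(v))` for the estimator `C^#` computed from the sample `z` of size `n`, where the
expectation is over the empirical prior of the degrees, the sample being held fixed. -/
def expectedError {n : ℕ} (z : Fin n → Fin 3 → ℝ) (c : ℝ → ℝ → ℝ) (v : ℝ) : ℝ≥0∞ :=
  ∫⁻ q, supNorm (fun u₁ u₂ => estimator ![q.1, q.2.1, q.2.2] z v u₁ u₂ - c u₁ u₂)
    ∂(empiricalPrior n)

/-! ### The population: `Q` is the law of `((Y₁, Y₂), X)` -/

/-- The law of `Y_j`. -/
def lawY (Q : Measure ((Fin 2 → ℝ) × ℝ)) (j : Fin 2) : Measure ℝ := Q.map (fun p => p.1 j)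

/-- The law of the covariate `X`. -/
def lawX (Q : Measure ((Fin 2 → ℝ) × ℝ)) : Measure ℝ := Q.map Prod.snd

/-- The conditional law of `Y_j` given `X = x`. -/
def condLaw (Q : Measure ((Fin 2 → ℝ) × ℝ)) [IsProbabilityMeasure Q] (j : Fin 2) : Kernel ℝ ℝ :=
  condDistrib (fun p : (Fin 2 → ℝ) × ℝ => p.1 j) Prod.snd Q

/-- The map `((y₁, y₂), x) ↦ (F_{1x}(y₁), F_{2x}(y₂), F_X(x))`, which sends the data to the
covariate-adjusted responses and the transformed covariate `(U₁, U₂, V)`. -/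
def adjust (Q : Measure ((Fin 2 → ℝ) × ℝ)) [IsProbabilityMeasure Q] (p : (Fin 2 → ℝ) × ℝ) :
    Fin 3 → ℝ :=
  ![cdf (condLaw Q 0 p.2) (p.1 0), cdf (condLaw Q 1 p.2) (p.1 1), cdf (lawX Q) p.2]

theorem measurable_adjust (Q : Measure ((Fin 2 → ℝ) × ℝ)) [IsProbabilityMeasure Q] :
    Measurable (adjust Q) := by
  have key : ∀ j : Fin 2, Measurable fun p : (Fin 2 → ℝ) × ℝ => cdf (condLaw Q j p.2) (p.1 j) := by
    intro j
    have hM : IsMarkovKernel (condLaw Q j) := by unfold condLaw; infer_instance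
    have hs : MeasurableSet {q : (ℝ × ℝ) × ℝ | q.2 ≤ q.1.2} :=
      measurableSet_le (by fun_prop) (by fun_prop)
    have h := (Kernel.measurable_kernel_prodMk_left
      (κ := (condLaw Q j).comap (Prod.fst : ℝ × ℝ → ℝ) measurable_fst) hs).ennreal_toReal
    have h2 := h.comp (g := fun q : ℝ × ℝ =>
      ((condLaw Q j).comap (Prod.fst : ℝ × ℝ → ℝ) measurable_fst q
        (Prod.mk q ⁻¹' {q : (ℝ × ℝ) × ℝ | q.2 ≤ q.1.2})).toReal)
      (f := fun p : (Fin 2 → ℝ) × ℝ => (p.2, p.1 j)) (by fun_prop)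
    convert h2 using 2 with p
    rw [cdf_eq_real]
    rfl
  refine measurable_pi_lambda _ fun k => ?_
  fin_cases k
  · exact key 0
  · exact key 1
  · exact (monotone_cdf _).measurable.comp measurable_snd

/-- The law of `(U₁, U₂, V)`. -/
def adjustedLaw (Q : Measure ((Fin 2 → ℝ) × ℝ)) [IsProbabilityMeasure Q] :
    Measure (Fin 3 → ℝ) :=
  Q.map (adjust Q)

/-- The trivariate copula `C(u₁, u₂, v) = P(U₁ ≤ u₁, U₂ ≤ u₂, V ≤ v)`: the joint distribution
function of the uniformly distributed variables `U₁`, `U₂`, `V`. -/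
def copula (Q : Measure ((Fin 2 → ℝ) × ℝ)) [IsProbabilityMeasure Q] (u : Fin 3 → ℝ) : ℝ :=
  (adjustedLaw Q).real (Iic u)

/-- The conditional copula `C_v(u₁, u₂ | v) = ∂C(u₁, u₂, v) / ∂v`, one-sided at `v = 0, 1`. -/
def condCopula (Q : Measure ((Fin 2 → ℝ) × ℝ)) [IsProbabilityMeasure Q] (v u₁ u₂ : ℝ) : ℝ :=
  derivWithin (fun t => copula Q ![u₁, u₂, t]) (Icc 0 1) v

/-- The copula of `(Y_j, X)`: the joint distribution function of `(F_{Y_j}(Y_j), F_X(X))`. -/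
def pairCopula (Q : Measure ((Fin 2 → ℝ) × ℝ)) (j : Fin 2) (w v : ℝ) : ℝ :=
  Q.real {p | cdf (lawY Q j) (p.1 j) ≤ w ∧ cdf (lawX Q) p.2 ≤ v}

/-! ### The pseudo-observations computed from the data -/

/-- The estimate `F̂_x(y)` of the conditional distribution function of a response given the
covariate: the derivative with respect to `v`, at `v = F_{nX}(x)`, of the bivariate ECBC with
degrees `(g, m)` of the pseudo-observations `(F_{nY}(yᵢ), F_{nX}(xᵢ))`. -/
def condCDFEstimate {n : ℕ} (g m : ℕ) (ys xs : Fin n → ℝ) (x y : ℝ) : ℝ :=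
  deriv (fun t => ecbc ![g, m] (fun i => ![modifiedECDF ys (ys i), modifiedECDF xs (xs i)])
    ![modifiedECDF ys y, t]) (modifiedECDF xs x)

/-- The sample `(Û_{i1}, Û_{i2}, V̂_i)` of covariate-adjusted pseudo-observations, where
`Û_{ij} = F̂_{j X_i}(Y_{ij})` is computed with degrees `(g j, m j)` and `V̂_i = F_{nX}(X_i)`. -/
def pseudoSample {n : ℕ} (g m : Fin 2 → ℕ) (D : Fin n → (Fin 2 → ℝ) × ℝ) (i : Fin n) :
    Fin 3 → ℝ :=
  ![condCDFEstimate (g 0) (m 0) (fun k => (D k).1 0) (fun k => (D k).2) (D i).2 ((D i).1 0),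
    condCDFEstimate (g 1) (m 1) (fun k => (D k).1 1) (fun k => (D k).2) (D i).2 ((D i).1 1),
    modifiedECDF (fun k => (D k).2) (D i).2]

end ECBC

end

open ECBC

/-! The ECBC sees a sample only through its ranks, so `X i` may be replaced by `V i = F_X(X i)`.
Differentiating it in `v` gives a weighted mean (`ecbcDeriv_eq`): the sum of `W i * B₁ i * B₂ i`,
where the weights `W i` depend only on the covariate ranks and `B_j i` is the Bernstein polynomial,
at `u_j`, of the distribution function of the cell of observation `i`. For a large degree, `B_j i`
is nearly the indicator of `U_ij ≤ u_j`. The weights are nonnegative, sum to `1`, are at most `m /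
n`, and have a small second moment about `v`. The derivative is thus a kernel-type estimate of `P(U₁
≤ u₁, U₂ ≤ u₂ | V = v) = C_v(u₁, u₂ | v)`.

Fluctuation: given the covariates, the weights are constants and the indicators are independent, so
a conditional Hoeffding inequality (`hoeffding_cond`) bounds a deviation by `2 exp(-2 ε² n / m)`.
For `m ≤ n ^ β` with `β < 1` this is summable even after a union over all such degrees and over the
points `k / (n + 1)`; Borel–Cantelli gives `LocalLLN`. Bias: the weights concentrate at `v` and
`C_v` is continuous. Comparing with indicators at a finite grid of levels makes everything uniform
in `(u₁, u₂)`. The result, `consistency`, is deterministic: it holds for all samples whose ranks are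
close to the true `U₁`, `U₂`, except possibly at extreme covariates.

In (i), closeness of ranks is Glivenko–Cantelli. In (ii), `consistency` is first applied to `(Y_j,
X)`: the estimated conditional distribution functions approach `∂_v C_j` at `(F_{Y_j}(Y_j),
F_X(X))`, which is almost surely `U_j` (`ae_adjustedY_eq`). The approximation may fail at extreme
covariates, but these are few and shift ranks only slightly (`rankClose_of_approx`), so
`consistency` applies a second time.

From the derivative to the estimator: `U_j` is independent of `V`, hence `C_v(t, 1 | v) = t = C_v(1,
t | v)`. The estimated margins are therefore near the identity, and so are their inverses
(`abs_quantile_sub_le`). Finally, the prior gives mass tending to `1` to the degrees for which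
`consistency` applies, and the error never exceeds `1` (`tendsto_expectedError`). -/

noncomputable section

namespace ECBC

/-! ### Bernstein polynomials of univariate functions -/

/-- The value at `u` of the Bernstein basis polynomial `h` of degree `l`. -/
def bw (l h : ℕ) (u : ℝ) : ℝ := (bernsteinPolynomial ℝ l h).eval u

theorem bw_nonneg {l h : ℕ} {u : ℝ} (hu : u ∈ Icc (0 : ℝ) 1) : 0 ≤ bw l h u := by
  have h1 : 0 ≤ 1 - u := by linarith [hu.2]
  have h0 := hu.1
  simp only [bw, bernsteinPolynomial, Polynomial.eval_mul, Polynomial.eval_natCast,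
    Polynomial.eval_pow, Polynomial.eval_X, Polynomial.eval_sub, Polynomial.eval_one]
  positivity

theorem sum_bw (l : ℕ) (u : ℝ) : ∑ h ∈ Finset.range (l + 1), bw l h u = 1 := by
  have := congrArg (Polynomial.eval u) (bernsteinPolynomial.sum ℝ l)
  simpa [Polynomial.eval_finsetSum, bw] using this

theorem bw_le_one {l h : ℕ} {u : ℝ} (hu : u ∈ Icc (0 : ℝ) 1) : bw l h u ≤ 1 := by
  by_cases hh : h ≤ l
  · rw [← sum_bw l u]
    exact Finset.single_le_sum (f := fun h => bw l h u) (fun _ _ => bw_nonneg hu)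
      (Finset.mem_range.2 (by omega))
  · rw [bw, bernsteinPolynomial.eq_zero_of_lt _ (by omega)]
    simp

theorem variance_bw (l : ℕ) (u : ℝ) :
    ∑ h ∈ Finset.range (l + 1), (l * u - h) ^ 2 * bw l h u = l * u * (1 - u) := by
  have := congrArg (Polynomial.eval u) (bernsteinPolynomial.variance ℝ l)
  simpa [Polynomial.eval_finsetSum, bw] using this

theorem bw_at_one (l h : ℕ) : bw l h 1 = if h = l then 1 else 0 :=
  bernsteinPolynomial.eval_at_1 ℝ l h

/-- The univariate Bernstein polynomial of degree `l` of `f`. -/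
def bern (l : ℕ) (f : ℝ → ℝ) (u : ℝ) : ℝ :=
  ∑ h ∈ Finset.range (l + 1), f (h / l) * bw l h u

theorem bern_nonneg {l : ℕ} {f : ℝ → ℝ} {u : ℝ} (hu : u ∈ Icc (0 : ℝ) 1) (hf : ∀ t, 0 ≤ f t) :
    0 ≤ bern l f u :=
  Finset.sum_nonneg fun _ _ => mul_nonneg (hf _) (bw_nonneg hu)

theorem bern_le_one {l : ℕ} {f : ℝ → ℝ} {u : ℝ} (hu : u ∈ Icc (0 : ℝ) 1) (hf : ∀ t, f t ≤ 1) :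
    bern l f u ≤ 1 := by
  rw [← sum_bw l u]
  exact Finset.sum_le_sum fun h _ => mul_le_of_le_one_left (bw_nonneg hu) (hf _)

theorem bern_one_sub (l : ℕ) (f : ℝ → ℝ) (u : ℝ) :
    bern l (fun t => 1 - f t) u = 1 - bern l f u := by
  simp only [bern, sub_mul, Finset.sum_sub_distrib, one_mul, sum_bw]

theorem bern_at_one {l : ℕ} (hl : 1 ≤ l) (f : ℝ → ℝ) : bern l f 1 = f 1 := by
  have hl0 : (l : ℝ) ≠ 0 := by positivity
  simp [bern, bw_at_one, hl0]

/-- If `f ≤ 1` vanishes on the grid points within `η` of `u`, its Bernstein polynomial is small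
at `u`. -/
theorem bern_le_of_vanish {l : ℕ} (hl : 1 ≤ l) {f : ℝ → ℝ} {u η : ℝ} (hη : 0 < η)
    (hu : u ∈ Icc (0 : ℝ) 1) (hf : ∀ t, f t ≤ 1)
    (hz : ∀ t, |u - t| < η → f t ≤ 0) : bern l f u ≤ 1 / (4 * l * η ^ 2) := by
  have hl0 : (0 : ℝ) < l := by positivity
  -- Chebyshev's argument: the quadratic is at least `1` wherever `f` may be positive, and its
  -- Bernstein mean is the binomial variance, where `u (1 - u) ≤ 1 / 4`.
  have key : ∀ h : ℕ, f (h / l) ≤ (l * u - h) ^ 2 / (l * η) ^ 2 := by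
    intro h
    by_cases hh : |u - h / l| < η
    · exact (hz _ hh).trans (by positivity)
    · refine (hf _).trans ?_
      rw [one_le_div (by positivity)]
      have h2 : l * u - h = l * (u - h / l) := by field_simp
      rw [h2, mul_pow, mul_pow]
      refine mul_le_mul_of_nonneg_left ?_ (by positivity)
      rw [← sq_abs (u - h / l)]
      exact pow_le_pow_left₀ hη.le (not_lt.1 hh) 2
  calc bern l f u ≤ ∑ h ∈ Finset.range (l + 1), (l * u - h) ^ 2 / (l * η) ^ 2 * bw l h u :=
        Finset.sum_le_sum fun h _ => mul_le_mul_of_nonneg_right (key h) (bw_nonneg hu)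
    _ = l * u * (1 - u) / (l * η) ^ 2 := by
        rw [← variance_bw, Finset.sum_div]
        exact Finset.sum_congr rfl fun h _ => by ring
    _ ≤ 1 / (4 * l * η ^ 2) := by
        rw [div_le_div_iff₀ (by positivity) (by positivity)]
        have : u * (1 - u) ≤ 1 / 4 := by nlinarith [sq_nonneg (u - 1 / 2)]
        have h4 : 0 ≤ (l * η) ^ 2 := by positivity
        nlinarith [mul_le_mul_of_nonneg_left this h4]

/-- Summation by parts moves the difference of consecutive basis polynomials of degree `m - 1` onto
`f`. For monotone `f` all terms are then nonnegative on `[0, 1]`, which is the source of the weights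
`vWeight`. -/
theorem hasDerivAt_bern {m : ℕ} (hm : 1 ≤ m) (f : ℝ → ℝ) (v : ℝ) :
    HasDerivAt (bern m f) (∑ h ∈ Finset.range m,
      m * (f ((h + 1 : ℝ) / m) - f (h / m)) * bw (m - 1) h v) v := by
  obtain ⟨k, rfl⟩ : ∃ k, m = k + 1 := ⟨m - 1, by omega⟩
  have h1 : HasDerivAt (bern (k + 1) f) (∑ h ∈ Finset.range (k + 1 + 1), f (h / (k + 1 : ℕ)) *
      (Polynomial.derivative (bernsteinPolynomial ℝ (k + 1) h)).eval v) v := by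
    unfold bern bw
    refine HasDerivAt.fun_sum fun h _ => ?_
    exact (Polynomial.hasDerivAt _ v).const_mul _
  convert h1 using 1
  rw [Finset.sum_range_succ' (fun h : ℕ => f (h / (k + 1 : ℕ)) *
      (Polynomial.derivative (bernsteinPolynomial ℝ (k + 1) h)).eval v)]
  simp only [bernsteinPolynomial.derivative_succ, bernsteinPolynomial.derivative_zero,
    Nat.add_sub_cancel, Polynomial.eval_mul, Polynomial.eval_sub, Polynomial.eval_natCast,
    Polynomial.eval_neg]
  have h0 : ∀ l h : ℕ, (bernsteinPolynomial ℝ l h).eval v = bw l h v := fun _ _ => rfl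
  simp only [h0]
  have h2 := Finset.sum_range_succ' (fun h : ℕ => f (h / (k + 1 : ℕ)) * bw k h v) (k + 1)
  rw [Finset.sum_range_succ] at h2
  have h3 : bw k (k + 1) v = 0 := by
    rw [bw, bernsteinPolynomial.eq_zero_of_lt _ (by omega)]; simp
  rw [h3, mul_zero, add_zero] at h2
  have h4 : ∀ h : ℕ, ((k + 1 : ℕ) : ℝ) * (f ((h + 1 : ℝ) / (k + 1 : ℕ)) - f (h / (k + 1 : ℕ))) *
      bw k h v = ((k + 1 : ℕ) : ℝ) * (f (((h + 1 : ℕ) : ℝ) / (k + 1 : ℕ)) * bw k h v) -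
        ((k + 1 : ℕ) : ℝ) * (f (h / (k + 1 : ℕ)) * bw k h v) := by
    intro h; push_cast; ring
  have h5 : ∀ h : ℕ, f (((h + 1 : ℕ) : ℝ) / (k + 1 : ℕ)) *
      (((k + 1 : ℕ) : ℝ) * (bw k h v - bw k (h + 1) v)) =
      ((k + 1 : ℕ) : ℝ) * (f (((h + 1 : ℕ) : ℝ) / (k + 1 : ℕ)) * bw k h v) -
        ((k + 1 : ℕ) : ℝ) * (f (((h + 1 : ℕ) : ℝ) / (k + 1 : ℕ)) * bw k (h + 1) v) := by
    intro h; ring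
  simp only [h4, h5, Finset.sum_sub_distrib, ← Finset.mul_sum]
  rw [h2]
  ring

/-! ### Ranks and the cells of a sample -/

theorem countLT_eq {n : ℕ} (x : Fin n → ℝ) (t : ℝ) :
    countLT x t = (Finset.univ.filter fun i => x i < t).card := by
  rw [countLT, Nat.card_eq_fintype_card, Fintype.card_subtype]

theorem countLE_eq {n : ℕ} (x : Fin n → ℝ) (t : ℝ) :
    countLE x t = (Finset.univ.filter fun i => x i ≤ t).card := by
  rw [countLE, Nat.card_eq_fintype_card, Fintype.card_subtype]

theorem countLE_le {n : ℕ} (x : Fin n → ℝ) (t : ℝ) : countLE x t ≤ n := by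
  rw [countLE_eq]
  exact (Finset.card_le_univ _).trans (by simp)

theorem countLE_mono {n : ℕ} (x : Fin n → ℝ) : Monotone (countLE x) := by
  intro s t hst
  rw [countLE_eq, countLE_eq]
  exact Finset.card_le_card fun i hi => by
    simp only [Finset.mem_filter, Finset.mem_univ, true_and] at hi ⊢
    exact hi.trans hst

theorem countLT_lt_countLE {n : ℕ} (x : Fin n → ℝ) (i : Fin n) :
    countLT x (x i) < countLE x (x i) := by
  rw [countLE_eq, countLT_eq]
  refine Finset.card_lt_card ?_
  rw [Finset.ssubset_iff_of_subset (fun j hj => by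
    simp only [Finset.mem_filter, Finset.mem_univ, true_and] at hj ⊢; exact hj.le)]
  exact ⟨i, by simp, by simp⟩

theorem countLT_lt {n : ℕ} (x : Fin n → ℝ) (i : Fin n) : countLT x (x i) < n :=
  (countLT_lt_countLE x i).trans_le (countLE_le _ _)

theorem countLE_of_injective {n : ℕ} {x : Fin n → ℝ} (hx : Function.Injective x) (i : Fin n) :
    countLE x (x i) = countLT x (x i) + 1 := by
  rw [countLE_eq, countLT_eq, ← Finset.card_insert_of_notMem (a := i) (by simp)]
  congr 1
  ext j
  simp only [Finset.mem_filter, Finset.mem_univ, true_and, Finset.mem_insert]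
  constructor
  · intro h
    rcases h.lt_or_eq with h | h
    · exact Or.inr h
    · exact Or.inl (hx h)
  · rintro (rfl | h)
    · exact le_rfl
    · exact h.le

theorem countLT_strictMono_on {n : ℕ} (x : Fin n → ℝ) {i j : Fin n} (h : x i < x j) :
    countLT x (x i) < countLT x (x j) := by
  refine (countLT_lt_countLE x i).trans_le ?_
  rw [countLE_eq, countLT_eq]
  exact Finset.card_le_card fun k hk => by
    simp only [Finset.mem_filter, Finset.mem_univ, true_and] at hk ⊢
    exact hk.trans_lt h

theorem countLE_lt_iff {n : ℕ} (x : Fin n → ℝ) {i j : Fin n} :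
    countLE x (x i) < countLE x (x j) ↔ x i < x j := by
  constructor
  · intro h
    by_contra h'
    exact absurd (countLE_mono x (not_lt.1 h')) (not_le.2 h)
  · intro h
    refine lt_of_le_of_lt ?_ (countLT_lt_countLE x j)
    rw [countLE_eq, countLT_eq]
    exact Finset.card_le_card fun k hk => by
      simp only [Finset.mem_filter, Finset.mem_univ, true_and] at hk ⊢
      exact hk.trans_lt h

/-- The rank transform keeps the strict order of the data, so the ECBC of the transformed sample is
the ECBC of the raw one. -/
theorem modifiedECDF_lt_iff {n : ℕ} (x : Fin n → ℝ) (i j : Fin n) :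
    modifiedECDF x (x i) < modifiedECDF x (x j) ↔ x i < x j := by
  rw [modifiedECDF, modifiedECDF, div_lt_div_iff_of_pos_right (by positivity), Nat.cast_lt,
    countLE_lt_iff]

theorem countLT_congr {n : ℕ} {x y : Fin n → ℝ} (h : ∀ i j, x i < x j ↔ y i < y j) (i : Fin n) :
    countLT x (x i) = countLT y (y i) := by
  simp only [countLT_eq, h]

theorem countLE_congr {n : ℕ} {x y : Fin n → ℝ} (h : ∀ i j, x i < x j ↔ y i < y j) (i : Fin n) :
    countLE x (x i) = countLE y (y i) := by
  simp only [countLE_eq, ← not_lt, h]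

/-- Only the order enters the cells. This is what allows `X`, `F_X(X)` and `F_{nX}(X)` to be
interchanged throughout. -/
theorem cellCDF_congr {n : ℕ} {x y : Fin n → ℝ} (h : ∀ i j, x i < x j ↔ y i < y j) :
    cellCDF x = cellCDF y := by
  funext i t
  rw [cellCDF, cellCDF, countLT_congr h, countLE_congr h]

theorem cellCDF_nonneg {n : ℕ} (x : Fin n → ℝ) (i : Fin n) (t : ℝ) : 0 ≤ cellCDF x i t :=
  le_min (le_max_right _ _) zero_le_one

theorem cellCDF_le_one {n : ℕ} (x : Fin n → ℝ) (i : Fin n) (t : ℝ) : cellCDF x i t ≤ 1 :=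
  min_le_right _ _

theorem cell_length_pos {n : ℕ} (x : Fin n → ℝ) (i : Fin n) :
    (0 : ℝ) < countLE x (x i) - countLT x (x i) :=
  sub_pos.2 (by exact_mod_cast countLT_lt_countLE x i)

theorem cellCDF_mono {n : ℕ} (x : Fin n → ℝ) (i : Fin n) : Monotone (cellCDF x i) := by
  intro s t hst
  refine min_le_min_right _ (max_le_max_right _ ?_)
  refine div_le_div_of_nonneg_right ?_ (cell_length_pos x i).le
  gcongr

theorem cellCDF_eq_one {n : ℕ} (x : Fin n → ℝ) (i : Fin n) {t : ℝ}
    (h : (countLE x (x i) : ℝ) ≤ n * t) : cellCDF x i t = 1 := by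
  refine min_eq_right (le_max_of_le_left ?_)
  rw [one_le_div (cell_length_pos x i)]
  linarith

theorem cellCDF_eq_zero {n : ℕ} (x : Fin n → ℝ) (i : Fin n) {t : ℝ}
    (h : n * t ≤ (countLT x (x i) : ℝ)) : cellCDF x i t = 0 := by
  rw [cellCDF, max_eq_right]
  · simp
  · exact div_nonpos_of_nonpos_of_nonneg (by linarith) (cell_length_pos x i).le

theorem cellCDF_at_one {n : ℕ} (x : Fin n → ℝ) (i : Fin n) : cellCDF x i 1 = 1 :=
  cellCDF_eq_one x i (by rw [mul_one]; exact_mod_cast countLE_le _ _)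

theorem cellCDF_of_injective {n : ℕ} {x : Fin n → ℝ} (hx : Function.Injective x) (i : Fin n)
    (t : ℝ) : cellCDF x i t = min (max (n * t - countLT x (x i)) 0) 1 := by
  rw [cellCDF, countLE_of_injective hx]
  simp

/-- The `r`-th summand is the length of the part of `[r, r + 1]` below `y`, and these intervals tile
`[0, N]`. -/
theorem sum_clip (N : ℕ) (y : ℝ) :
    ∑ r ∈ Finset.range N, min (max (y - r) 0) 1 = min (max y 0) N := by
  induction N with
  | zero => simp
  | succ N ih =>
    rw [Finset.sum_range_succ, ih]
    push_cast
    have hN : (0 : ℝ) ≤ N := by positivity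
    rcases le_total y 0 with h | h
    · rw [max_eq_right h, max_eq_right (by linarith)]
      simp [hN, show (0 : ℝ) ≤ N + 1 by linarith]
    · rw [max_eq_left h]
      rcases le_total y N with h' | h'
      · rw [min_eq_left h', max_eq_right (by linarith), min_eq_left (by linarith),
          min_eq_left (by linarith), add_zero]
      · rw [min_eq_right h', max_eq_left (by linarith)]
        rcases le_total y (N + 1) with h'' | h''
        · rw [min_eq_left h'', min_eq_left (by linarith)]; ring
        · rw [min_eq_right h'', min_eq_right (by linarith)]

theorem sum_rank {n : ℕ} {x : Fin n → ℝ} (hx : Function.Injective x) (f : ℕ → ℝ) :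
    ∑ i, f (countLT x (x i)) = ∑ r ∈ Finset.range n, f r := by
  rw [← Fin.sum_univ_eq_sum_range]
  let e : Fin n → Fin n := fun i => ⟨countLT x (x i), countLT_lt x i⟩
  have he : Function.Injective e := by
    intro i j hij
    have hij' : countLT x (x i) = countLT x (x j) := congrArg Fin.val hij
    by_contra hne
    rcases lt_or_gt_of_ne (hx.ne hne) with h | h
    · exact absurd (countLT_strictMono_on x h) (by omega)
    · exact absurd (countLT_strictMono_on x h) (by omega)
  exact Fintype.sum_bijective e (Finite.injective_iff_bijective.1 he) _ _ fun i => rfl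

/-- Without ties the cells tile the unit interval, so the checkerboard copula has exactly uniform
margins. -/
theorem sum_cellCDF {n : ℕ} {x : Fin n → ℝ} (hx : Function.Injective x) {t : ℝ}
    (ht : t ∈ Icc (0 : ℝ) 1) : ∑ i, cellCDF x i t = n * t := by
  simp only [cellCDF_of_injective hx]
  rw [sum_rank hx (fun r => min (max (n * t - r) 0) 1), sum_clip, max_eq_left, min_eq_left]
  · exact mul_le_of_le_one_right (by positivity) ht.2
  · exact mul_nonneg (by positivity) ht.1

/-! ### The weights of the observations -/

/-- The weight of the `i`-th observation in the ECBC estimate of a conditional distribution at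
`v`. -/
def vWeight {n : ℕ} (m : ℕ) (v : ℝ) (x : Fin n → ℝ) (i : Fin n) : ℝ :=
  (1 / n : ℝ) * ∑ h ∈ Finset.range m,
    m * (cellCDF x i ((h + 1 : ℝ) / m) - cellCDF x i (h / m)) * bw (m - 1) h v

theorem vWeight_congr {n : ℕ} {x y : Fin n → ℝ} (h : ∀ i j, x i < x j ↔ y i < y j) (m : ℕ)
    (v : ℝ) : vWeight m v x = vWeight m v y := by
  funext i
  rw [vWeight, vWeight, cellCDF_congr h]

theorem cell_increment_nonneg {n : ℕ} (m h : ℕ) (x : Fin n → ℝ) (i : Fin n) :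
    0 ≤ cellCDF x i ((h + 1 : ℝ) / m) - cellCDF x i (h / m) :=
  sub_nonneg.2 (cellCDF_mono x i (div_le_div_of_nonneg_right (by linarith) (by positivity)))

theorem vWeight_nonneg {n : ℕ} (m : ℕ) {v : ℝ} (hv : v ∈ Icc (0 : ℝ) 1) (x : Fin n → ℝ)
    (i : Fin n) : 0 ≤ vWeight m v x i := by
  refine mul_nonneg (by positivity) (Finset.sum_nonneg fun h _ => ?_)
  exact mul_nonneg (mul_nonneg (by positivity) (cell_increment_nonneg m h x i)) (bw_nonneg hv)

/-- Bounding the basis polynomials by `1` leaves a telescoping sum of increments of one distribution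
function. The bound `m / n` controls the Hoeffding exponent. -/
theorem vWeight_le {n : ℕ} (m : ℕ) {v : ℝ} (hv : v ∈ Icc (0 : ℝ) 1) (x : Fin n → ℝ)
    (i : Fin n) : vWeight m v x i ≤ m / n := by
  have h1 : ∑ h ∈ Finset.range m,
      m * (cellCDF x i ((h + 1 : ℝ) / m) - cellCDF x i (h / m)) * bw (m - 1) h v ≤
      ∑ h ∈ Finset.range m,
        m * (cellCDF x i (((h + 1 : ℕ) : ℝ) / m) - cellCDF x i (h / m)) := by
    refine Finset.sum_le_sum fun h _ => ?_
    push_cast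
    exact mul_le_of_le_one_right (mul_nonneg (by positivity) (cell_increment_nonneg m h x i))
      (bw_le_one hv)
  rw [← Finset.mul_sum, Finset.sum_range_sub (fun h : ℕ => cellCDF x i (h / m))] at h1
  have h2 : (m : ℝ) * (cellCDF x i (m / m) - cellCDF x i ((0 : ℕ) / m)) ≤ m :=
    mul_le_of_le_one_right (by positivity)
      (by linarith [cellCDF_le_one x i (m / m), cellCDF_nonneg x i ((0 : ℕ) / m)])
  rw [vWeight, one_div, div_eq_inv_mul]
  exact mul_le_mul_of_nonneg_left (h1.trans h2) (by positivity)

/-- By uniformity of the margin, each of the `m` slabs `[h / m, (h + 1) / m]` carries mass exactly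
`1 / m`. -/
theorem sum_cell_increment {n : ℕ} (hn : 1 ≤ n) {m h : ℕ} (hm : h < m) {x : Fin n → ℝ}
    (hx : Function.Injective x) :
    ∑ i, (1 / n : ℝ) * (m * (cellCDF x i ((h + 1 : ℝ) / m) - cellCDF x i (h / m))) = 1 := by
  have hm0 : (0 : ℝ) < m := by exact_mod_cast (show 0 < m by omega)
  have hn0 : (0 : ℝ) < n := by exact_mod_cast hn
  have hle : (h + 1 : ℝ) ≤ m := by exact_mod_cast hm
  rw [← Finset.mul_sum, ← Finset.mul_sum, Finset.sum_sub_distrib, sum_cellCDF hx, sum_cellCDF hx]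
  · field_simp
    ring
  · exact ⟨by positivity, div_le_one_of_le₀ (by linarith) (by positivity)⟩
  · exact ⟨by positivity, div_le_one_of_le₀ hle (by positivity)⟩

theorem sum_vWeight {n : ℕ} (hn : 1 ≤ n) {m : ℕ} (hm : 1 ≤ m) (v : ℝ) {x : Fin n → ℝ}
    (hx : Function.Injective x) : ∑ i, vWeight m v x i = 1 := by
  unfold vWeight
  simp only [Finset.mul_sum]
  rw [Finset.sum_comm]
  have h1 : ∀ h ∈ Finset.range m, ∑ i, (1 / n : ℝ) *
      (m * (cellCDF x i ((h + 1 : ℝ) / m) - cellCDF x i (h / m)) * bw (m - 1) h v) =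
      bw (m - 1) h v := by
    intro h hh
    have := sum_cell_increment hn (Finset.mem_range.1 hh) hx
    simp only [← mul_assoc] at this ⊢
    rw [← Finset.sum_mul, this, one_mul]
  rw [Finset.sum_congr rfl h1]
  have := sum_bw (m - 1) v
  rwa [Nat.sub_add_cancel hm] at this

/-- The weights are concentrated on the observations whose relative rank is close to `v`. -/
theorem sum_vWeight_mul_sq_le {n : ℕ} (hn : 1 ≤ n) {m : ℕ} (hm : 1 ≤ m) {v : ℝ}
    (hv : v ∈ Icc (0 : ℝ) 1) {x : Fin n → ℝ} (hx : Function.Injective x) {y : Fin n → ℝ} {η : ℝ}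
    (hη : 0 ≤ η) (hy : ∀ i, |y i - countLT x (x i) / n| ≤ η) :
    ∑ i, vWeight m v x i * (y i - v) ^ 2 ≤ 2 / m + 2 * (η + 2 / m + 1 / n) ^ 2 := by
  have hm0 : (0 : ℝ) < m := by exact_mod_cast (show 0 < m by omega)
  have hn0 : (0 : ℝ) < n := by exact_mod_cast hn
  set r : ℝ := η + 2 / m + 1 / n with hr
  have hr0 : 0 ≤ r := by positivity
  set a : Fin n → ℕ → ℝ := fun i h =>
    (1 / n : ℝ) * (m * (cellCDF x i ((h + 1 : ℝ) / m) - cellCDF x i (h / m))) with ha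
  have ha0 : ∀ i h, 0 ≤ a i h := fun i h =>
    mul_nonneg (by positivity) (mul_nonneg (by positivity) (cell_increment_nonneg m h x i))
  have key : ∀ i, ∀ h : ℕ, a i h * (y i - v) ^ 2 ≤
      a i h * (2 * ((((m - 1 : ℕ) : ℝ) * v - h) ^ 2 / m ^ 2) + 2 * r ^ 2) := by
    intro i h
    by_cases h0 : cellCDF x i ((h + 1 : ℝ) / m) - cellCDF x i (h / m) = 0
    · simp [ha, h0]
    refine mul_le_mul_of_nonneg_left ?_ (ha0 i h)
    -- A nonzero increment means that the cell of `i` meets the slab of `h`, which ties the relative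
    -- rank of `i` to `h / m`.
    have h1 : (countLT x (x i) : ℝ) < n * ((h + 1 : ℝ) / m) := by
      by_contra hc
      have e1 := cellCDF_eq_zero x i (not_lt.1 hc)
      have e2 := cell_increment_nonneg m h x i
      have e3 := cellCDF_nonneg x i (h / m)
      exact h0 (by linarith)
    have h2 : n * (h / m : ℝ) < countLT x (x i) + 1 := by
      by_contra hc
      have e1 := cellCDF_eq_one x i (t := (h / m : ℝ)) (by
        rw [countLE_of_injective hx]; push_cast; exact not_lt.1 hc)
      have e2 := cell_increment_nonneg m h x i
      have e3 := cellCDF_le_one x i ((h + 1 : ℝ) / m)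
      exact h0 (by linarith)
    have h3 : (countLT x (x i) : ℝ) / n < (h + 1) / m := by
      rw [div_lt_iff₀ hn0]; linarith
    have h4 : (h / m : ℝ) < countLT x (x i) / n + 1 / n := by
      rw [← add_div, lt_div_iff₀ hn0]; linarith
    rw [add_div] at h3
    have h5 := abs_le.1 (hy i)
    -- The basis has degree `m - 1` while the slabs have width `1 / m`, so `d` differs from `v - h /
    -- m` by `v / m`. The radius `r` absorbs this shift, the slab width, the cell length `1 / n` and
    -- the error `η`.
    set d : ℝ := (((m - 1 : ℕ) : ℝ) * v - h) / m with hd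
    have hd' : d = v - h / m - v / m := by
      rw [hd, Nat.cast_sub hm]; push_cast; field_simp; ring
    have hvm : v / m ≤ 1 / m := div_le_div_of_nonneg_right hv.2 hm0.le
    have hvm0 : 0 ≤ v / m := div_nonneg hv.1 hm0.le
    have h2m : (2 / m : ℝ) = 1 / m + 1 / m := by ring
    have hm1 : (0 : ℝ) < 1 / m := by positivity
    have hn1 : (0 : ℝ) < 1 / n := by positivity
    have h6 : |y i - v + d| ≤ r := by
      rw [abs_le, hd', hr, h2m]
      constructor <;> linarith [h5.1, h5.2]
    have h7 : (y i - v + d) ^ 2 ≤ r ^ 2 := sq_le_sq' (abs_le.1 h6).1 (abs_le.1 h6).2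
    rw [← div_pow, ← hd]
    -- This is `(a - d)² ≤ 2 a² + 2 d²` with `a = y i - v + d`.
    nlinarith [sq_nonneg (y i - v + 2 * d)]
  calc ∑ i, vWeight m v x i * (y i - v) ^ 2
      = ∑ i, ∑ h ∈ Finset.range m, a i h * (y i - v) ^ 2 * bw (m - 1) h v := by
        refine Finset.sum_congr rfl fun i _ => ?_
        rw [vWeight, Finset.mul_sum, Finset.sum_mul]
        exact Finset.sum_congr rfl fun h _ => by simp only [ha]; ring
    _ ≤ ∑ i, ∑ h ∈ Finset.range m,
        a i h * (2 * ((((m - 1 : ℕ) : ℝ) * v - h) ^ 2 / m ^ 2) + 2 * r ^ 2) * bw (m - 1) h v :=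
        Finset.sum_le_sum fun i _ => Finset.sum_le_sum fun h _ =>
          mul_le_mul_of_nonneg_right (key i h) (bw_nonneg hv)
    _ = ∑ h ∈ Finset.range m,
        (2 * ((((m - 1 : ℕ) : ℝ) * v - h) ^ 2 / m ^ 2) + 2 * r ^ 2) * bw (m - 1) h v := by
        rw [Finset.sum_comm]
        refine Finset.sum_congr rfl fun h hh => ?_
        simp only [mul_assoc]
        rw [← Finset.sum_mul]
        have := sum_cell_increment hn (Finset.mem_range.1 hh) hx
        simp only [ha]
        rw [this, one_mul]
    _ = 2 / m ^ 2 * ∑ h ∈ Finset.range (m - 1 + 1), ((((m - 1 : ℕ) : ℝ) * v - h) ^ 2 *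
          bw (m - 1) h v) + 2 * r ^ 2 * ∑ h ∈ Finset.range (m - 1 + 1), bw (m - 1) h v := by
        rw [Nat.sub_add_cancel hm, Finset.mul_sum, Finset.mul_sum, ← Finset.sum_add_distrib]
        exact Finset.sum_congr rfl fun h _ => by ring
    _ ≤ 2 / m + 2 * r ^ 2 := by
        rw [variance_bw, sum_bw, mul_one]
        have h1 : ((m - 1 : ℕ) : ℝ) * v * (1 - v) ≤ m := by
          have e1 : ((m - 1 : ℕ) : ℝ) ≤ m := by exact_mod_cast Nat.sub_le m 1
          have e2 : v * (1 - v) ≤ 1 := by nlinarith [hv.1, hv.2]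
          have e3 : 0 ≤ v * (1 - v) := mul_nonneg hv.1 (by linarith [hv.2])
          rw [mul_assoc]
          nlinarith
        have h2 : 2 / (m : ℝ) ^ 2 * (((m - 1 : ℕ) : ℝ) * v * (1 - v)) ≤ 2 / m ^ 2 * m :=
          mul_le_mul_of_nonneg_left h1 (by positivity)
        have h3 : 2 / (m : ℝ) ^ 2 * m = 2 / m := by field_simp
        linarith

/-! ### The estimators as weighted sums -/

/-- The checkerboard copula is a sum of products of univariate functions, and Bernstein smoothing is
linear and acts on each coordinate separately. -/
theorem ecbc_eq {n d : ℕ} (l : Fin d → ℕ) (z : Fin n → Fin d → ℝ) (u : Fin d → ℝ) :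
    ecbc l z u = (1 / n : ℝ) * ∑ i, ∏ k, bern (l k) (cellCDF (fun i' => z i' k) i) (u k) := by
  simp only [ecbc, bernsteinSmoothing, checkerboard, bern]
  simp only [Finset.prod_univ_sum, Finset.mul_sum, Finset.sum_mul]
  rw [Finset.sum_comm]
  refine Finset.sum_congr rfl fun i _ => Finset.sum_congr rfl fun h _ => ?_
  rw [Finset.prod_mul_distrib]
  simp only [bw]
  ring

/-- Only the last factor of each product depends on `v`; its derivative, divided by `n`, is the
weight. The weights involve the covariate alone, which makes conditioning on the covariates
effective. -/
theorem ecbcDeriv_eq {n : ℕ} {l : Fin 3 → ℕ} (hl : 1 ≤ l 2) (z : Fin n → Fin 3 → ℝ)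
    (v u₁ u₂ : ℝ) : ecbcDeriv l z v u₁ u₂ = ∑ i, vWeight (l 2) v (fun i' => z i' 2) i *
      (bern (l 0) (cellCDF (fun i' => z i' 0) i) u₁ *
        bern (l 1) (cellCDF (fun i' => z i' 1) i) u₂) := by
  rw [ecbcDeriv]
  refine HasDerivAt.deriv ?_
  simp only [ecbc_eq, Fin.prod_univ_three]
  simp only [Matrix.cons_val_zero, Matrix.cons_val_one, Matrix.cons_val]
  have := HasDerivAt.const_mul (1 / n : ℝ) (HasDerivAt.fun_sum (u := Finset.univ) fun i _ =>
    (hasDerivAt_bern hl (cellCDF (fun i' => z i' 2) i) v).const_mul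
      (bern (l 0) (cellCDF (fun i' => z i' 0) i) u₁ *
        bern (l 1) (cellCDF (fun i' => z i' 1) i) u₂))
  refine this.congr_deriv ?_
  rw [Finset.mul_sum]
  exact Finset.sum_congr rfl fun i _ => by rw [vWeight]; ring

theorem condCDFEstimate_eq {n g m : ℕ} (hm : 1 ≤ m) (ys xs : Fin n → ℝ) (x y : ℝ) :
    condCDFEstimate g m ys xs x y = ∑ i, vWeight m (modifiedECDF xs x) xs i *
      bern g (cellCDF ys i) (modifiedECDF ys y) := by
  rw [condCDFEstimate]
  refine HasDerivAt.deriv ?_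
  simp only [ecbc_eq, Fin.prod_univ_two]
  simp only [Matrix.cons_val_zero, Matrix.cons_val_one, Matrix.cons_val_fin_one]
  rw [cellCDF_congr (modifiedECDF_lt_iff ys), cellCDF_congr (modifiedECDF_lt_iff xs)]
  have := HasDerivAt.const_mul (1 / n : ℝ) (HasDerivAt.fun_sum (u := Finset.univ) fun i _ =>
    (hasDerivAt_bern hm (cellCDF xs i) (modifiedECDF xs x)).const_mul
      (bern g (cellCDF ys i) (modifiedECDF ys y)))
  refine this.congr_deriv ?_
  rw [Finset.mul_sum]
  exact Finset.sum_congr rfl fun i _ => by rw [vWeight]; ring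

/-! ### A conditional Hoeffding inequality -/

section Hoeffding

variable {E F : Type*} [MeasurableSpace E] [MeasurableSpace F]

/-- The product kernel `v ↦ ⨂ᵢ κ (vᵢ)`. -/
def piKernel (n : ℕ) (κ : Kernel F E) [IsMarkovKernel κ] : Kernel (Fin n → F) (Fin n → E) where
  toFun v := Measure.pi fun i => κ (v i)
  measurable' := by
    refine Measurable.measure_of_isPiSystem_of_isProbabilityMeasure generateFrom_pi.symm
      isPiSystem_pi ?_
    rintro _ ⟨s, hs, rfl⟩
    simp only [Set.mem_pi, Set.mem_univ, true_imp_iff, Set.mem_ofPred_eq] at hs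
    simp only [Measure.pi_pi]
    exact Finset.measurable_fun_prod _ fun i _ =>
      (κ.measurable_coe (hs i)).comp (measurable_pi_apply i)

theorem piKernel_apply (n : ℕ) (κ : Kernel F E) [IsMarkovKernel κ] (v : Fin n → F) :
    piKernel n κ v = Measure.pi fun i => κ (v i) := rfl

instance (n : ℕ) (κ : Kernel F E) [IsMarkovKernel κ] : IsMarkovKernel (piKernel n κ) :=
  ⟨fun v => by rw [piKernel_apply]; infer_instance⟩

/-- Drawing i.i.d. pairs amounts to drawing all first coordinates and then, given these, independent
second coordinates. On rectangles, both sides are products of the same integrals. -/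
theorem pi_compProd (n : ℕ) (ρ : Measure F) [IsProbabilityMeasure ρ] (κ : Kernel F E)
    [IsMarkovKernel κ] :
    Measure.pi (fun _ : Fin n => ρ ⊗ₘ κ) =
      ((Measure.pi fun _ : Fin n => ρ) ⊗ₘ piKernel n κ).map (fun p i => (p.1 i, p.2 i)) := by
  refine Measure.pi_eq fun s hs => ?_
  rw [Measure.map_apply (by fun_prop) (MeasurableSet.univ_pi hs),
    Measure.compProd_apply ((by fun_prop : Measurable fun (p : (Fin n → F) × (Fin n → E)) i =>
      (p.1 i, p.2 i)) (MeasurableSet.univ_pi hs))]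
  have h1 : ∀ v : Fin n → F, piKernel n κ v (Prod.mk v ⁻¹'
      ((fun (p : (Fin n → F) × (Fin n → E)) i => (p.1 i, p.2 i)) ⁻¹' (univ.pi s))) =
      ∏ i, κ (v i) (Prod.mk (v i) ⁻¹' s i) := by
    intro v
    rw [piKernel_apply, ← Measure.pi_pi]
    congr 1
  have hm : ∀ i, Measurable fun v : F => κ v (Prod.mk v ⁻¹' s i) := fun i =>
    Kernel.measurable_kernel_prodMk_left (hs i)
  simp only [h1]
  have hind : iIndepFun (fun (i : Fin n) (v : Fin n → F) => κ (v i) (Prod.mk (v i) ⁻¹' s i))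
      (Measure.pi fun _ : Fin n => ρ) :=
    iIndepFun_pi (X := fun i v => κ v (Prod.mk v ⁻¹' s i)) fun i => (hm i).aemeasurable
  rw [lintegral_prod_eq_prod_lintegral_of_indepFun Finset.univ _ hind
    fun i => (hm i).comp (measurable_pi_apply i)]
  refine Finset.prod_congr rfl fun i _ => ?_
  rw [Measure.compProd_apply (hs i)]
  have hmp := measurePreserving_eval (fun _ : Fin n => ρ) i
  exact hmp.lintegral_comp (f := fun v : F => κ v (Prod.mk v ⁻¹' s i)) (hm i)

theorem hasSubgaussianMGF_mono {Ω : Type*} [MeasurableSpace Ω] {μ : Measure Ω} {X : Ω → ℝ}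
    {c c' : ℝ≥0} (h : HasSubgaussianMGF X c μ) (hc : c ≤ c') : HasSubgaussianMGF X c' μ :=
  ⟨h.integrable_exp_mul, fun t => (h.mgf_le t).trans (Real.exp_le_exp.2 (by gcongr))⟩

/-- Hoeffding's inequality for a weighted sum of centred indicators of independent variables. -/
theorem hoeffding_pi {n : ℕ} (ν : Fin n → Measure E) [∀ i, IsProbabilityMeasure (ν i)]
    {B : Set E} (hB : MeasurableSet B) {w : Fin n → ℝ} {c : ℝ} (hw0 : ∀ i, 0 ≤ w i)
    (hwc : ∀ i, w i ≤ c) (hw1 : ∑ i, w i ≤ 1) (hc : 0 < c) {ε : ℝ} (hε : 0 ≤ ε) :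
    Measure.pi ν {e | ε ≤ |∑ i, w i * (B.indicator 1 (e i) - (ν i).real B)|} ≤
      ENNReal.ofReal (2 * Real.exp (-2 * ε ^ 2 / c)) := by
  have hBm : Measurable (B.indicator (1 : E → ℝ)) := measurable_one.indicator hB
  have hX : ∀ i, HasSubgaussianMGF (fun e : E => B.indicator (1 : E → ℝ) e - (ν i).real B)
      ((‖(1 : ℝ) - 0‖₊ / 2) ^ 2) (ν i) := by
    intro i
    have := hasSubgaussianMGF_of_mem_Icc (μ := ν i) (a := 0) (b := 1) hBm.aemeasurable
      (ae_of_all _ fun e => ⟨Set.indicator_nonneg (fun _ _ => zero_le_one) _,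
        Set.indicator_le_self' (s := B) (f := (1 : E → ℝ)) (fun _ _ => zero_le_one) e⟩)
    rwa [integral_indicator_one hB] at this
  have hX' : ∀ i, HasSubgaussianMGF
      (fun e : Fin n → E => w i * (B.indicator (1 : E → ℝ) (e i) - (ν i).real B))
      (Real.toNNReal (w i ^ 2 / 4)) (Measure.pi ν) := by
    intro i
    -- Hoeffding's lemma gives variance proxy `1 / 4` for a variable with values in `[0, 1]`;
    -- scaling multiplies it by `w i ^ 2`.
    have hpar : (NNReal.mk (w i ^ 2) (sq_nonneg _)) * (‖(1 : ℝ) - 0‖₊ / 2) ^ 2 ≤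
        Real.toNNReal (w i ^ 2 / 4) := by
      rw [← NNReal.coe_le_coe, Real.coe_toNNReal _ (by positivity), NNReal.coe_mul,
        NNReal.coe_pow, NNReal.coe_div, coe_nnnorm, NNReal.coe_mk, sub_zero, norm_one]
      norm_num
      linarith
    have h1 := hasSubgaussianMGF_mono ((hX i).const_mul (w i)) hpar
    have h2 : HasSubgaussianMGF (fun e : E => w i * (B.indicator (1 : E → ℝ) e - (ν i).real B))
        (Real.toNNReal (w i ^ 2 / 4)) ((Measure.pi ν).map (Function.eval i)) := by
      rwa [(measurePreserving_eval ν i).map_eq]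
    have h3 := HasSubgaussianMGF.of_map (Y := Function.eval i) (μ := Measure.pi ν)
      (measurable_pi_apply i).aemeasurable h2
    exact h3
  have hind : iIndepFun (fun (i : Fin n) (e : Fin n → E) =>
      w i * (B.indicator (1 : E → ℝ) (e i) - (ν i).real B)) (Measure.pi ν) :=
    iIndepFun_pi (X := fun i e => w i * (B.indicator (1 : E → ℝ) e - (ν i).real B)) fun i =>
      ((hBm.sub_const _).const_mul _).aemeasurable
  have hsum := HasSubgaussianMGF.sum_of_iIndepFun hind (s := Finset.univ) fun i _ => hX' i
  have hle : ∑ i, Real.toNNReal (w i ^ 2 / 4) ≤ Real.toNNReal (c / 4) := by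
    rw [← NNReal.coe_le_coe, Real.coe_toNNReal _ (by positivity)]
    push_cast
    simp only [Real.coe_toNNReal _ (show (0 : ℝ) ≤ w _ ^ 2 / 4 by positivity)]
    rw [← Finset.sum_div]
    -- The maximal weight times the total weight bounds the sum of squares, so the total proxy is `c
    -- / 4` and the exponent is `-ε² / (2 c / 4)`.
    have : ∑ i, w i ^ 2 ≤ c := by
      calc ∑ i, w i ^ 2 ≤ ∑ i, c * w i := Finset.sum_le_sum fun i _ => by
            rw [sq]; exact mul_le_mul_of_nonneg_right (hwc i) (hw0 i)
        _ ≤ c := by rw [← Finset.mul_sum]; exact mul_le_of_le_one_right hc.le hw1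
    linarith
  have hsum' := hasSubgaussianMGF_mono hsum hle
  have hexp : Real.exp (-ε ^ 2 / (2 * ((Real.toNNReal (c / 4) : ℝ≥0) : ℝ))) =
      Real.exp (-2 * ε ^ 2 / c) := by
    congr 1
    rw [Real.coe_toNNReal _ (by positivity)]
    field_simp
    norm_num
  have h1 := hsum'.measure_ge_le hε
  have h2 := hsum'.neg.measure_ge_le hε
  rw [hexp] at h1 h2
  have hsub : {e : Fin n → E | ε ≤ |∑ i, w i * (B.indicator 1 (e i) - (ν i).real B)|} ⊆
      {e | ε ≤ ∑ i, w i * (B.indicator (1 : E → ℝ) (e i) - (ν i).real B)} ∪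
      {e | ε ≤ (-fun e : Fin n → E => ∑ i, w i * (B.indicator (1 : E → ℝ) (e i) -
        (ν i).real B)) e} := by
    intro e he
    have he' : ε ≤ |∑ i, w i * (B.indicator (1 : E → ℝ) (e i) - (ν i).real B)| := he
    exact le_abs.1 he'
  rw [← ofReal_measureReal]
  refine ENNReal.ofReal_le_ofReal ((measureReal_mono hsub).trans
    ((measureReal_union_le _ _).trans ?_))
  linarith

/-- Hoeffding's inequality conditionally on the variables `φ (D i)`, for weights which depend on
these variables only. -/
theorem hoeffding_cond [StandardBorelSpace E] [Nonempty E] {Ω : Type*} [MeasurableSpace Ω]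
    {μ : Measure Ω} [IsProbabilityMeasure μ] {Q : Measure E} [IsProbabilityMeasure Q]
    {D : ℕ → Ω → E} (hmeas : ∀ i, Measurable (D i)) (hindep : iIndepFun D μ)
    (hlaw : ∀ i, μ.map (D i) = Q) {φ : E → F} (hφ : Measurable φ) {B : Set E}
    (hB : MeasurableSet B) {n : ℕ} {w : (Fin n → F) → Fin n → ℝ} (hwm : ∀ i, Measurable (w · i))
    {c : ℝ} (hw0 : ∀ x i, 0 ≤ w x i) (hwc : ∀ x i, w x i ≤ c) (hw1 : ∀ x, ∑ i, w x i ≤ 1)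
    (hc : 0 < c) {ε : ℝ} (hε : 0 ≤ ε) :
    μ {ω | ε ≤ |∑ i : Fin n, w (fun k => φ (D k ω)) i * (B.indicator 1 (D i ω) -
        (condDistrib id φ Q (φ (D i ω))).real B)|} ≤
      ENNReal.ofReal (2 * Real.exp (-2 * ε ^ 2 / c)) := by
  set κ := condDistrib id φ Q with hκ
  set G : (Fin n → F × E) → ℝ := fun z => ∑ i : Fin n, w (fun k => (z k).1) i *
    (B.indicator 1 (z i).2 - (κ (z i).1).real B) with hG
  have hGm : Measurable G := by
    refine Finset.measurable_fun_sum _ fun i _ => Measurable.mul ?_ (Measurable.sub ?_ ?_)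
    · exact (hwm i).comp (by fun_prop)
    · exact (measurable_one.indicator hB).comp (by fun_prop)
    · exact (κ.measurable_coe hB).ennreal_toReal.comp (by fun_prop)
  have hlaw' : μ.map (fun ω (i : Fin n) => (φ (D i ω), D i ω)) =
      Measure.pi fun _ : Fin n => Q.map φ ⊗ₘ κ := by
    have hi : iIndepFun (fun (i : Fin n) ω => (φ (D i ω), D i ω)) μ := by
      have := hindep.precomp (g := fun i : Fin n => (i : ℕ)) Fin.val_injective
      exact this.comp (fun _ d => (φ d, d)) fun _ => by fun_prop
    rw [(iIndepFun_iff_map_fun_eq_pi_map (fun i => (by fun_prop))).1 hi]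
    congr 1
    funext i
    rw [hκ, compProd_map_condDistrib aemeasurable_id, ← hlaw i,
      Measure.map_map (by fun_prop) (hmeas i)]
    rfl
  have hset : MeasurableSet {z : Fin n → F × E | ε ≤ |G z|} :=
    measurableSet_le measurable_const hGm.abs
  have hQφ : IsProbabilityMeasure (Q.map φ) := Measure.isProbabilityMeasure_map hφ.aemeasurable
  calc μ {ω | ε ≤ |∑ i : Fin n, w (fun k => φ (D k ω)) i * (B.indicator 1 (D i ω) -
        (κ (φ (D i ω))).real B)|}
      = μ.map (fun ω (i : Fin n) => (φ (D i ω), D i ω)) {z | ε ≤ |G z|} := by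
        rw [Measure.map_apply (by fun_prop) hset]
        rfl
    _ = ∫⁻ v, piKernel n κ v {e | ε ≤ |∑ i, w v i * (B.indicator 1 (e i) - (κ (v i)).real B)|}
          ∂(Measure.pi fun _ : Fin n => Q.map φ) := by
        rw [hlaw', pi_compProd, Measure.map_apply (by fun_prop) hset,
          Measure.compProd_apply ((by fun_prop : Measurable
            fun (p : (Fin n → F) × (Fin n → E)) i => (p.1 i, p.2 i)) hset)]
        rfl
    _ ≤ ∫⁻ _, ENNReal.ofReal (2 * Real.exp (-2 * ε ^ 2 / c))
          ∂(Measure.pi fun _ : Fin n => Q.map φ) :=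
        lintegral_mono fun v => by
          rw [piKernel_apply]
          exact hoeffding_pi (fun i => κ (v i)) hB (hw0 v) (hwc v) (hw1 v) hc hε
    _ = ENNReal.ofReal (2 * Real.exp (-2 * ε ^ 2 / c)) := by simp

end Hoeffding

/-! ### The local law of large numbers -/

theorem measurable_countLT {n : ℕ} (i : Fin n) :
    Measurable fun x : Fin n → ℝ => (countLT x (x i) : ℝ) := by
  simp only [countLT_eq, Finset.card_filter, Nat.cast_sum, Nat.cast_ite, Nat.cast_one,
    Nat.cast_zero]
  refine Finset.measurable_fun_sum _ fun j _ => Measurable.ite ?_ measurable_const measurable_const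
  exact measurableSet_lt (measurable_pi_apply j) (measurable_pi_apply i)

theorem measurable_countLE {n : ℕ} (i : Fin n) :
    Measurable fun x : Fin n → ℝ => (countLE x (x i) : ℝ) := by
  simp only [countLE_eq, Finset.card_filter, Nat.cast_sum, Nat.cast_ite, Nat.cast_one,
    Nat.cast_zero]
  refine Finset.measurable_fun_sum _ fun j _ => Measurable.ite ?_ measurable_const measurable_const
  exact measurableSet_le (measurable_pi_apply j) (measurable_pi_apply i)

theorem measurable_cellCDF {n : ℕ} (i : Fin n) (t : ℝ) :
    Measurable fun x : Fin n → ℝ => cellCDF x i t := by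
  unfold cellCDF
  exact ((((measurable_const.sub (measurable_countLT i)).div
    ((measurable_countLE i).sub (measurable_countLT i))).max measurable_const).min
    measurable_const)

theorem measurable_vWeight {n : ℕ} (m : ℕ) (v : ℝ) (i : Fin n) :
    Measurable fun x : Fin n → ℝ => vWeight m v x i := by
  unfold vWeight
  refine (Finset.measurable_fun_sum _ fun h _ => ?_).const_mul _
  exact (((measurable_cellCDF i _).sub (measurable_cellCDF i _)).const_mul _).mul_const _

theorem measurableSet_injective (n : ℕ) : MeasurableSet {x : Fin n → ℝ | Function.Injective x} := by
  have : {x : Fin n → ℝ | Function.Injective x} =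
      ⋂ i, ⋂ j, ⋂ (_ : i ≠ j), {x : Fin n → ℝ | x i = x j}ᶜ := by
    ext x
    simp only [Set.mem_iInter, Set.mem_compl_iff, Set.mem_ofPred_eq]
    exact ⟨fun h i j hij => h.ne hij, fun h i j hij => by_contra fun hne => h i j hne hij⟩
  rw [this]
  exact MeasurableSet.iInter fun i => MeasurableSet.iInter fun j => MeasurableSet.iInter fun _ =>
    (measurableSet_eq_fun (measurable_pi_apply i) (measurable_pi_apply j)).compl

/-- The evaluation points: a fixed point `v₀` and the points `k / (n + 1)`. -/
def node (v₀ : ℝ) (n k : ℕ) : ℝ := if k = 0 then v₀ else k / (n + 1)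

theorem node_mem {v₀ : ℝ} (hv₀ : v₀ ∈ Icc (0 : ℝ) 1) {n k : ℕ} (hk : k ≤ n) :
    node v₀ n k ∈ Icc (0 : ℝ) 1 := by
  unfold node
  split_ifs
  · exact hv₀
  · exact ⟨by positivity, div_le_one_of_le₀ (by norm_cast; omega) (by positivity)⟩

/-- The locally weighted averages of `b - q` tend to `0`, uniformly over the evaluation points and
over the degrees that are at most `n ^ β`. -/
def LocalLLN (V b q : ℕ → ℝ) (v₀ : ℝ) : Prop :=
  ∀ β < (1 : ℝ), ∀ ε > (0 : ℝ), ∀ᶠ n : ℕ in atTop, ∀ m : ℕ, 1 ≤ m → (m : ℝ) ≤ (n : ℝ) ^ β →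
    ∀ k ≤ n, |∑ i : Fin n, vWeight m (node v₀ n k) (fun i : Fin n => V i) i * (b i - q i)| ≤ ε

theorem summable_poly_mul_exp {a γ : ℝ} (ha : 0 < a) (hγ : 0 < γ) :
    Summable fun n : ℕ => ((n : ℝ) + 1) * (n + 1) * (2 * Real.exp (-a * (n : ℝ) ^ γ)) := by
  -- The power `-4 / γ` turns `n ^ γ` into `n⁻⁴`; after multiplication by the quadratic factor, the
  -- summable `n⁻²` remains.
  have h1 : (fun n : ℕ => Real.exp (-a * (n : ℝ) ^ γ)) =o[atTop]
      fun n : ℕ => ((n : ℝ) ^ γ) ^ (-4 / γ) :=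
    (isLittleO_exp_neg_mul_rpow_atTop ha (-4 / γ)).comp_tendsto
      ((tendsto_rpow_atTop hγ).comp tendsto_natCast_atTop_atTop)
  refine summable_of_isBigO_nat (g := fun n : ℕ => ((n : ℝ) ^ 2)⁻¹)
    (Real.summable_nat_pow_inv.2 one_lt_two) ?_
  have h2 : (fun n : ℕ => ((n : ℝ) + 1) * (n + 1)) =O[atTop] fun n : ℕ => (n : ℝ) ^ 2 := by
    refine Asymptotics.IsBigO.of_bound 4 ?_
    filter_upwards [eventually_ge_atTop 1] with n hn
    have hn' : (1 : ℝ) ≤ n := by exact_mod_cast hn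
    rw [Real.norm_of_nonneg (by positivity), Real.norm_of_nonneg (by positivity)]
    nlinarith
  have h3 : (fun n : ℕ => 2 * Real.exp (-a * (n : ℝ) ^ γ)) =O[atTop]
      fun n : ℕ => ((n : ℝ) ^ 4)⁻¹ := by
    refine (h1.isBigO.const_mul_left 2).trans (Asymptotics.IsBigO.of_bound 1 ?_)
    filter_upwards [eventually_ge_atTop 1] with n hn
    have hn' : (0 : ℝ) < n := by exact_mod_cast hn
    rw [← Real.rpow_mul hn'.le, mul_div_cancel₀ _ hγ.ne', Real.rpow_neg hn'.le, one_mul]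
    norm_cast
  refine (h2.mul h3).trans (Asymptotics.IsBigO.of_bound 1 ?_)
  filter_upwards [eventually_ge_atTop 1] with n hn
  have hn' : (0 : ℝ) < n := by exact_mod_cast hn
  rw [one_mul]
  refine le_of_eq ?_
  congr 1
  field_simp

section Law

variable {E : Type*} [MeasurableSpace E] {Ω : Type*} [MeasurableSpace Ω] {μ : Measure Ω}
  {Q : Measure E} {D : ℕ → Ω → E}

theorem ae_of_law (hmeas : ∀ i, Measurable (D i)) (hlaw : ∀ i, μ.map (D i) = Q) {P : E → Prop}
    (h : ∀ᵐ d ∂Q, P d) : ∀ᵐ ω ∂μ, ∀ i, P (D i ω) := by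
  rw [ae_all_iff]
  intro i
  rw [← hlaw i] at h
  exact ae_of_ae_map (hmeas i).aemeasurable h

/-- By Fubini, the diagonal is null for the product of two copies of an atomless law. -/
theorem ae_injective [IsProbabilityMeasure μ] [IsProbabilityMeasure Q] (hmeas : ∀ i, Measurable (D i)) (hindep : iIndepFun D μ)
    (hlaw : ∀ i, μ.map (D i) = Q) {φ : E → ℝ} (hφ : Measurable φ)
    (hatom : ∀ t, Q.map φ {t} = 0) :
    ∀ᵐ ω ∂μ, Function.Injective fun i => φ (D i ω) := by
  have key : ∀ i j, i ≠ j → ∀ᵐ ω ∂μ, φ (D i ω) ≠ φ (D j ω) := by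
    intro i j hij
    have hi : IndepFun (fun ω => φ (D i ω)) (fun ω => φ (D j ω)) μ :=
      (hindep.indepFun hij).comp hφ hφ
    have h1 := (indepFun_iff_map_prod_eq_prod_map_map (by fun_prop) (by fun_prop)).1 hi
    have hl : ∀ i, μ.map (fun ω => φ (D i ω)) = Q.map φ := fun i => by
      rw [← hlaw i, Measure.map_map hφ (hmeas i)]; rfl
    rw [hl, hl] at h1
    have hdiag : MeasurableSet {q : ℝ × ℝ | q.1 = q.2} :=
      measurableSet_eq_fun measurable_fst measurable_snd
    have h2 : μ {ω | φ (D i ω) = φ (D j ω)} = 0 := by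
      have : μ {ω | φ (D i ω) = φ (D j ω)} =
          μ.map (fun ω => (φ (D i ω), φ (D j ω))) {q : ℝ × ℝ | q.1 = q.2} := by
        rw [Measure.map_apply (by fun_prop) hdiag]; rfl
      rw [this, h1, Measure.prod_apply hdiag]
      have h3 : ∀ x : ℝ, (Prod.mk x ⁻¹' {q : ℝ × ℝ | q.1 = q.2}) = {x} := by
        intro x; ext y; simp [eq_comm]
      simp [h3, hatom]
    exact measure_eq_zero_iff_ae_notMem.1 h2
  have h : ∀ᵐ ω ∂μ, ∀ i j, i ≠ j → φ (D i ω) ≠ φ (D j ω) := by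
    rw [ae_all_iff]; intro i; rw [ae_all_iff]; intro j
    by_cases hij : i = j
    · simp [hij]
    · filter_upwards [key i j hij] with ω hω _ using hω
  filter_upwards [h] with ω hω i j hij
  by_contra hne
  exact hω i j hne hij

end Law

section LLN

variable {E : Type*} [MeasurableSpace E] [StandardBorelSpace E] [Nonempty E]
  {Ω : Type*} [MeasurableSpace Ω] {μ : Measure Ω} [IsProbabilityMeasure μ]
  {Q : Measure E} [IsProbabilityMeasure Q] {D : ℕ → Ω → E}

/-- A conditional probability given a uniform variable is the derivative of the joint
probability. -/
theorem condDistrib_ae_eq_deriv {φ : E → ℝ} (hφ : Measurable φ)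
    (hunif : Q.map φ = volume.restrict (Icc 0 1)) {B : Set E} (hB : MeasurableSet B) {p : ℝ → ℝ}
    (hp : ∀ t ∈ Ioo (0 : ℝ) 1, HasDerivAt (fun s => Q.real (B ∩ {d | φ d ≤ s})) (p t) t) :
    ∀ᵐ d ∂Q, (condDistrib id φ Q (φ d)).real B = p (φ d) := by
  set κ := condDistrib id φ Q with hκ
  have hqm : Measurable fun v => (κ v).real B := (κ.measurable_coe hB).ennreal_toReal
  have hbd : ∀ v, ‖(κ v).real B‖ ≤ 1 := fun v => by
    rw [Real.norm_of_nonneg measureReal_nonneg]; exact measureReal_le_one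
  have hloc : LocallyIntegrable (fun v => (κ v).real B) volume := by
    refine (locallyIntegrable_const (1 : ℝ)).mono hqm.aestronglyMeasurable (ae_of_all _ fun v => ?_)
    simpa using hbd v
  -- Disintegration along the uniform variable: the joint probability is an indefinite integral of
  -- the conditional probability, so Lebesgue differentiation recovers the latter almost everywhere.
  have hint : ∀ s ∈ Ioo (0 : ℝ) 1, ∫ v in (0 : ℝ)..s, (κ v).real B =
      Q.real (B ∩ {d | φ d ≤ s}) := by
    intro s hs
    have h1 := setLIntegral_preimage_condDistrib (μ := Q) hφ (aemeasurable_id (μ := Q)) hB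
      (measurableSet_Iic (a := s))
    rw [← hκ, ← setLIntegral_map measurableSet_Iic (κ.measurable_coe hB) hφ, hunif,
      Measure.restrict_restrict measurableSet_Iic] at h1
    have h2 : Iic s ∩ Icc (0 : ℝ) 1 = Icc 0 s := by
      ext x; simp only [Set.mem_inter_iff, Set.mem_Iic, Set.mem_Icc]
      exact ⟨fun h => ⟨h.2.1, h.1⟩, fun h => ⟨h.2, h.1, h.2.trans hs.2.le⟩⟩
    rw [h2] at h1
    rw [intervalIntegral.integral_of_le hs.1.le, ← integral_Icc_eq_integral_Ioc]
    simp only [measureReal_def]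
    rw [integral_toReal (κ.measurable_coe hB).aemeasurable (ae_of_all _ fun v => measure_lt_top _ _),
      h1, inter_comm]
    rfl
  have hae : ∀ᵐ v ∂(Q.map φ), (κ v).real B = p v := by
    rw [hunif, ← restrict_Ioo_eq_restrict_Icc, ae_restrict_iff' measurableSet_Ioo]
    filter_upwards [LocallyIntegrable.ae_hasDerivAt_integral hloc] with t ht htm
    refine (ht 0).unique ((hp t htm).congr_of_eventuallyEq ?_)
    filter_upwards [Ioo_mem_nhds htm.1 htm.2] with s hs using hint s hs
  exact ae_of_ae_map hφ.aemeasurable hae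

/-- Since weights are at most `n ^ (β - 1)`, each deviation has probability at most `2 exp(-2 ε² n ^
(1 - β))`. At most `(n + 1)²` pairs `(m, k)` occur, so Borel–Cantelli applies. -/
theorem ae_localLLN_aux (hmeas : ∀ i, Measurable (D i)) (hindep : iIndepFun D μ)
    (hlaw : ∀ i, μ.map (D i) = Q) {φ : E → ℝ} (hφ : Measurable φ)
    {B : Set E} (hB : MeasurableSet B) {v₀ : ℝ} (hv₀ : v₀ ∈ Icc (0 : ℝ) 1)
    (hinj : ∀ᵐ ω ∂μ, Function.Injective fun i => φ (D i ω)) {β ε : ℝ} (hβ : β < 1) (hε : 0 < ε) :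
    ∀ᵐ ω ∂μ, ∀ᶠ n : ℕ in atTop, ∀ m : ℕ, 1 ≤ m → (m : ℝ) ≤ (n : ℝ) ^ β → ∀ k ≤ n,
      |∑ i : Fin n, vWeight m (node v₀ n k) (fun i : Fin n => φ (D i ω)) i *
        (B.indicator 1 (D i ω) - (condDistrib id φ Q (φ (D i ω))).real B)| ≤ ε := by
  classical
  -- The conditional Hoeffding inequality asks for its weight bounds at every covariate vector.
  -- Setting the weights to `0` on ties secures this and changes nothing almost surely.
  set W : ℕ → ℕ → (n : ℕ) → (Fin n → ℝ) → Fin n → ℝ := fun m k n x i =>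
    if Function.Injective x then vWeight m (node v₀ n k) x i else 0 with hW
  set A : ℕ → ℕ → ℕ → Set Ω := fun n m k => {ω | ε ≤ |∑ i : Fin n,
    W m k n (fun i : Fin n => φ (D i ω)) i *
        (B.indicator 1 (D i ω) - (condDistrib id φ Q (φ (D i ω))).real B)|} with hA
  set S : ℕ → Finset (ℕ × ℕ) := fun n => (Finset.range (n + 1) ×ˢ Finset.range (n + 1)).filter
    fun q => 1 ≤ q.1 ∧ (q.1 : ℝ) ≤ (n : ℝ) ^ β with hS
  have hAle : ∀ n : ℕ, ∀ q ∈ S n, μ (A n q.1 q.2) ≤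
      ENNReal.ofReal (2 * Real.exp (-(2 * ε ^ 2) * (n : ℝ) ^ (1 - β))) := by
    rintro n ⟨m, k⟩ hq
    simp only [hS, Finset.mem_filter, Finset.mem_product, Finset.mem_range] at hq
    obtain ⟨⟨hmn, hkn⟩, hm1, hmβ⟩ := hq
    have hn : 1 ≤ n := by omega
    have hn0 : (0 : ℝ) < n := by exact_mod_cast hn
    have hv := node_mem hv₀ (n := n) (k := k) (by omega)
    have hcpos : (0 : ℝ) < (n : ℝ) ^ (β - 1) := by positivity
    have hwc : (m : ℝ) / n ≤ (n : ℝ) ^ (β - 1) := by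
      rw [Real.rpow_sub_one hn0.ne']
      exact div_le_div_of_nonneg_right hmβ hn0.le
    have h1 := hoeffding_cond (μ := μ) hmeas hindep hlaw hφ hB (w := W m k n) (n := n)
      (c := (n : ℝ) ^ (β - 1)) (fun i => ?_) (fun x i => ?_) (fun x i => ?_) (fun x => ?_)
      hcpos hε.le
    · refine h1.trans (le_of_eq ?_)
      congr 3
      rw [show (1 - β) = -(β - 1) by ring, Real.rpow_neg hn0.le]
      ring
    · exact Measurable.ite (measurableSet_injective n) (measurable_vWeight _ _ i) measurable_const
    · simp only [hW]
      split_ifs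
      · exact vWeight_nonneg m hv x i
      · exact le_rfl
    · simp only [hW]
      split_ifs
      · exact (vWeight_le m hv x i).trans hwc
      · exact hcpos.le
    · simp only [hW]
      split_ifs with hx
      · exact (sum_vWeight hn hm1 _ hx).le
      · simp
  have hsum : ∑' n, μ (⋃ q ∈ S n, A n q.1 q.2) ≠ ∞ := by
    refine ne_top_of_le_ne_top (summable_poly_mul_exp (a := 2 * ε ^ 2) (γ := 1 - β)
      (by positivity) (by linarith)).tsum_ofReal_ne_top (ENNReal.tsum_le_tsum fun n => ?_)
    refine (measure_biUnion_finset_le _ _).trans ((Finset.sum_le_sum (hAle n)).trans ?_)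
    rw [Finset.sum_const, nsmul_eq_mul, ENNReal.ofReal_mul (p := ((n : ℝ) + 1) * (n + 1)) (by positivity)]
    refine mul_le_mul' ?_ le_rfl
    have : (S n).card ≤ (n + 1) * (n + 1) := (Finset.card_filter_le _ _).trans (by simp)
    rw [← ENNReal.ofReal_natCast]
    exact ENNReal.ofReal_le_ofReal (by exact_mod_cast this)
  filter_upwards [ae_eventually_notMem hsum, hinj] with ω hω hinjω
  filter_upwards [hω, eventually_ge_atTop 1] with n hn hn0 m hm1 hmβ k hk
  by_cases hmn : m ≤ n
  · have hq : (m, k) ∈ S n := by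
      simp only [hS, Finset.mem_filter, Finset.mem_product, Finset.mem_range]
      exact ⟨⟨by omega, by omega⟩, hm1, hmβ⟩
    have h2 : ω ∉ A n m k := fun h => hn (Set.mem_biUnion hq h)
    have h3 : ¬ ε ≤ |∑ i : Fin n, W m k n (fun i : Fin n => φ (D i ω)) i *
        (B.indicator 1 (D i ω) - (condDistrib id φ Q (φ (D i ω))).real B)| := h2
    have h4 : Function.Injective fun i : Fin n => φ (D i ω) := hinjω.comp Fin.val_injective
    simp only [hW, if_pos h4] at h3
    exact (not_le.1 h3).le
  · exfalso
    have h1 : (1 : ℝ) ≤ n := by exact_mod_cast hn0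
    have h2 : (n : ℝ) ^ β ≤ n := by
      conv_rhs => rw [← Real.rpow_one (n : ℝ)]
      exact Real.rpow_le_rpow_of_exponent_le h1 hβ.le
    exact hmn (by exact_mod_cast hmβ.trans h2)

/-- The local law of large numbers for the indicators of an event `B`: the centring `p` is the
derivative of the joint probability with the uniform variable `φ`. -/
theorem ae_localLLN (hmeas : ∀ i, Measurable (D i)) (hindep : iIndepFun D μ)
    (hlaw : ∀ i, μ.map (D i) = Q) {φ : E → ℝ} (hφ : Measurable φ)
    (hunif : Q.map φ = volume.restrict (Icc 0 1)) {B : Set E} (hB : MeasurableSet B) {p : ℝ → ℝ}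
    (hp : ∀ t ∈ Ioo (0 : ℝ) 1, HasDerivAt (fun s => Q.real (B ∩ {d | φ d ≤ s})) (p t) t)
    {v₀ : ℝ} (hv₀ : v₀ ∈ Icc (0 : ℝ) 1) :
    ∀ᵐ ω ∂μ, LocalLLN (fun i => φ (D i ω)) (fun i => B.indicator 1 (D i ω))
      (fun i => p (φ (D i ω))) v₀ := by
  have hinj := ae_injective hmeas hindep hlaw hφ (fun t => by rw [hunif]; simp)
  -- Countably many exponents tending to `1` and tolerances tending to `0` suffice, so one null set
  -- serves all `β` and `ε`.
  have h1 : ∀ᵐ ω ∂μ, ∀ j k : ℕ, ∀ᶠ n : ℕ in atTop, ∀ m : ℕ, 1 ≤ m →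
      (m : ℝ) ≤ (n : ℝ) ^ (1 - 1 / ((j : ℝ) + 1)) → ∀ l ≤ n,
      |∑ i : Fin n, vWeight m (node v₀ n l) (fun i : Fin n => φ (D i ω)) i *
        (B.indicator 1 (D i ω) - (condDistrib id φ Q (φ (D i ω))).real B)| ≤ 1 / ((k : ℝ) + 1) := by
    rw [ae_all_iff]; intro j; rw [ae_all_iff]; intro k
    exact ae_localLLN_aux hmeas hindep hlaw hφ hB hv₀ hinj (by
      have : (0 : ℝ) < 1 / ((j : ℝ) + 1) := by positivity
      linarith) (by positivity)
  filter_upwards [h1, ae_of_law hmeas hlaw (condDistrib_ae_eq_deriv hφ hunif hB hp)] with ω hω hq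
  intro β hβ ε hε
  obtain ⟨j, hj⟩ := exists_nat_one_div_lt (sub_pos.2 hβ)
  obtain ⟨k, hk⟩ := exists_nat_one_div_lt hε
  filter_upwards [hω j k, eventually_ge_atTop 1] with n hn hn1 m hm1 hmβ l hl
  have h2 := hn m hm1 (hmβ.trans (Real.rpow_le_rpow_of_exponent_le (by exact_mod_cast hn1)
    (by linarith))) l hl
  simp only [hq] at h2
  exact h2.trans hk.le

end LLN

/-! ### Uniform variables and the Glivenko–Cantelli theorem -/

/-- Uniform convergence of the empirical distribution function of `x` to that of the uniform law. -/
def GC (x : ℕ → ℝ) : Prop :=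
  ∀ η > (0 : ℝ), ∀ᶠ n : ℕ in atTop, ∀ t ∈ Icc (0 : ℝ) 1,
    |(countLE (fun i : Fin n => x i) t : ℝ) - n * t| ≤ η * n

/-- Counts are monotone in the level, so they are trapped between their values at neighbouring
points of a grid of mesh below `η / 2`. -/
theorem GC_of_tendsto {x : ℕ → ℝ} (h : ∀ j J : ℕ, 1 ≤ J → j ≤ J → Tendsto
    (fun n : ℕ => (countLE (fun i : Fin n => x i) (j / J) : ℝ) / n) atTop (𝓝 (j / J))) :
    GC x := by
  intro η hη
  obtain ⟨J', hJ'⟩ := exists_nat_one_div_lt (half_pos hη)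
  set J := J' + 1 with hJ
  have hJ0 : (0 : ℝ) < J := by positivity
  have hJη : 1 / (J : ℝ) < η / 2 := by rw [hJ]; push_cast; exact hJ'
  have h1 : ∀ᶠ n : ℕ in atTop, ∀ j ∈ Finset.range (J + 1),
      |(countLE (fun i : Fin n => x i) (j / J) : ℝ) / n - j / J| < η / 2 := by
    rw [Filter.eventually_all_finset]
    intro j hj
    have := h j J (by omega) (by simpa [Nat.lt_succ_iff] using hj)
    exact (Metric.tendsto_nhds.1 this (η / 2) (half_pos hη)).mono fun n hn => by
      rwa [Real.dist_eq] at hn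
  filter_upwards [h1, eventually_ge_atTop 1] with n hn hn1 t ht
  have hn0 : (0 : ℝ) < n := by exact_mod_cast hn1
  have hb : ∀ j : ℕ, j ≤ J → |(countLE (fun i : Fin n => x i) (j / J) : ℝ) - n * (j / J)| ≤
      η / 2 * n := by
    intro j hj
    have h2 := (hn j (by simpa [Nat.lt_succ_iff] using hj)).le
    have h3 : (countLE (fun i : Fin n => x i) (j / J) : ℝ) - n * (j / J) =
        ((countLE (fun i : Fin n => x i) (j / J) : ℝ) / n - j / J) * n := by
      field_simp
    rw [h3, abs_mul, abs_of_pos hn0]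
    exact mul_le_mul_of_nonneg_right h2 hn0.le
  have hup : ⌈J * t⌉₊ ≤ J := by
    rw [Nat.ceil_le]; exact mul_le_of_le_one_right hJ0.le ht.2
  have hlo : ⌊J * t⌋₊ ≤ J := (Nat.floor_le_ceil _).trans hup
  have hJt : 0 ≤ J * t := mul_nonneg hJ0.le ht.1
  have e1 : t ≤ (⌈J * t⌉₊ : ℝ) / J := by
    rw [le_div_iff₀ hJ0, mul_comm]; exact Nat.le_ceil _
  have e2 : (⌈J * t⌉₊ : ℝ) / J ≤ t + η / 2 := by
    have : (⌈J * t⌉₊ : ℝ) / J ≤ (J * t + 1) / J :=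
      div_le_div_of_nonneg_right (Nat.ceil_lt_add_one hJt).le hJ0.le
    rw [add_div, mul_div_cancel_left₀ _ hJ0.ne'] at this
    linarith
  have e3 : (⌊J * t⌋₊ : ℝ) / J ≤ t := by
    rw [div_le_iff₀ hJ0, mul_comm t]; exact Nat.floor_le hJt
  have e4 : t - η / 2 ≤ (⌊J * t⌋₊ : ℝ) / J := by
    have : (J * t - 1) / J ≤ (⌊J * t⌋₊ : ℝ) / J :=
      div_le_div_of_nonneg_right (by linarith [Nat.lt_floor_add_one (J * t)]) hJ0.le
    rw [sub_div, mul_div_cancel_left₀ _ hJ0.ne'] at this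
    linarith
  have f1 : (countLE (fun i : Fin n => x i) t : ℝ) ≤
      countLE (fun i : Fin n => x i) (⌈J * t⌉₊ / J) := by exact_mod_cast countLE_mono _ e1
  have f2 : (countLE (fun i : Fin n => x i) (⌊J * t⌋₊ / J) : ℝ) ≤
      countLE (fun i : Fin n => x i) t := by exact_mod_cast countLE_mono _ e3
  have g1 := abs_le.1 (hb _ hup)
  have g2 := abs_le.1 (hb _ hlo)
  have k1 := mul_le_mul_of_nonneg_left e2 hn0.le
  have k2 := mul_le_mul_of_nonneg_left e4 hn0.le
  rw [abs_le]
  constructor <;> nlinarith [g1.1, g1.2, g2.1, g2.2]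

/-- The strict count at `t` lies between the weak counts at `t - η / 2` and at `t`; for `t < η / 2`
the lower bound is trivial. -/
theorem GC.countLT {x : ℕ → ℝ} (h : GC x) {η : ℝ} (hη : 0 < η) : ∀ᶠ n : ℕ in atTop,
    ∀ t ∈ Icc (0 : ℝ) 1, |(countLT (fun i : Fin n => x i) t : ℝ) - n * t| ≤ η * n := by
  filter_upwards [h (η / 2) (half_pos hη)] with n hn t ht
  have hle : ∀ s t, s < t → countLE (fun i : Fin n => x i) s ≤
      ECBC.countLT (fun i : Fin n => x i) t := by
    intro s t hst
    rw [countLE_eq, countLT_eq]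
    exact Finset.card_le_card fun i hi => by
      simp only [Finset.mem_filter, Finset.mem_univ, true_and] at hi ⊢
      exact hi.trans_lt hst
  have hle' : ECBC.countLT (fun i : Fin n => x i) t ≤ countLE (fun i : Fin n => x i) t := by
    rw [countLE_eq, countLT_eq]
    exact Finset.card_le_card fun i hi => by
      simp only [Finset.mem_filter, Finset.mem_univ, true_and] at hi ⊢
      exact hi.le
  have h1 := abs_le.1 (hn t ht)
  have hn0 : (0 : ℝ) ≤ n := by positivity
  have h2 : (ECBC.countLT (fun i : Fin n => x i) t : ℝ) ≤ countLE (fun i : Fin n => x i) t := by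
    exact_mod_cast hle'
  rw [abs_le]
  refine ⟨?_, by nlinarith [h1.2]⟩
  by_cases htη : η / 2 ≤ t
  · have h3 := abs_le.1 (hn (t - η / 2) ⟨by linarith, by linarith [ht.2]⟩)
    have h4 : (countLE (fun i : Fin n => x i) (t - η / 2) : ℝ) ≤
        ECBC.countLT (fun i : Fin n => x i) t := by
      exact_mod_cast hle _ _ (by linarith)
    nlinarith [h3.1]
  · have : (0 : ℝ) ≤ ECBC.countLT (fun i : Fin n => x i) t := by positivity
    nlinarith [not_le.1 htη]

section Law

variable {E : Type*} [MeasurableSpace E] {Ω : Type*} [MeasurableSpace Ω] {μ : Measure Ω}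
  {Q : Measure E} {D : ℕ → Ω → E}

theorem real_le_of_unif {φ : E → ℝ} (hφ : Measurable φ)
    (hunif : Q.map φ = volume.restrict (Icc 0 1)) {t : ℝ} (ht : t ∈ Icc (0 : ℝ) 1) :
    Q.real {d | φ d ≤ t} = t := by
  have h1 : Q {d | φ d ≤ t} = Q.map φ (Iic t) := by
    rw [Measure.map_apply hφ measurableSet_Iic]; rfl
  have h2 : Iic t ∩ Icc (0 : ℝ) 1 = Icc 0 t := by
    ext x; simp only [Set.mem_inter_iff, Set.mem_Iic, Set.mem_Icc]
    exact ⟨fun h => ⟨h.2.1, h.1⟩, fun h => ⟨h.2, h.1, h.2.trans ht.2⟩⟩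
  rw [measureReal_def, h1, hunif, Measure.restrict_apply measurableSet_Iic, h2, Real.volume_Icc,
    sub_zero, ENNReal.toReal_ofReal ht.1]

theorem unif_of_le [IsProbabilityMeasure Q] {φ : E → ℝ} (hφ : Measurable φ)
    (h01 : ∀ d, φ d ∈ Icc (0 : ℝ) 1) (h : ∀ t ∈ Ioo (0 : ℝ) 1, Q.real {d | φ d ≤ t} = t) :
    Q.map φ = volume.restrict (Icc 0 1) := by
  have hfin : IsProbabilityMeasure (Q.map φ) := Measure.isProbabilityMeasure_map hφ.aemeasurable
  have h0 : Q.real {d | φ d ≤ 0} = 0 := by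
    refine le_antisymm (le_of_forall_pos_le_add fun ε hε => ?_) measureReal_nonneg
    have hs : min ε (1 / 2) ∈ Ioo (0 : ℝ) 1 :=
      ⟨lt_min hε (by norm_num), (min_le_right _ _).trans_lt (by norm_num)⟩
    calc Q.real {d | φ d ≤ 0} ≤ Q.real {d | φ d ≤ min ε (1 / 2)} :=
          measureReal_mono fun d (hd : φ d ≤ 0) => hd.trans hs.1.le
      _ ≤ 0 + ε := by rw [h _ hs, zero_add]; exact min_le_left _ _
  refine Measure.ext_of_Iic _ _ fun t => ?_
  rw [Measure.map_apply hφ measurableSet_Iic, Measure.restrict_apply measurableSet_Iic]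
  change Q {d | φ d ≤ t} = _
  rcases lt_or_ge t 0 with ht | ht
  · have e1 : {d | φ d ≤ t} = ∅ := by
      ext d
      simp only [Set.mem_ofPred_eq, Set.mem_empty_iff_false, iff_false, not_le]
      exact ht.trans_le (h01 d).1
    have e2 : Iic t ∩ Icc (0 : ℝ) 1 = ∅ := by
      ext x; simp only [Set.mem_inter_iff, Set.mem_Iic, Set.mem_Icc, Set.mem_empty_iff_false,
        iff_false]
      intro hx; linarith [hx.1, hx.2.1]
    rw [e1, e2]; simp
  rcases le_or_gt 1 t with ht1 | ht1
  · have e1 : {d | φ d ≤ t} = univ := by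
      ext d
      simp only [Set.mem_ofPred_eq, Set.mem_univ, iff_true]
      exact (h01 d).2.trans ht1
    have e2 : Iic t ∩ Icc (0 : ℝ) 1 = Icc 0 1 := by
      ext x; simp only [Set.mem_inter_iff, Set.mem_Iic, Set.mem_Icc]
      exact ⟨fun h => h.2, fun h => ⟨h.2.trans ht1, h⟩⟩
    rw [e1, e2]; simp
  have e2 : Iic t ∩ Icc (0 : ℝ) 1 = Icc 0 t := by
    ext x; simp only [Set.mem_inter_iff, Set.mem_Iic, Set.mem_Icc]
    exact ⟨fun h => ⟨h.2.1, h.1⟩, fun h => ⟨h.2, h.1, h.2.trans ht1.le⟩⟩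
  rw [e2, Real.volume_Icc, sub_zero, ← ofReal_measureReal]
  congr 1
  rcases ht.eq_or_lt with rfl | ht
  · exact h0
  · exact h t ⟨ht, ht1⟩

theorem ae_GC [IsProbabilityMeasure μ] [IsProbabilityMeasure Q] (hmeas : ∀ i, Measurable (D i))
    (hindep : iIndepFun D μ) (hlaw : ∀ i, μ.map (D i) = Q) {φ : E → ℝ} (hφ : Measurable φ)
    (hunif : Q.map φ = volume.restrict (Icc 0 1)) : ∀ᵐ ω ∂μ, GC fun i => φ (D i ω) := by
  have key : ∀ t ∈ Icc (0 : ℝ) 1, ∀ᵐ ω ∂μ, Tendsto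
      (fun n : ℕ => (countLE (fun i : Fin n => φ (D i ω)) t : ℝ) / n) atTop (𝓝 t) := by
    intro t ht
    have hB : MeasurableSet {d | φ d ≤ t} := measurableSet_le hφ measurable_const
    set f : E → ℝ := {d | φ d ≤ t}.indicator 1 with hf
    have hfm : Measurable f := measurable_one.indicator hB
    have hident : ∀ i, IdentDistrib (fun ω => f (D i ω)) (fun ω => f (D 0 ω)) μ μ := fun i =>
      (IdentDistrib.mk (hmeas i).aemeasurable (hmeas 0).aemeasurable
        (by rw [hlaw, hlaw])).comp hfm
    have hint : Integrable (fun ω => f (D 0 ω)) μ := by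
      refine Integrable.of_bound (hfm.comp (hmeas 0)).aestronglyMeasurable 1 (ae_of_all _ fun ω => ?_)
      simp only [hf, Set.indicator_apply]
      split_ifs <;> simp
    have hmean : ∫ ω, f (D 0 ω) ∂μ = t := by
      rw [← integral_map (hmeas 0).aemeasurable hfm.aestronglyMeasurable, hlaw, hf,
        integral_indicator_one hB, real_le_of_unif hφ hunif ht]
    have hsl := strong_law_ae_real (fun i ω => f (D i ω)) hint
      (fun i j hij => (hindep.indepFun hij).comp hfm hfm) hident
    rw [hmean] at hsl
    filter_upwards [hsl] with ω hω
    refine hω.congr fun n => ?_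
    rw [countLE_eq, Finset.card_filter, ← Fin.sum_univ_eq_sum_range (fun i => f (D i ω))]
    push_cast
    simp [hf, Set.indicator_apply]
  have h : ∀ᵐ ω ∂μ, ∀ j J : ℕ, 1 ≤ J → j ≤ J → Tendsto
      (fun n : ℕ => (countLE (fun i : Fin n => φ (D i ω)) (j / J) : ℝ) / n)
        atTop (𝓝 (j / J)) := by
    rw [ae_all_iff]; intro j; rw [ae_all_iff]; intro J
    by_cases hJ : 1 ≤ J ∧ j ≤ J
    · filter_upwards [key (j / J) ⟨by positivity, div_le_one_of_le₀ (by exact_mod_cast hJ.2)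
        (by positivity)⟩] with ω hω _ _ using hω
    · exact ae_of_all _ fun ω h1 h2 => absurd ⟨h1, h2⟩ hJ
  filter_upwards [h] with ω hω using GC_of_tendsto hω

end Law

theorem continuous_cdf (ν : Measure ℝ) [IsProbabilityMeasure ν] [NullSingletonClass ν] :
    Continuous (cdf ν) := by
  refine continuous_iff_continuousAt.2 fun a => ?_
  have h1 : ν {a} = 0 := measure_singleton a
  have h2 := (cdf ν).measure_singleton a
  rw [measure_cdf, h1, eq_comm, ENNReal.ofReal_eq_zero] at h2
  rw [(monotone_cdf ν).continuousAt_iff_leftLim_eq_rightLim, (cdf ν).rightLim_eq]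
  exact le_antisymm ((monotone_cdf ν).leftLim_le le_rfl) (by linarith)

theorem exists_cdf_eq (ν : Measure ℝ) [IsProbabilityMeasure ν] [NullSingletonClass ν] {t : ℝ}
    (ht : t ∈ Ioo (0 : ℝ) 1) : ∃ s, cdf ν s = t :=
  mem_range_of_exists_le_of_exists_ge (continuous_cdf ν)
    (((tendsto_cdf_atBot ν).eventually_le_const ht.1).exists)
    (((tendsto_cdf_atTop ν).eventually_const_le ht.2).exists)

/-- The probability integral transform. -/
theorem real_cdf_le (ν : Measure ℝ) [IsProbabilityMeasure ν] [NullSingletonClass ν] {t : ℝ}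
    (ht : t ∈ Ioo (0 : ℝ) 1) : ν.real {y | cdf ν y ≤ t} = t := by
  -- The distribution function may be flat at level `t`. A point where it takes a slightly larger
  -- level, kept below `1` by the minimum, bounds the whole sublevel set.
  refine le_antisymm (le_of_forall_gt_imp_ge_of_dense fun r hr => ?_) ?_
  · have hr' : min r ((t + 1) / 2) ∈ Ioo (0 : ℝ) 1 :=
      ⟨lt_min (ht.1.trans hr) (by linarith [ht.1]),
        (min_le_right _ _).trans_lt (by linarith [ht.2])⟩
    have htr : t < min r ((t + 1) / 2) := lt_min hr (by linarith [ht.2])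
    obtain ⟨s, hs⟩ := exists_cdf_eq ν hr'
    calc ν.real {y | cdf ν y ≤ t} ≤ ν.real (Iic s) := by
          refine measureReal_mono fun y (hy : cdf ν y ≤ t) => ?_
          by_contra hys
          have := monotone_cdf ν (not_le.1 hys).le
          rw [hs] at this
          linarith
      _ = min r ((t + 1) / 2) := by rw [← cdf_eq_real, hs]
      _ ≤ r := min_le_left _ _
  · obtain ⟨s, hs⟩ := exists_cdf_eq ν ht
    calc t = ν.real (Iic s) := by rw [← cdf_eq_real, hs]
      _ ≤ ν.real {y | cdf ν y ≤ t} := by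
          refine measureReal_mono fun y (hy : y ≤ s) => ?_
          exact (monotone_cdf ν hy).trans hs.le

/-! ### Uniform consistency of the smoothed weighted averages -/

theorem exists_concentration {V : ℕ → ℝ} (hV : ∀ i, V i ∈ Ioo (0 : ℝ) 1)
    (hinj : Function.Injective V) (hGC : GC V) {τ : ℝ} (hτ : 0 < τ) :
    ∃ K : ℕ, 1 ≤ K ∧ ∀ᶠ n : ℕ in atTop, ∀ m ≥ K, ∀ v ∈ Icc (0 : ℝ) 1,
      ∑ i : Fin n, vWeight m v (fun i : Fin n => V i) i * (V i - v) ^ 2 ≤ τ := by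
  -- With `2 / m`, `1 / n` and the rank error all at most `σ ≤ 1`, the bound is `σ + 2 (3 σ)² ≤ 19
  -- σ`.
  set σ : ℝ := min 1 (τ / 19) with hσ
  have hσ0 : 0 < σ := lt_min one_pos (by positivity)
  have hσ1 : σ ≤ 1 := min_le_left _ _
  have hστ : 19 * σ ≤ τ := by linarith [min_le_right 1 (τ / 19)]
  obtain ⟨K, hK⟩ := exists_nat_gt (2 / σ)
  have hK0 : (0 : ℝ) < K := lt_trans (by positivity) hK
  obtain ⟨N, hN⟩ := exists_nat_gt (1 / σ)
  refine ⟨K, by exact_mod_cast hK0, ?_⟩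
  filter_upwards [hGC.countLT hσ0, eventually_ge_atTop (N + 1)] with n hn hnN m hm v hv
  have hn1 : 1 ≤ n := by omega
  have hn0 : (0 : ℝ) < n := by exact_mod_cast hn1
  have hKm : (K : ℝ) ≤ m := by exact_mod_cast hm
  have hm0 : (0 : ℝ) < m := hK0.trans_le hKm
  have hm2 : 2 / (m : ℝ) ≤ σ := by
    rw [div_le_iff₀ hm0]
    rw [div_lt_iff₀ hσ0] at hK
    nlinarith
  have hn2 : 1 / (n : ℝ) ≤ σ := by
    rw [div_le_iff₀ hn0]
    rw [div_lt_iff₀ hσ0] at hN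
    have : (N : ℝ) ≤ n := by exact_mod_cast (by omega : N ≤ n)
    nlinarith
  have h1 := sum_vWeight_mul_sq_le hn1 (m := m) (by exact_mod_cast hm0) hv
    (x := fun i : Fin n => V i) (hinj.comp Fin.val_injective) (y := fun i : Fin n => V i)
    hσ0.le (fun i => by
      have h2 := hn (V i) ⟨(hV i).1.le, (hV i).2.le⟩
      have h3 : V i - (countLT (fun i : Fin n => V i) (V i) : ℝ) / n =
          -((countLT (fun i : Fin n => V i) (V i) : ℝ) - n * V i) / n := by
        field_simp; ring
      rw [h3, abs_div, abs_neg, abs_of_pos hn0, div_le_iff₀ hn0]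
      exact h2)
  refine h1.trans (le_trans ?_ hστ)
  have h4 : (0 : ℝ) ≤ 2 / m := by positivity
  have h5 : (0 : ℝ) ≤ 1 / n := by positivity
  have h6 : (σ + 2 / m + 1 / n) ^ 2 ≤ (3 * σ) ^ 2 := pow_le_pow_left₀ (by positivity)
    (by linarith) 2
  nlinarith

/-- Near `v`, the term `a i` is compared with `b i` and the centring `q i` with `P`. Far
observations have total weight at most `τ / ρ ^ 2` by Chebyshev, and each costs at most `2`. -/
theorem weighted_le {n : ℕ} {W V a b q : Fin n → ℝ} {v P ε κ ρ τ : ℝ} (hW0 : ∀ i, 0 ≤ W i)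
    (hW1 : ∑ i, W i = 1) (hτ : ∑ i, W i * (V i - v) ^ 2 ≤ τ) (hρ : 0 < ρ) (ha : ∀ i, a i ≤ 1)
    (hb : ∀ i, 0 ≤ b i) (hq : ∀ i, q i ≤ 1) (hP : 0 ≤ P) (hκ : 0 ≤ κ) (hε : 0 ≤ ε)
    (hab : ∀ i, |V i - v| < ρ → a i ≤ b i + κ) (hqP : ∀ i, |V i - v| < ρ → q i ≤ P + ε)
    (hbq : ∑ i, W i * (b i - q i) ≤ ε) :
    ∑ i, W i * a i ≤ P + 2 * ε + κ + 2 * (τ / ρ ^ 2) := by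
  have hfar : ∀ i, ¬ |V i - v| < ρ → 1 ≤ (V i - v) ^ 2 / ρ ^ 2 := by
    intro i hi
    rw [one_le_div (by positivity), ← sq_abs (V i - v)]
    exact pow_le_pow_left₀ hρ.le (not_lt.1 hi) 2
  have hsq : ∀ i, 0 ≤ (V i - v) ^ 2 / ρ ^ 2 := fun i => by positivity
  have key : ∀ i, W i * a i ≤ W i * (b i - q i) + W i * (P + ε + κ) +
      2 / ρ ^ 2 * (W i * (V i - v) ^ 2) := by
    intro i
    have h1 : a i ≤ b i - q i + (P + ε + κ) + 2 * ((V i - v) ^ 2 / ρ ^ 2) := by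
      by_cases h : |V i - v| < ρ
      · linarith [hab i h, hqP i h, hsq i]
      · linarith [hfar i h, ha i, hb i, hq i]
    have h2 := mul_le_mul_of_nonneg_left h1 (hW0 i)
    have h3 : W i * (b i - q i + (P + ε + κ) + 2 * ((V i - v) ^ 2 / ρ ^ 2)) =
      W i * (b i - q i) + W i * (P + ε + κ) + 2 / ρ ^ 2 * (W i * (V i - v) ^ 2) := by ring
    linarith
  have h4 : ∑ i, W i * a i ≤ ∑ i, W i * (b i - q i) + (P + ε + κ) +
      2 / ρ ^ 2 * ∑ i, W i * (V i - v) ^ 2 := by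
    refine (Finset.sum_le_sum fun i _ => key i).trans (le_of_eq ?_)
    rw [Finset.sum_add_distrib, Finset.sum_add_distrib, ← Finset.sum_mul, hW1, one_mul,
      ← Finset.mul_sum]
  have h5 : 2 / ρ ^ 2 * ∑ i, W i * (V i - v) ^ 2 ≤ 2 / ρ ^ 2 * τ :=
    mul_le_mul_of_nonneg_left hτ (by positivity)
  have h6 : 2 / ρ ^ 2 * τ = 2 * (τ / ρ ^ 2) := by ring
  linarith

/-- `weighted_le` applied to the complements `1 - a`, `1 - b`, `1 - q`, `1 - P`. -/
theorem le_weighted {n : ℕ} {W V a b q : Fin n → ℝ} {v P ε κ ρ τ : ℝ} (hW0 : ∀ i, 0 ≤ W i)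
    (hW1 : ∑ i, W i = 1) (hτ : ∑ i, W i * (V i - v) ^ 2 ≤ τ) (hρ : 0 < ρ) (ha : ∀ i, 0 ≤ a i)
    (hb : ∀ i, b i ≤ 1) (hq : ∀ i, 0 ≤ q i) (hP : P ≤ 1) (hκ : 0 ≤ κ) (hε : 0 ≤ ε)
    (hab : ∀ i, |V i - v| < ρ → b i - κ ≤ a i) (hqP : ∀ i, |V i - v| < ρ → P - ε ≤ q i)
    (hbq : -ε ≤ ∑ i, W i * (b i - q i)) :
    P - 2 * ε - κ - 2 * (τ / ρ ^ 2) ≤ ∑ i, W i * a i := by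
  have h := weighted_le (a := fun i => 1 - a i) (b := fun i => 1 - b i) (q := fun i => 1 - q i)
    (P := 1 - P) (κ := κ) (ε := ε) hW0 hW1 hτ hρ (fun i => by linarith [ha i])
    (fun i => by linarith [hb i]) (fun i => by linarith [hq i]) (by linarith) hκ hε
    (fun i hi => by linarith [hab i hi]) (fun i hi => by linarith [hqP i hi]) (by
      have : ∑ i, W i * (1 - b i - (1 - q i)) = -∑ i, W i * (b i - q i) := by
        rw [← Finset.sum_neg_distrib]
        exact Finset.sum_congr rfl fun i _ => by ring
      linarith)
  simp only [mul_sub, mul_one, Finset.sum_sub_distrib, hW1] at h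
  linarith

/-- The cell of the `i`-th observation of the sample `z` lies in the `η`-neighbourhood of `s i`. -/
def RankClose {n : ℕ} (z s : Fin n → ℝ) (η : ℝ) (i : Fin n) : Prop :=
  (countLE z (z i) : ℝ) ≤ n * (s i + η) ∧ n * (s i - η) ≤ (countLT z (z i) : ℝ)

/-- The cell ends at or before `s i + η ≤ u - η`, so its distribution function is `1` within `η` of
`u`; smoothing then loses only the Chebyshev term. -/
theorem RankClose.one_sub_le_bern {n : ℕ} {z s : Fin n → ℝ} {η : ℝ} {i : Fin n}
    (h : RankClose z s η i) {l : ℕ} (hl : 1 ≤ l) (hη : 0 < η) {u : ℝ} (hu : u ∈ Icc (0 : ℝ) 1)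
    (hs : s i ≤ u - 2 * η) : 1 - 1 / (4 * l * η ^ 2) ≤ bern l (cellCDF z i) u := by
  have h1 := bern_le_of_vanish hl hη hu (f := fun t => 1 - cellCDF z i t)
    (fun t => by linarith [cellCDF_nonneg z i t]) (fun t ht => by
      have h2 : s i + η ≤ t := by linarith [(abs_lt.1 ht).2]
      rw [cellCDF_eq_one z i (h.1.trans (mul_le_mul_of_nonneg_left h2 (by positivity)))]
      simp)
  rw [bern_one_sub] at h1
  linarith

theorem RankClose.bern_le {n : ℕ} {z s : Fin n → ℝ} {η : ℝ} {i : Fin n}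
    (h : RankClose z s η i) {l : ℕ} (hl : 1 ≤ l) (hη : 0 < η) {u : ℝ} (hu : u ∈ Icc (0 : ℝ) 1)
    (hs : u + 2 * η ≤ s i) : bern l (cellCDF z i) u ≤ 1 / (4 * l * η ^ 2) :=
  bern_le_of_vanish hl hη hu (cellCDF_le_one z i) fun t ht => by
    have h2 : t ≤ s i - η := by linarith [(abs_lt.1 ht).1]
    rw [cellCDF_eq_zero z i ((mul_le_mul_of_nonneg_left h2 (by positivity)).trans h.2)]

/-- The grid point is `u + 2 η`, truncated at `1` and rounded up. The truncation is harmless because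
only values `s < 1` are compared with it. -/
theorem exists_grid_above {J : ℕ} (hJ : 1 ≤ J) {u η : ℝ} (hu : u ∈ Icc (0 : ℝ) 1) (hη : 0 < η)
    (hJη : 1 / (J : ℝ) < η) : ∃ j ≤ J, |(j / J : ℝ) - u| ≤ 3 * η ∧
      ∀ s < (1 : ℝ), (j / J : ℝ) < s → u + 2 * η ≤ s := by
  have hJ0 : (0 : ℝ) < J := by exact_mod_cast hJ
  set t := min (u + 2 * η) 1 with ht
  have ht0 : 0 ≤ t := le_min (by linarith [hu.1]) zero_le_one
  have ht1 : t ≤ 1 := min_le_right _ _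
  have htu : u ≤ t := le_min (by linarith) hu.2
  have htu' : t ≤ u + 2 * η := min_le_left _ _
  have e1 : t ≤ (⌈J * t⌉₊ : ℝ) / J := by
    rw [le_div_iff₀ hJ0, mul_comm]; exact Nat.le_ceil _
  have e2 : (⌈J * t⌉₊ : ℝ) / J ≤ t + 1 / J := by
    have : (⌈J * t⌉₊ : ℝ) / J ≤ (J * t + 1) / J :=
      div_le_div_of_nonneg_right (Nat.ceil_lt_add_one (by positivity)).le hJ0.le
    rwa [add_div, mul_div_cancel_left₀ _ hJ0.ne'] at this
  refine ⟨⌈J * t⌉₊, ?_, ?_, fun s hs hjs => ?_⟩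
  · rw [Nat.ceil_le]; exact mul_le_of_le_one_right hJ0.le ht1
  · rw [abs_le]; constructor <;> linarith
  · have h1 : t < s := e1.trans_lt hjs
    rcases min_lt_iff.1 h1 with h | h
    · exact h.le
    · linarith

theorem exists_grid_below {J : ℕ} (hJ : 1 ≤ J) {u η : ℝ} (hu : u ∈ Icc (0 : ℝ) 1) (hη : 0 < η)
    (hJη : 1 / (J : ℝ) < η) : ∃ j ≤ J, |(j / J : ℝ) - u| ≤ 3 * η ∧
      ∀ s > (0 : ℝ), s ≤ (j / J : ℝ) → s ≤ u - 2 * η := by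
  have hJ0 : (0 : ℝ) < J := by exact_mod_cast hJ
  set t := max (u - 2 * η) 0 with ht
  have ht0 : 0 ≤ t := le_max_right _ _
  have htu : t ≤ u := max_le (by linarith) hu.1
  have ht1 : t ≤ 1 := htu.trans hu.2
  have htu' : u - 2 * η ≤ t := le_max_left _ _
  have hJt : 0 ≤ J * t := by positivity
  have e3 : (⌊J * t⌋₊ : ℝ) / J ≤ t := by
    rw [div_le_iff₀ hJ0, mul_comm t]; exact Nat.floor_le hJt
  have e4 : t - 1 / J ≤ (⌊J * t⌋₊ : ℝ) / J := by
    have : (J * t - 1) / J ≤ (⌊J * t⌋₊ : ℝ) / J :=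
      div_le_div_of_nonneg_right (by linarith [Nat.lt_floor_add_one (J * t)]) hJ0.le
    rwa [sub_div, mul_div_cancel_left₀ _ hJ0.ne'] at this
  refine ⟨⌊J * t⌋₊, ?_, ?_, fun s hs hjs => ?_⟩
  · exact (Nat.floor_le_of_le (by exact mul_le_of_le_one_right hJ0.le ht1))
  · rw [abs_le]; constructor <;> linarith
  · have h1 : s ≤ t := hjs.trans e3
    rcases le_max_iff.1 h1 with h | h
    · exact h
    · linarith

theorem mul_le_indicator {a b κ : ℝ} {A B : Prop} [Decidable (A ∧ B)] (ha0 : 0 ≤ a) (ha1 : a ≤ 1)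
    (hb0 : 0 ≤ b) (hb1 : b ≤ 1) (hκ : 0 ≤ κ) (ha : ¬A → a ≤ κ) (hb : ¬B → b ≤ κ) :
    a * b ≤ (if A ∧ B then 1 else 0) + κ := by
  split_ifs with h
  · nlinarith
  · rcases not_and_or.1 h with h | h
    · nlinarith [ha h]
    · nlinarith [hb h]

theorem indicator_le_mul {a b κ : ℝ} {A B : Prop} [Decidable (A ∧ B)] (ha0 : 0 ≤ a) (ha1 : a ≤ 1)
    (hb0 : 0 ≤ b) (hb1 : b ≤ 1) (hκ : 0 ≤ κ) (ha : A → 1 - κ ≤ a) (hb : B → 1 - κ ≤ b) :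
    (if A ∧ B then 1 else 0) - 2 * κ ≤ a * b := by
  split_ifs with h
  · nlinarith [ha h.1, hb h.2]
  · nlinarith

open Classical in
/-- If the ranks of the samples `z₁`, `z₂` are close to `S₁`, `S₂`, the ECBC estimate of the
conditional distribution function at `v` is close to `p · · v`. -/
theorem consistency {V S₁ S₂ : ℕ → ℝ} {p : ℝ → ℝ → ℝ → ℝ} {v₀ : ℝ} (hv₀ : v₀ ∈ Icc (0 : ℝ) 1)
    (hV : ∀ i, V i ∈ Ioo (0 : ℝ) 1) (hinj : Function.Injective V) (hGC : GC V)
    (hS₁ : ∀ i, S₁ i ∈ Ioo (0 : ℝ) 1) (hS₂ : ∀ i, S₂ i ∈ Ioo (0 : ℝ) 1)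
    (hp : ContinuousOn (fun x : ℝ × ℝ × ℝ => p x.1 x.2.1 x.2.2)
      (Icc 0 1 ×ˢ Icc 0 1 ×ˢ Ioo 0 1))
    (hp01 : ∀ u₁ ∈ Icc (0 : ℝ) 1, ∀ u₂ ∈ Icc (0 : ℝ) 1, ∀ v ∈ Ioo (0 : ℝ) 1,
      p u₁ u₂ v ∈ Icc (0 : ℝ) 1)
    (hlln : ∀ J : ℕ, 1 ≤ J → ∀ j₁ ≤ J, ∀ j₂ ≤ J, LocalLLN V
      (fun i => if S₁ i ≤ j₁ / J ∧ S₂ i ≤ j₂ / J then 1 else 0)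
      (fun i => p (j₁ / J) (j₂ / J) (V i)) v₀)
    {ε δ β : ℝ} (hε : 0 < ε) (hδ : 0 < δ) (hβ : β < 1) :
    ∃ η > (0 : ℝ), ∃ K : ℕ, 1 ≤ K ∧ ∀ᶠ n : ℕ in atTop, ∀ m ≥ K, (m : ℝ) ≤ (n : ℝ) ^ β →
      ∀ k ≤ n, node v₀ n k ∈ Icc δ (1 - δ) → ∀ l₁ ≥ K, ∀ l₂ ≥ K, ∀ z₁ z₂ : Fin n → ℝ,
      (∀ i : Fin n, V i ∈ Icc (δ / 2) (1 - δ / 2) →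
        RankClose z₁ (fun i => S₁ i) η i ∧ RankClose z₂ (fun i => S₂ i) η i) →
      ∀ u₁ ∈ Icc (0 : ℝ) 1, ∀ u₂ ∈ Icc (0 : ℝ) 1,
        |∑ i : Fin n, vWeight m (node v₀ n k) (fun i : Fin n => V i) i *
          (bern l₁ (cellCDF z₁ i) u₁ * bern l₂ (cellCDF z₂ i) u₂) - p u₁ u₂ (node v₀ n k)| ≤ ε := by
  -- Error budget: `2 e` from the law of large numbers and the continuity of `p`, at most `e` from
  -- the smoothed indicators, and `e` from the far observations.
  set e := ε / 4 with he
  have he0 : 0 < e := by positivity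
  set C : Set (ℝ × ℝ × ℝ) := Icc 0 1 ×ˢ Icc 0 1 ×ˢ Icc (δ / 2) (1 - δ / 2) with hC
  have hCc : IsCompact C := isCompact_Icc.prod (isCompact_Icc.prod isCompact_Icc)
  have hsub : Icc (δ / 2) (1 - δ / 2) ⊆ Ioo (0 : ℝ) 1 := fun x hx =>
    ⟨by linarith [hx.1], by linarith [hx.2]⟩
  have huc := hCc.uniformContinuousOn_of_continuous
    (hp.mono (Set.prod_mono le_rfl (Set.prod_mono le_rfl hsub)))
  rw [Metric.uniformContinuousOn_iff] at huc
  obtain ⟨r, hr0, hr⟩ := huc e he0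
  set η := r / 4 with hη
  have hη0 : 0 < η := by positivity
  -- The bound `δ / 2` keeps covariates near the node inside the band where `p` is uniformly
  -- continuous and rank closeness is assumed.
  set ρ := min r (δ / 2) with hρ
  have hρ0 : 0 < ρ := lt_min hr0 (by positivity)
  obtain ⟨J', hJ'⟩ := exists_nat_one_div_lt hη0
  set J := J' + 1 with hJdef
  have hJ : 1 ≤ J := by omega
  have hJη : 1 / (J : ℝ) < η := by rw [hJdef]; push_cast; exact hJ'
  obtain ⟨K₁, hK₁, hconc⟩ := exists_concentration hV hinj hGC (τ := e / 2 * ρ ^ 2) (by positivity)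
  obtain ⟨K₂, hK₂⟩ := exists_nat_gt (1 / (2 * e * η ^ 2))
  refine ⟨η, hη0, max K₁ K₂, hK₁.trans (le_max_left _ _), ?_⟩
  have hlln' : ∀ᶠ n : ℕ in atTop, ∀ j₁ ∈ Finset.range (J + 1), ∀ j₂ ∈ Finset.range (J + 1),
      ∀ m : ℕ, 1 ≤ m → (m : ℝ) ≤ (n : ℝ) ^ β → ∀ k ≤ n,
      |∑ i : Fin n, vWeight m (node v₀ n k) (fun i : Fin n => V i) i *
        ((if S₁ i ≤ j₁ / J ∧ S₂ i ≤ j₂ / J then 1 else 0) - p (j₁ / J) (j₂ / J) (V i))| ≤ e := by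
    rw [Filter.eventually_all_finset]
    intro j₁ hj₁
    rw [Filter.eventually_all_finset]
    intro j₂ hj₂
    exact hlln J hJ j₁ (Nat.lt_succ_iff.1 (Finset.mem_range.1 hj₁)) j₂
      (Nat.lt_succ_iff.1 (Finset.mem_range.1 hj₂)) β hβ e he0
  filter_upwards [hconc, hlln', eventually_ge_atTop 1] with n hconcn hllnn hn1 m hm hmβ k hk hnode
    l₁ hl₁ l₂ hl₂ z₁ z₂ hz u₁ hu₁ u₂ hu₂
  set v := node v₀ n k with hv
  have hv01 : v ∈ Icc (0 : ℝ) 1 := node_mem hv₀ hk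
  have hvmid : v ∈ Icc (δ / 2) (1 - δ / 2) := ⟨by linarith [hnode.1], by linarith [hnode.2]⟩
  have hm1 : 1 ≤ m := hK₁.trans ((le_max_left _ _).trans hm)
  have hτ := hconcn m ((le_max_left _ _).trans hm) v hv01
  have hW0 := vWeight_nonneg m hv01 (fun i : Fin n => V i)
  have hW1 := sum_vWeight hn1 hm1 v (x := fun i : Fin n => V i) (hinj.comp Fin.val_injective)
  have hK₂0 : (0 : ℝ) < K₂ := lt_trans (by positivity) hK₂
  have hκ : ∀ l : ℕ, max K₁ K₂ ≤ l → 1 ≤ l ∧ 1 / (4 * (l : ℝ) * η ^ 2) ≤ e / 2 := by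
    intro l hl
    have hl' : (K₂ : ℝ) ≤ l := by exact_mod_cast (le_max_right _ _).trans hl
    have hl0 : (0 : ℝ) < l := hK₂0.trans_le hl'
    refine ⟨by exact_mod_cast hl0, ?_⟩
    rw [div_lt_iff₀ (by positivity)] at hK₂
    rw [div_le_iff₀ (by positivity)]
    have h1 : (K₂ : ℝ) * (2 * e * η ^ 2) ≤ l * (2 * e * η ^ 2) :=
      mul_le_mul_of_nonneg_right hl' (by positivity)
    nlinarith
  obtain ⟨hl₁1, hκ₁⟩ := hκ l₁ hl₁
  obtain ⟨hl₂1, hκ₂⟩ := hκ l₂ hl₂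
  have hband : ∀ i : Fin n, |V i - v| < ρ → V i ∈ Icc (δ / 2) (1 - δ / 2) := by
    intro i hi
    have h1 := abs_lt.1 (hi.trans_le (min_le_right r (δ / 2)))
    exact ⟨by linarith [hnode.1], by linarith [hnode.2]⟩
  have hgrid : ∀ j : ℕ, j ≤ J → (j / J : ℝ) ∈ Icc (0 : ℝ) 1 := fun j hj =>
    ⟨by positivity, div_le_one_of_le₀ (by exact_mod_cast hj) (by positivity)⟩
  have hclose : ∀ j₁ ≤ J, ∀ j₂ ≤ J, |(j₁ / J : ℝ) - u₁| ≤ 3 * η → |(j₂ / J : ℝ) - u₂| ≤ 3 * η →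
      ∀ i : Fin n, |V i - v| < ρ → |p (j₁ / J) (j₂ / J) (V i) - p u₁ u₂ v| < e := by
    intro j₁ hj₁ j₂ hj₂ h1 h2 i hi
    have := hr (j₁ / J, j₂ / J, V i) ⟨hgrid j₁ hj₁, hgrid j₂ hj₂, hband i hi⟩
      (u₁, u₂, v) ⟨hu₁, hu₂, hvmid⟩ (by
        rw [Prod.dist_eq, Prod.dist_eq, Real.dist_eq, Real.dist_eq, Real.dist_eq]
        have h3 : 3 * η < r := by rw [hη]; linarith
        exact max_lt (h1.trans_lt h3) (max_lt (h2.trans_lt h3)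
          (hi.trans_le (min_le_left _ _))))
    rwa [Real.dist_eq] at this
  have hP := hp01 u₁ hu₁ u₂ hu₂ v (hsub hvmid)
  have hq : ∀ j₁ ≤ J, ∀ j₂ ≤ J, ∀ i, p (j₁ / J) (j₂ / J) (V i) ∈ Icc (0 : ℝ) 1 :=
    fun j₁ hj₁ j₂ hj₂ i => hp01 _ (hgrid j₁ hj₁) _ (hgrid j₂ hj₂) _ (hV i)
  have ha0 : ∀ i, 0 ≤ bern l₁ (cellCDF z₁ i) u₁ := fun i => bern_nonneg hu₁ (cellCDF_nonneg z₁ i)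
  have hb0 : ∀ i, 0 ≤ bern l₂ (cellCDF z₂ i) u₂ := fun i => bern_nonneg hu₂ (cellCDF_nonneg z₂ i)
  have ha1 : ∀ i, bern l₁ (cellCDF z₁ i) u₁ ≤ 1 := fun i => bern_le_one hu₁ (cellCDF_le_one z₁ i)
  have hb1 : ∀ i, bern l₂ (cellCDF z₂ i) u₂ ≤ 1 := fun i => bern_le_one hu₂ (cellCDF_le_one z₂ i)
  have hτρ : e / 2 * ρ ^ 2 / ρ ^ 2 = e / 2 := by field_simp
  have hup : ∑ i : Fin n, vWeight m v (fun i : Fin n => V i) i *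
      (bern l₁ (cellCDF z₁ i) u₁ * bern l₂ (cellCDF z₂ i) u₂) ≤ p u₁ u₂ v + ε := by
    -- An observation beyond the upper grid level exceeds `u` by at least `2 η`, so its smoothed
    -- indicator is negligible. The lower bound uses grid levels below `u` in the same way.
    obtain ⟨j₁, hj₁, hd₁, hs₁⟩ := exists_grid_above hJ hu₁ hη0 hJη
    obtain ⟨j₂, hj₂, hd₂, hs₂⟩ := exists_grid_above hJ hu₂ hη0 hJη
    have h := weighted_le (κ := e / 2) (ε := e) (P := p u₁ u₂ v)
      (q := fun i => p (j₁ / J) (j₂ / J) (V i))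
      (b := fun i => if S₁ i ≤ j₁ / J ∧ S₂ i ≤ j₂ / J then 1 else 0)
      (a := fun i => bern l₁ (cellCDF z₁ i) u₁ * bern l₂ (cellCDF z₂ i) u₂)
      hW0 hW1 hτ hρ0 (fun i => mul_le_one₀ (ha1 i) (hb0 i) (hb1 i))
      (fun i => by split_ifs <;> norm_num) (fun i => (hq j₁ hj₁ j₂ hj₂ i).2) hP.1 (by positivity)
      he0.le (fun i hi => mul_le_indicator (ha0 i) (ha1 i) (hb0 i) (hb1 i) (by positivity)
        (fun h => ((hz i (hband i hi)).1.bern_le hl₁1 hη0 hu₁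
          (hs₁ _ (hS₁ i).2 (not_le.1 h))).trans hκ₁)
        (fun h => ((hz i (hband i hi)).2.bern_le hl₂1 hη0 hu₂
          (hs₂ _ (hS₂ i).2 (not_le.1 h))).trans hκ₂))
      (fun i hi => by linarith [(abs_lt.1 (hclose j₁ hj₁ j₂ hj₂ hd₁ hd₂ i hi)).2])
      (abs_le.1 (hllnn j₁ (Finset.mem_range.2 (by omega)) j₂ (Finset.mem_range.2 (by omega))
        m hm1 hmβ k hk)).2
    rw [hτρ] at h
    linarith
  have hlo : p u₁ u₂ v - ε ≤ ∑ i : Fin n, vWeight m v (fun i : Fin n => V i) i *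
      (bern l₁ (cellCDF z₁ i) u₁ * bern l₂ (cellCDF z₂ i) u₂) := by
    obtain ⟨j₁, hj₁, hd₁, hs₁⟩ := exists_grid_below hJ hu₁ hη0 hJη
    obtain ⟨j₂, hj₂, hd₂, hs₂⟩ := exists_grid_below hJ hu₂ hη0 hJη
    have h := le_weighted (κ := 2 * (e / 2)) (ε := e) (P := p u₁ u₂ v)
      (q := fun i => p (j₁ / J) (j₂ / J) (V i))
      (b := fun i => if S₁ i ≤ j₁ / J ∧ S₂ i ≤ j₂ / J then 1 else 0)
      (a := fun i => bern l₁ (cellCDF z₁ i) u₁ * bern l₂ (cellCDF z₂ i) u₂)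
      hW0 hW1 hτ hρ0 (fun i => mul_nonneg (ha0 i) (hb0 i))
      (fun i => by split_ifs <;> norm_num) (fun i => (hq j₁ hj₁ j₂ hj₂ i).1) hP.2 (by positivity)
      he0.le (fun i hi => indicator_le_mul (ha0 i) (ha1 i) (hb0 i) (hb1 i) (by positivity)
        (fun h => le_trans (by linarith) ((hz i (hband i hi)).1.one_sub_le_bern hl₁1 hη0 hu₁
          (hs₁ _ (hS₁ i).1 h)))
        (fun h => le_trans (by linarith) ((hz i (hband i hi)).2.one_sub_le_bern hl₂1 hη0 hu₂
          (hs₂ _ (hS₂ i).1 h))))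
      (fun i hi => by linarith [(abs_lt.1 (hclose j₁ hj₁ j₂ hj₂ hd₁ hd₂ i hi)).1])
      (abs_le.1 (hllnn j₁ (Finset.mem_range.2 (by omega)) j₂ (Finset.mem_range.2 (by omega))
        m hm1 hmβ k hk)).1
    rw [hτρ] at h
    linarith
  rw [abs_le]
  constructor <;> linarith

/-! ### The empirical prior concentrates on moderately large degrees -/

theorem poisson_succ (r : ℝ≥0) (k : ℕ) :
    ((k + 1 : ℕ) : ℝ≥0∞) * poissonMeasure r {k + 1} = r * poissonMeasure r {k} := by
  rw [poissonMeasure_singleton, poissonMeasure_singleton, ← ENNReal.ofReal_natCast,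
    ← ENNReal.ofReal_mul (by positivity), ← ENNReal.ofReal_coe_nnreal,
    ← ENNReal.ofReal_mul (by positivity), Nat.factorial_succ]
  congr 1
  push_cast
  field_simp
  ring

theorem poisson_lintegral (r : ℝ≥0) : ∫⁻ k, (k : ℝ≥0∞) ∂(poissonMeasure r) = r := by
  rw [lintegral_countable', tsum_eq_zero_add' ENNReal.summable]
  simp only [poisson_succ, Nat.cast_zero, zero_mul, zero_add]
  rw [ENNReal.tsum_mul_left]
  have h1 : ∑' k, poissonMeasure r {k} = 1 := by
    have := lintegral_countable' (μ := poissonMeasure r) (fun _ => 1)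
    simp only [lintegral_const, measure_univ, one_mul] at this
    exact this.symm
  rw [h1, mul_one]

/-- By `(k + 1) p_{k+1} = r p_k`, `r` times the lower tail is a sum of `K` terms, each at most `K`.
This crude bound suffices as `r → ∞`. -/
theorem poisson_lt_le {r : ℝ≥0} (hr : r ≠ 0) (K : ℕ) :
    poissonMeasure r {k | k < K} ≤ (K * K : ℕ) / r := by
  have h0 : (r : ℝ≥0∞) ≠ 0 := by exact_mod_cast hr
  rw [ENNReal.le_div_iff_mul_le (Or.inl h0) (Or.inl ENNReal.coe_ne_top)]
  have h1 : {k | k < K} = ⋃ k ∈ Finset.range K, {k} := by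
    ext j; simp
  calc poissonMeasure r {k | k < K} * r
      ≤ (∑ k ∈ Finset.range K, poissonMeasure r {k}) * r := by
        rw [h1]; exact mul_le_mul' (measure_biUnion_finset_le _ _) le_rfl
    _ = ∑ k ∈ Finset.range K, ((k + 1 : ℕ) : ℝ≥0∞) * poissonMeasure r {k + 1} := by
        rw [Finset.sum_mul]
        exact Finset.sum_congr rfl fun k _ => by rw [poisson_succ, mul_comm]
    _ ≤ ∑ k ∈ Finset.range K, (K : ℝ≥0∞) := by
        refine Finset.sum_le_sum fun k hk => ?_
        calc ((k + 1 : ℕ) : ℝ≥0∞) * poissonMeasure r {k + 1} ≤ (K : ℝ≥0∞) * 1 := by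
              refine mul_le_mul' ?_ prob_le_one
              exact_mod_cast Finset.mem_range.1 hk
          _ = K := mul_one _
    _ = (K * K : ℕ) := by simp

theorem poisson_ge_le (r : ℝ≥0) (s : ℕ) {M : ℝ} (hM : 0 < M) :
    poissonMeasure r {k | M ≤ (k + s : ℕ)} ≤ (r + s) / ENNReal.ofReal M := by
  have h1 := meas_ge_le_lintegral_div (μ := poissonMeasure r)
    (f := fun k : ℕ => (k : ℝ≥0∞) + s) (by fun_prop) (ε := ENNReal.ofReal M)
    (by simpa using hM) ENNReal.ofReal_ne_top
  rw [lintegral_add_right _ measurable_const, poisson_lintegral, lintegral_const, measure_univ,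
    mul_one] at h1
  refine le_trans (measure_mono fun k hk => ?_) h1
  have hk' : M ≤ (k + s : ℕ) := hk
  change ENNReal.ofReal M ≤ (k : ℝ≥0∞) + s
  rw [← Nat.cast_add, ← ENNReal.ofReal_natCast]
  exact ENNReal.ofReal_le_ofReal hk'

theorem degreeLaw_le {n s : ℕ} {A : Set ℕ} {b : ℝ≥0∞}
    (h : ∀ α ∈ Icc (1 / 3 : ℝ) (2 / 3), poissonMeasure ((n : ℝ≥0) ^ α) {k | k + s ∈ A} ≤ b) :
    degreeLaw n s A ≤ b := by
  have hvol : IsProbabilityMeasure (cond volume (Icc (1 / 3 : ℝ) (2 / 3))) :=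
    cond_isProbabilityMeasure_of_finite (by rw [Real.volume_Icc]; norm_num) (by simp)
  rw [degreeLaw, Measure.bind_apply (MeasurableSet.of_discrete) (shiftedPoisson n s).aemeasurable]
  calc ∫⁻ α, shiftedPoisson n s α A ∂(cond volume (Icc (1 / 3 : ℝ) (2 / 3)))
      ≤ ∫⁻ _, b ∂(cond volume (Icc (1 / 3 : ℝ) (2 / 3))) := by
        refine lintegral_mono_ae ?_
        filter_upwards [ae_cond_mem measurableSet_Icc] with α hα
        change (poissonMeasure ((n : ℝ≥0) ^ α)).map (fun k => k + s) A ≤ b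
        rw [Measure.map_apply (by fun_prop) MeasurableSet.of_discrete]
        exact h α hα
    _ = b := by rw [lintegral_const, measure_univ, mul_one]

instance (n s : ℕ) : IsMarkovKernel (shiftedPoisson n s) :=
  ⟨fun α => by
    change IsProbabilityMeasure ((poissonMeasure ((n : ℝ≥0) ^ α)).map (fun k => k + s))
    exact Measure.isProbabilityMeasure_map (by fun_prop)⟩

instance (n s : ℕ) : IsProbabilityMeasure (degreeLaw n s) := by
  have hvol : IsProbabilityMeasure (cond volume (Icc (1 / 3 : ℝ) (2 / 3))) :=
    cond_isProbabilityMeasure_of_finite (by rw [Real.volume_Icc]; norm_num) (by simp)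
  unfold degreeLaw
  infer_instance

theorem tendsto_degreeLaw_lt (s K : ℕ) :
    Tendsto (fun n => degreeLaw n s {k | k < K}) atTop (𝓝 0) := by
  have hlim : Tendsto (fun n : ℕ => ((K * K : ℕ) : ℝ≥0∞) / (((n : ℝ≥0) ^ (1 / 3 : ℝ) : ℝ≥0) : ℝ≥0∞))
      atTop (𝓝 0) := by
    have h1 : Tendsto (fun n : ℕ => (((n : ℝ≥0) ^ (1 / 3 : ℝ) : ℝ≥0) : ℝ≥0∞)) atTop (𝓝 ∞) := by
      rw [ENNReal.tendsto_coe_nhds_top]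
      exact (NNReal.tendsto_rpow_atTop (by norm_num)).comp tendsto_natCast_atTop_atTop
    have h2 := ENNReal.Tendsto.const_div (a := ((K * K : ℕ) : ℝ≥0∞)) h1
      (Or.inr (ENNReal.natCast_ne_top _))
    simpa using h2
  refine tendsto_of_tendsto_of_tendsto_of_le_of_le' tendsto_const_nhds hlim
    (Eventually.of_forall fun n => zero_le) ?_
  filter_upwards [eventually_ge_atTop 1] with n hn
  have hn1 : (1 : ℝ≥0) ≤ n := by exact_mod_cast hn
  have hn0 : (n : ℝ≥0) ≠ 0 := (zero_lt_one.trans_le hn1).ne'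
  refine degreeLaw_le fun α hα => ?_
  refine (measure_mono (t := {k | k < K}) fun k (hk : k + s < K) => ?_).trans
    ((poisson_lt_le (by simp [hn0]) K).trans ?_)
  · exact lt_of_le_of_lt (Nat.le_add_right k s) hk
  · refine ENNReal.div_le_div_left ?_ _
    exact_mod_cast NNReal.rpow_le_rpow_of_exponent_le hn1 hα.1

/-- Markov's inequality: the mean is at most `3 n ^ (2 / 3)`. The exponent `3 / 4` exceeds `2 / 3`,
so the tail vanishes, and stays below `1`, as the local law of large numbers requires. -/
theorem tendsto_degreeLaw_gt :
    Tendsto (fun n : ℕ => degreeLaw n 2 {k | (n : ℝ) ^ (3 / 4 : ℝ) < k}) atTop (𝓝 0) := by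
  have hlim : Tendsto (fun n : ℕ => ENNReal.ofReal (3 * (n : ℝ) ^ (-(1 / 12) : ℝ)))
      atTop (𝓝 0) := by
    have h1 : Tendsto (fun n : ℕ => 3 * (n : ℝ) ^ (-(1 / 12) : ℝ)) atTop (𝓝 (3 * 0)) :=
      ((tendsto_rpow_neg_atTop (by norm_num)).comp tendsto_natCast_atTop_atTop).const_mul 3
    have h2 := ENNReal.tendsto_ofReal h1
    simpa using h2
  refine tendsto_of_tendsto_of_tendsto_of_le_of_le' tendsto_const_nhds hlim
    (Eventually.of_forall fun n => zero_le) ?_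
  filter_upwards [eventually_ge_atTop 1] with n hn
  have hn1 : (1 : ℝ) ≤ n := by exact_mod_cast hn
  have hn0 : (0 : ℝ) < n := zero_lt_one.trans_le hn1
  refine degreeLaw_le fun α hα => ?_
  refine (measure_mono (t := {k : ℕ | (n : ℝ) ^ (3 / 4 : ℝ) ≤ (k + 2 : ℕ)})
    fun k (hk : (n : ℝ) ^ (3 / 4 : ℝ) < (k + 2 : ℕ)) => hk.le).trans
    ((poisson_ge_le _ 2 (by positivity)).trans ?_)
  rw [← ENNReal.ofReal_coe_nnreal, ← ENNReal.ofReal_natCast, ← ENNReal.ofReal_add (by positivity)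
    (by positivity), ← ENNReal.ofReal_div_of_pos (by positivity)]
  refine ENNReal.ofReal_le_ofReal ?_
  rw [div_le_iff₀ (by positivity), mul_assoc, ← Real.rpow_add hn0]
  push_cast
  have h1 : (n : ℝ) ^ α ≤ (n : ℝ) ^ (2 / 3 : ℝ) := Real.rpow_le_rpow_of_exponent_le hn1 hα.2
  have h2 : (1 : ℝ) ≤ (n : ℝ) ^ (2 / 3 : ℝ) := Real.one_le_rpow hn1 (by norm_num)
  have h3 : (-(1 / 12) + 3 / 4 : ℝ) = 2 / 3 := by norm_num
  rw [h3]
  linarith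

/-- A union bound over the coordinates. Only `m` needs an upper bound, since the weights do not
involve `l₁` and `l₂`. -/
theorem tendsto_empiricalPrior_bad (K : ℕ) : Tendsto (fun n : ℕ => empiricalPrior n
    {q | q.1 < K ∨ q.2.1 < K ∨ q.2.2 < K ∨ (n : ℝ) ^ (3 / 4 : ℝ) < q.2.2}) atTop (𝓝 0) := by
  have hlim := (((tendsto_degreeLaw_lt 1 K).add (tendsto_degreeLaw_lt 1 K)).add
    (tendsto_degreeLaw_lt 2 K)).add tendsto_degreeLaw_gt
  simp only [add_zero] at hlim
  refine tendsto_of_tendsto_of_tendsto_of_le_of_le tendsto_const_nhds hlim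
    (fun n => zero_le) fun n => ?_
  have e1 : empiricalPrior n {q | q.1 < K} = degreeLaw n 1 {k | k < K} := by
    have : {q : ℕ × ℕ × ℕ | q.1 < K} = {k | k < K} ×ˢ univ := by ext; simp
    rw [empiricalPrior, this, Measure.prod_prod]; simp
  have e2 : empiricalPrior n {q | q.2.1 < K} = degreeLaw n 1 {k | k < K} := by
    have : {q : ℕ × ℕ × ℕ | q.2.1 < K} = univ ×ˢ ({k | k < K} ×ˢ univ) := by ext; simp
    rw [empiricalPrior, this, Measure.prod_prod, Measure.prod_prod]; simp
  have e3 : ∀ A : Set ℕ, empiricalPrior n {q | q.2.2 ∈ A} = degreeLaw n 2 A := by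
    intro A
    have : {q : ℕ × ℕ × ℕ | q.2.2 ∈ A} = univ ×ˢ (univ ×ˢ A) := by ext; simp
    rw [empiricalPrior, this, Measure.prod_prod, Measure.prod_prod]; simp
  have hsub : {q : ℕ × ℕ × ℕ | q.1 < K ∨ q.2.1 < K ∨ q.2.2 < K ∨ (n : ℝ) ^ (3 / 4 : ℝ) < q.2.2} ⊆
      (({q | q.1 < K} ∪ {q | q.2.1 < K}) ∪ {q | q.2.2 ∈ {k | k < K}}) ∪
        {q | q.2.2 ∈ {k : ℕ | (n : ℝ) ^ (3 / 4 : ℝ) < k}} := by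
    rintro q (h | h | h | h)
    · exact Or.inl (Or.inl (Or.inl h))
    · exact Or.inl (Or.inl (Or.inr h))
    · exact Or.inl (Or.inr h)
    · exact Or.inr h
  rw [← e3 {k | k < K}, ← e3 {k : ℕ | (n : ℝ) ^ (3 / 4 : ℝ) < k}]
  nth_rewrite 1 [← e1]
  rw [← e2]
  refine (measure_mono hsub).trans ((measure_union_le _ _).trans (add_le_add ?_ le_rfl))
  exact (measure_union_le _ _).trans (add_le_add (measure_union_le _ _) le_rfl)

/-! ### From the derivative of the ECBC to the expected error of the estimator -/

theorem ecbcDeriv_mem {n : ℕ} (l : Fin 3 → ℕ) {z : Fin n → Fin 3 → ℝ}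
    (hz : Function.Injective fun i => z i 2) {v u₁ u₂ : ℝ} (hv : v ∈ Icc (0 : ℝ) 1)
    (hu₁ : u₁ ∈ Icc (0 : ℝ) 1) (hu₂ : u₂ ∈ Icc (0 : ℝ) 1) :
    ecbcDeriv l z v u₁ u₂ ∈ Icc (0 : ℝ) 1 := by
  -- At degree `0` the ECBC is constant in `v`. Covering this case bounds the error for every degree
  -- without exception.
  rcases Nat.eq_zero_or_pos (l 2) with h0 | hl
  · have : ecbcDeriv l z v u₁ u₂ = 0 := by
      rw [ecbcDeriv]
      simp [ecbc_eq, Fin.prod_univ_three, h0, bern, bw, bernsteinPolynomial]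
    rw [this]; simp
  rw [ecbcDeriv_eq hl]
  have ha0 : ∀ i, 0 ≤ bern (l 0) (cellCDF (fun i' => z i' 0) i) u₁ :=
    fun i => bern_nonneg hu₁ (cellCDF_nonneg _ i)
  have hb0 : ∀ i, 0 ≤ bern (l 1) (cellCDF (fun i' => z i' 1) i) u₂ :=
    fun i => bern_nonneg hu₂ (cellCDF_nonneg _ i)
  have hW0 := vWeight_nonneg (l 2) hv (fun i' => z i' 2)
  refine ⟨Finset.sum_nonneg fun i _ => mul_nonneg (hW0 i) (mul_nonneg (ha0 i) (hb0 i)), ?_⟩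
  rcases Nat.eq_zero_or_pos n with rfl | hn
  · simp
  rw [← sum_vWeight hn hl v hz]
  refine Finset.sum_le_sum fun i _ => mul_le_of_le_one_right (hW0 i) ?_
  exact mul_le_one₀ (bern_le_one hu₁ (cellCDF_le_one _ i)) (hb0 i)
    (bern_le_one hu₂ (cellCDF_le_one _ i))

theorem ecbcDeriv_one_one {n : ℕ} (hn : 1 ≤ n) {l : Fin 3 → ℕ} (hl : ∀ k, 1 ≤ l k)
    {z : Fin n → Fin 3 → ℝ} (hz : Function.Injective fun i => z i 2) (v : ℝ) :
    ecbcDeriv l z v 1 1 = 1 := by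
  rw [ecbcDeriv_eq (hl 2)]
  simp only [bern_at_one (hl 0), bern_at_one (hl 1), cellCDF_at_one, mul_one]
  exact sum_vWeight hn (hl 2) v hz

theorem quantile_mem (F : ℝ → ℝ) (u : ℝ) : quantile F u ∈ Icc (0 : ℝ) 1 := by
  rw [quantile]
  rcases Set.eq_empty_or_nonempty {t | t ∈ Icc (0 : ℝ) 1 ∧ u ≤ F t} with h | ⟨t, ht⟩
  -- The infimum of the empty set is `0` by convention, which still lies in `[0, 1]`.
  · rw [h, Real.sInf_empty]; simp
  · exact ⟨Real.sInf_nonneg fun s hs => hs.1.1, (csInf_le ⟨0, fun s hs => hs.1.1⟩ ht).trans ht.1.2⟩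

/-- A function uniformly `ε`-close to the identity crosses level `u` only beyond `u - ε`, and has
done so by `u + ε`; monotonicity is not needed. The value at `1` keeps the defining set nonempty. -/
theorem abs_quantile_sub_le {F : ℝ → ℝ} {u ε : ℝ} (hF : ∀ t ∈ Icc (0 : ℝ) 1, |F t - t| ≤ ε)
    (hF1 : F 1 = 1) (hu : u ∈ Icc (0 : ℝ) 1) : |quantile F u - u| ≤ ε := by
  have hε : 0 ≤ ε := (abs_nonneg _).trans (hF 1 (by simp))
  have hne : {t | t ∈ Icc (0 : ℝ) 1 ∧ u ≤ F t}.Nonempty := ⟨1, by simp, by rw [hF1]; exact hu.2⟩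
  rw [abs_le]
  constructor
  · have : u - ε ≤ quantile F u := le_csInf hne fun t ht => by
      linarith [(abs_le.1 (hF t ht.1)).2, ht.2]
    linarith
  · by_cases h : u + ε ≤ 1
    · have hm : u + ε ∈ Icc (0 : ℝ) 1 := ⟨by linarith [hu.1], h⟩
      have : quantile F u ≤ u + ε := csInf_le ⟨0, fun s hs => hs.1.1⟩
        ⟨hm, by linarith [(abs_le.1 (hF _ hm)).1]⟩
      linarith
    · linarith [(quantile_mem F u).2]

theorem supNorm_le {g : ℝ → ℝ → ℝ} {ε : ℝ}
    (h : ∀ u₁ ∈ Icc (0 : ℝ) 1, ∀ u₂ ∈ Icc (0 : ℝ) 1, |g u₁ u₂| ≤ ε) :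
    supNorm g ≤ ENNReal.ofReal ε := by
  refine iSup₂_le fun u₁ hu₁ => iSup₂_le fun u₂ hu₂ => ?_
  rw [Real.enorm_eq_ofReal_abs]
  exact ENNReal.ofReal_le_ofReal (h u₁ hu₁ u₂ hu₂)

/-- Since the margins of `c` are uniform, inserting the estimated quantiles moves the arguments of
`c` little, and uniform continuity absorbs this. Degrees outside the good set cost at most their
prior probability. -/
theorem tendsto_expectedError {z : ∀ n : ℕ, Fin n → Fin 3 → ℝ} {c : ℝ → ℝ → ℝ} {v : ℝ}
    (hv : v ∈ Icc (0 : ℝ) 1) (hz : ∀ n, Function.Injective fun i => z n i 2)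
    (hc01 : ∀ u₁ ∈ Icc (0 : ℝ) 1, ∀ u₂ ∈ Icc (0 : ℝ) 1, c u₁ u₂ ∈ Icc (0 : ℝ) 1)
    (hc₁ : ∀ t ∈ Icc (0 : ℝ) 1, c t 1 = t) (hc₂ : ∀ t ∈ Icc (0 : ℝ) 1, c 1 t = t)
    (hcont : ContinuousOn (fun x : ℝ × ℝ => c x.1 x.2) (Icc 0 1 ×ˢ Icc 0 1))
    (h : ∀ ε > (0 : ℝ), ∃ K : ℕ, ∀ᶠ n : ℕ in atTop, ∀ l : Fin 3 → ℕ, K ≤ l 0 → K ≤ l 1 → K ≤ l 2 →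
      (l 2 : ℝ) ≤ (n : ℝ) ^ (3 / 4 : ℝ) → ∀ u₁ ∈ Icc (0 : ℝ) 1, ∀ u₂ ∈ Icc (0 : ℝ) 1,
        |ecbcDeriv l (z n) v u₁ u₂ - c u₁ u₂| ≤ ε) :
    Tendsto (fun n => expectedError (z n) c v) atTop (𝓝 0) := by
  have hgood : ∀ ε > (0 : ℝ), ∃ K : ℕ, ∀ᶠ n : ℕ in atTop, ∀ l : Fin 3 → ℕ, K ≤ l 0 → K ≤ l 1 →
      K ≤ l 2 → (l 2 : ℝ) ≤ (n : ℝ) ^ (3 / 4 : ℝ) → ∀ u₁ ∈ Icc (0 : ℝ) 1, ∀ u₂ ∈ Icc (0 : ℝ) 1,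
        |estimator l (z n) v u₁ u₂ - c u₁ u₂| ≤ ε := by
    intro ε hε
    have huc := (isCompact_Icc.prod isCompact_Icc).uniformContinuousOn_of_continuous hcont
    rw [Metric.uniformContinuousOn_iff] at huc
    obtain ⟨r, hr0, hr⟩ := huc (ε / 2) (half_pos hε)
    obtain ⟨K, hK⟩ := h (min (ε / 2) (r / 2)) (lt_min (half_pos hε) (half_pos hr0))
    refine ⟨max K 1, ?_⟩
    filter_upwards [hK, eventually_ge_atTop 1] with n hn hn1 l h0 h1 h2 hl u₁ hu₁ u₂ hu₂
    have hn' := hn l ((le_max_left _ _).trans h0) ((le_max_left _ _).trans h1)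
      ((le_max_left _ _).trans h2) hl
    have hl1 : ∀ k, 1 ≤ l k := by
      intro k
      fin_cases k
      · exact (le_max_right _ _).trans h0
      · exact (le_max_right _ _).trans h1
      · exact (le_max_right _ _).trans h2
    have h11 := ecbcDeriv_one_one hn1 hl1 (hz n) v
    have hone : (1 : ℝ) ∈ Icc (0 : ℝ) 1 := by simp
    have hq₁ := abs_quantile_sub_le (F := fun t => ecbcDeriv l (z n) v t 1) (fun t ht => by
      have := hn' t ht 1 hone
      rw [hc₁ t ht] at this
      exact this.trans (min_le_right _ _)) h11 hu₁
    have hq₂ := abs_quantile_sub_le (F := fun t => ecbcDeriv l (z n) v 1 t) (fun t ht => by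
      have := hn' 1 hone t ht
      rw [hc₂ t ht] at this
      exact this.trans (min_le_right _ _)) h11 hu₂
    rw [estimator]
    set q₁ := quantile (fun t => ecbcDeriv l (z n) v t 1) u₁
    set q₂ := quantile (fun t => ecbcDeriv l (z n) v 1 t) u₂
    have hm₁ : q₁ ∈ Icc (0 : ℝ) 1 := quantile_mem _ _
    have hm₂ : q₂ ∈ Icc (0 : ℝ) 1 := quantile_mem _ _
    have e1 := (hn' q₁ hm₁ q₂ hm₂).trans (min_le_left _ _)
    have e2 := hr (q₁, q₂) ⟨hm₁, hm₂⟩ (u₁, u₂) ⟨hu₁, hu₂⟩ (by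
      rw [Prod.dist_eq, Real.dist_eq, Real.dist_eq]
      exact max_lt (hq₁.trans_lt (by linarith)) (hq₂.trans_lt (by linarith)))
    rw [Real.dist_eq] at e2
    have e3 := abs_add_le (ecbcDeriv l (z n) v q₁ q₂ - c q₁ q₂) (c q₁ q₂ - c u₁ u₂)
    rw [sub_add_sub_cancel] at e3
    simp only at e2
    linarith
  have hall : ∀ n (l : Fin 3 → ℕ), supNorm (fun u₁ u₂ => estimator l (z n) v u₁ u₂ - c u₁ u₂) ≤
      1 := by
    intro n l
    rw [← ENNReal.ofReal_one]
    refine supNorm_le fun u₁ hu₁ u₂ hu₂ => ?_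
    have h1 := ecbcDeriv_mem l (hz n) hv
      (quantile_mem (fun t => ecbcDeriv l (z n) v t 1) u₁)
      (quantile_mem (fun t => ecbcDeriv l (z n) v 1 t) u₂)
    have h2 := hc01 u₁ hu₁ u₂ hu₂
    rw [estimator, abs_le]
    constructor <;> linarith [h1.1, h1.2, h2.1, h2.2]
  rw [ENNReal.tendsto_nhds_zero]
  intro ε hε
  obtain ⟨δ, hδ0, hδ⟩ := ENNReal.lt_iff_exists_real_btwn.1 (ENNReal.half_pos hε.ne')
  have hδpos : 0 < δ := by
    have := hδ.1
    simpa using this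
  obtain ⟨K, hK⟩ := hgood δ hδpos
  filter_upwards [hK, ENNReal.tendsto_nhds_zero.1 (tendsto_empiricalPrior_bad K) (ε / 2)
    (ENNReal.half_pos hε.ne')] with n hn hbad
  set bad : Set (ℕ × ℕ × ℕ) :=
    {q | q.1 < K ∨ q.2.1 < K ∨ q.2.2 < K ∨ (n : ℝ) ^ (3 / 4 : ℝ) < q.2.2} with hbaddef
  have hprior : IsProbabilityMeasure (empiricalPrior n) := by unfold empiricalPrior; infer_instance
  have hpt : ∀ q : ℕ × ℕ × ℕ,
      supNorm (fun u₁ u₂ => estimator ![q.1, q.2.1, q.2.2] (z n) v u₁ u₂ - c u₁ u₂) ≤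
        ENNReal.ofReal δ + bad.indicator 1 q := by
    intro q
    by_cases hq : q ∈ bad
    · rw [Set.indicator_of_mem hq]
      exact (hall n _).trans le_add_self
    · rw [Set.indicator_of_notMem hq, add_zero]
      have hq' : ¬ (q.1 < K ∨ q.2.1 < K ∨ q.2.2 < K ∨ (n : ℝ) ^ (3 / 4 : ℝ) < q.2.2) := hq
      push Not at hq'
      exact supNorm_le (hn ![q.1, q.2.1, q.2.2] hq'.1 hq'.2.1 hq'.2.2.1 hq'.2.2.2)
  calc expectedError (z n) c v
      ≤ ∫⁻ q, (ENNReal.ofReal δ + bad.indicator 1 q) ∂(empiricalPrior n) := lintegral_mono hpt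
    _ = ENNReal.ofReal δ + empiricalPrior n bad := by
        rw [lintegral_add_left measurable_const, lintegral_const, measure_univ, mul_one,
          lintegral_indicator_one MeasurableSet.of_discrete]
    _ ≤ ε / 2 + ε / 2 := add_le_add hδ.2.le hbad
    _ = ε := ENNReal.add_halves ε

/-! ### The population -/

theorem nullSingletonClass_of_ac {ν : Measure ℝ} (h : ν ≪ volume) : NullSingletonClass ν :=
  ⟨fun x => h (measure_singleton x)⟩

theorem real_cdf_le_of_mem_Icc (ν : Measure ℝ) [IsProbabilityMeasure ν] [NullSingletonClass ν]
    {t : ℝ} (ht : t ∈ Icc (0 : ℝ) 1) : ν.real {y | cdf ν y ≤ t} = t :=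
  real_le_of_unif (monotone_cdf ν).measurable
    (unif_of_le (monotone_cdf ν).measurable (fun y => ⟨cdf_nonneg ν y, cdf_le_one ν y⟩)
      fun _ hs => real_cdf_le ν hs) ht

/-- The two nested sets have equal mass `cdf ν a`: what a flat piece of the distribution function
adds is null. -/
theorem ae_cdf_le_iff (ν : Measure ℝ) [IsProbabilityMeasure ν] [NullSingletonClass ν] (a : ℝ) :
    ∀ᵐ y ∂ν, (cdf ν y ≤ cdf ν a ↔ y ≤ a) := by
  have hsub : Iic a ⊆ {y | cdf ν y ≤ cdf ν a} := fun y hy => monotone_cdf ν hy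
  have h1 : ν.real {y | cdf ν y ≤ cdf ν a} = ν.real (Iic a) := by
    rw [real_cdf_le_of_mem_Icc ν ⟨cdf_nonneg ν a, cdf_le_one ν a⟩, cdf_eq_real]
  have h2 : ν {y | cdf ν y ≤ cdf ν a} ≤ ν (Iic a) := by
    rw [← ofReal_measureReal, h1, ofReal_measureReal]
  have h3 := ae_eq_of_subset_of_measure_ge hsub h2 measurableSet_Iic.nullMeasurableSet
    (measure_ne_top _ _)
  filter_upwards [h3.mem_iff] with y hy
  exact hy.symm

theorem ae_mem_Ioo_of_unif {E : Type*} [MeasurableSpace E] {Q : Measure E} {φ : E → ℝ}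
    (hφ : Measurable φ) (hunif : Q.map φ = volume.restrict (Icc 0 1)) :
    ∀ᵐ d ∂Q, φ d ∈ Ioo (0 : ℝ) 1 := by
  refine ae_of_ae_map hφ.aemeasurable (p := fun x => x ∈ Ioo (0 : ℝ) 1) ?_
  rw [hunif, ← restrict_Ioo_eq_restrict_Icc]
  exact ae_restrict_mem measurableSet_Ioo

/-- The derivative of a joint probability with a uniform variable is a probability. -/
theorem deriv_mem_Icc {E : Type*} [MeasurableSpace E] {Q : Measure E} [IsProbabilityMeasure Q]
    {φ : E → ℝ} (hφ : Measurable φ) (hunif : Q.map φ = volume.restrict (Icc 0 1)) {B : Set E}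
    {p t : ℝ} (ht : t ∈ Ioo (0 : ℝ) 1)
    (hp : HasDerivAt (fun s => Q.real (B ∩ {d | φ d ≤ s})) p t) : p ∈ Icc (0 : ℝ) 1 := by
  have hinc : ∀ s r : ℝ, s ∈ Ioo (0 : ℝ) 1 → r ∈ Ioo (0 : ℝ) 1 → s ≤ r →
      Q.real (B ∩ {d | φ d ≤ s}) ≤ Q.real (B ∩ {d | φ d ≤ r}) ∧
      Q.real (B ∩ {d | φ d ≤ r}) - Q.real (B ∩ {d | φ d ≤ s}) ≤ r - s := by
    intro s r hs hr hsr
    refine ⟨measureReal_mono fun d hd => ⟨hd.1, le_trans hd.2 hsr⟩, ?_⟩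
    have hsub : {d | φ d ≤ s} ⊆ {d | φ d ≤ r} := fun d hd => le_trans hd hsr
    have h1 : Q.real ({d | φ d ≤ r} \ {d | φ d ≤ s}) = r - s := by
      rw [measureReal_sdiff hsub (measurableSet_le hφ measurable_const),
        real_le_of_unif hφ hunif ⟨hr.1.le, hr.2.le⟩, real_le_of_unif hφ hunif ⟨hs.1.le, hs.2.le⟩]
    have h2 : Q.real (B ∩ {d | φ d ≤ r}) ≤ Q.real (B ∩ {d | φ d ≤ s}) +
        Q.real ({d | φ d ≤ r} \ {d | φ d ≤ s}) := by
      refine (measureReal_mono fun d hd => ?_).trans (measureReal_union_le _ _)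
      by_cases h : φ d ≤ s
      · exact Or.inl ⟨hd.1, h⟩
      · exact Or.inr ⟨hd.2, h⟩
    linarith
  refine isClosed_Icc.mem_of_tendsto (hasDerivAt_iff_tendsto_slope.1 hp) ?_
  filter_upwards [mem_nhdsWithin_of_mem_nhds (Ioo_mem_nhds ht.1 ht.2), self_mem_nhdsWithin]
    with s hs hst
  rw [slope_def_field]
  rcases lt_or_gt_of_ne (show s ≠ t from hst) with h | h
  · have h1 := hinc s t hs ht h.le
    rw [← neg_div_neg_eq]
    exact ⟨div_nonneg (by linarith [h1.1]) (by linarith),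
      div_le_one_of_le₀ (by linarith [h1.2]) (by linarith)⟩
  · have h1 := hinc t s ht hs h.le
    exact ⟨div_nonneg (by linarith [h1.1]) (by linarith),
      div_le_one_of_le₀ (by linarith [h1.2]) (by linarith)⟩

section Population

variable (Q : Measure ((Fin 2 → ℝ) × ℝ))

/-- The transformed covariate `F_X(X)`. -/
def unifX (d : (Fin 2 → ℝ) × ℝ) : ℝ := cdf (lawX Q) d.2

/-- The transformed response `F_{Y_j}(Y_j)`. -/
def unifY (j : Fin 2) (d : (Fin 2 → ℝ) × ℝ) : ℝ := cdf (lawY Q j) (d.1 j)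

theorem measurable_unifX : Measurable (unifX Q) :=
  (monotone_cdf (lawX Q)).measurable.comp measurable_snd

theorem measurable_unifY (j : Fin 2) : Measurable (unifY Q j) :=
  (monotone_cdf (lawY Q j)).measurable.comp (by fun_prop)

variable {Q} in
theorem hasDerivAt_pairCopula {j : Fin 2} {w : ℝ}
    (hdiff : DifferentiableOn ℝ (pairCopula Q j w) (Ioo 0 1)) {t : ℝ}
    (ht : t ∈ Ioo (0 : ℝ) 1) : HasDerivAt (fun s =>
      Q.real ({d | unifY Q j d ≤ w} ∩ {d | unifX Q d ≤ s})) (deriv (pairCopula Q j w) t) t :=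
  ((hdiff t ht).differentiableAt (Ioo_mem_nhds ht.1 ht.2)).hasDerivAt

variable [IsProbabilityMeasure Q]

/-- The covariate-adjusted response `F_{jX}(Y_j)`. -/
def adjustedY (j : Fin 2) (d : (Fin 2 → ℝ) × ℝ) : ℝ := cdf (condLaw Q j d.2) (d.1 j)

instance : IsProbabilityMeasure (lawX Q) := Measure.isProbabilityMeasure_map (by fun_prop)

instance (j : Fin 2) : IsProbabilityMeasure (lawY Q j) :=
  Measure.isProbabilityMeasure_map (by fun_prop)

instance (j : Fin 2) : IsMarkovKernel (condLaw Q j) := by unfold condLaw; infer_instance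

theorem measurable_adjustedY (j : Fin 2) : Measurable (adjustedY Q j) := by
  have h := measurable_adjust Q
  rw [measurable_pi_iff] at h
  fin_cases j
  · exact h 0
  · exact h 1

variable {Q}

theorem map_unifX (hX : lawX Q ≪ volume) : Q.map (unifX Q) = volume.restrict (Icc 0 1) := by
  have := nullSingletonClass_of_ac hX
  refine unif_of_le (measurable_unifX Q) (fun d => ⟨cdf_nonneg _ _, cdf_le_one _ _⟩) fun t ht => ?_
  conv_rhs => rw [← real_cdf_le (lawX Q) ht]
  rw [lawX, map_measureReal_apply measurable_snd
    (measurableSet_le (monotone_cdf _).measurable measurable_const)]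
  rfl

theorem map_unifY {j : Fin 2} (hY : lawY Q j ≪ volume) :
    Q.map (unifY Q j) = volume.restrict (Icc 0 1) := by
  have := nullSingletonClass_of_ac hY
  refine unif_of_le (measurable_unifY Q j) (fun d => ⟨cdf_nonneg _ _, cdf_le_one _ _⟩)
    fun t ht => ?_
  conv_rhs => rw [← real_cdf_le (lawY Q j) ht]
  rw [lawY, map_measureReal_apply (by fun_prop)
    (measurableSet_le (monotone_cdf _).measurable measurable_const)]
  rfl

theorem lawX_compProd_condLaw (j : Fin 2) :
    lawX Q ⊗ₘ condLaw Q j = Q.map fun d => (d.2, d.1 j) :=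
  compProd_map_condDistrib (by fun_prop)

/-- The covariate-adjusted response is uniform and independent of the covariate. -/
theorem real_adjustedY_le_inter {j : Fin 2} (hYX : ∀ᵐ x ∂(lawX Q), condLaw Q j x ≪ volume)
    {t : ℝ} (ht : t ∈ Icc (0 : ℝ) 1) {A : Set ℝ} (hA : MeasurableSet A) :
    Q.real ({d | adjustedY Q j d ≤ t} ∩ {d | d.2 ∈ A}) = t * (lawX Q).real A := by
  have hm : Measurable fun q : ℝ × ℝ => cdf (condLaw Q j q.1) q.2 :=
    (measurable_adjustedY Q j).comp
      (by fun_prop : Measurable fun q : ℝ × ℝ => ((fun _ => q.2, q.1) : (Fin 2 → ℝ) × ℝ))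
  have hs : MeasurableSet {q : ℝ × ℝ | cdf (condLaw Q j q.1) q.2 ≤ t ∧ q.1 ∈ A} :=
    (measurableSet_le hm measurable_const).inter (measurable_fst hA)
  have h1 : Q ({d | adjustedY Q j d ≤ t} ∩ {d | d.2 ∈ A}) =
      ∫⁻ x, condLaw Q j x (Prod.mk x ⁻¹' {q : ℝ × ℝ | cdf (condLaw Q j q.1) q.2 ≤ t ∧ q.1 ∈ A})
        ∂(lawX Q) := by
    rw [← Measure.compProd_apply hs, lawX_compProd_condLaw, Measure.map_apply (by fun_prop) hs]
    rfl
  have h2 : ∀ᵐ x ∂(lawX Q), condLaw Q j x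
      (Prod.mk x ⁻¹' {q : ℝ × ℝ | cdf (condLaw Q j q.1) q.2 ≤ t ∧ q.1 ∈ A}) =
      A.indicator (fun _ => ENNReal.ofReal t) x := by
    filter_upwards [hYX] with x hx
    have := nullSingletonClass_of_ac hx
    by_cases hxA : x ∈ A
    · rw [Set.indicator_of_mem hxA]
      have e : Prod.mk x ⁻¹' {q : ℝ × ℝ | cdf (condLaw Q j q.1) q.2 ≤ t ∧ q.1 ∈ A} =
          {y | cdf (condLaw Q j x) y ≤ t} := by
        ext y; simp [hxA]
      rw [e, ← ofReal_measureReal, real_cdf_le_of_mem_Icc _ ht]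
    · rw [Set.indicator_of_notMem hxA]
      have e : Prod.mk x ⁻¹' {q : ℝ × ℝ | cdf (condLaw Q j q.1) q.2 ≤ t ∧ q.1 ∈ A} = ∅ := by
        ext y; simp [hxA]
      rw [e, measure_empty]
  rw [measureReal_def, h1, lintegral_congr_ae h2, lintegral_indicator hA, setLIntegral_const,
    ENNReal.toReal_mul, ENNReal.toReal_ofReal ht.1]
  rfl

theorem map_adjustedY {j : Fin 2} (hYX : ∀ᵐ x ∂(lawX Q), condLaw Q j x ≪ volume) :
    Q.map (adjustedY Q j) = volume.restrict (Icc 0 1) := by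
  refine unif_of_le (measurable_adjustedY Q j) (fun d => ⟨cdf_nonneg _ _, cdf_le_one _ _⟩)
    fun t ht => ?_
  have := real_adjustedY_le_inter hYX ⟨ht.1.le, ht.2.le⟩ MeasurableSet.univ
  simpa using this

theorem copula_eq (u₁ u₂ s : ℝ) : copula Q ![u₁, u₂, s] =
    Q.real ({d | adjustedY Q 0 d ≤ u₁ ∧ adjustedY Q 1 d ≤ u₂} ∩ {d | unifX Q d ≤ s}) := by
  rw [copula, adjustedLaw, map_measureReal_apply (measurable_adjust Q) measurableSet_Iic]
  congr 1
  ext d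
  simp only [Set.mem_preimage, Set.mem_Iic, Pi.le_def, Fin.forall_fin_succ, Set.mem_inter_iff,
    Set.mem_ofPred_eq]
  simp [adjust, adjustedY, unifX, and_assoc]

theorem hasDerivAt_copula {u₁ u₂ : ℝ}
    (hdiff : DifferentiableOn ℝ (fun t => copula Q ![u₁, u₂, t]) (Icc 0 1)) {t : ℝ}
    (ht : t ∈ Ioo (0 : ℝ) 1) : HasDerivAt (fun s =>
      Q.real ({d | adjustedY Q 0 d ≤ u₁ ∧ adjustedY Q 1 d ≤ u₂} ∩ {d | unifX Q d ≤ s}))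
      (condCopula Q t u₁ u₂) t := by
  have hn : Icc (0 : ℝ) 1 ∈ 𝓝 t := Icc_mem_nhds ht.1 ht.2
  have h1 := ((hdiff t (Ioo_subset_Icc_self ht)).differentiableAt hn).hasDerivAt
  rw [condCopula, derivWithin_of_mem_nhds hn]
  simpa only [copula_eq] using h1

/-- `U_j` is uniform and independent of `V`, so the bivariate margins of the copula are `t * s`,
with `s`-derivative `t`. -/
theorem condCopula_right {v t : ℝ} (hX : lawX Q ≪ volume)
    (hYX : ∀ j, ∀ᵐ x ∂(lawX Q), condLaw Q j x ≪ volume) (hv : v ∈ Icc (0 : ℝ) 1)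
    (ht : t ∈ Icc (0 : ℝ) 1) : condCopula Q v t 1 = t ∧ condCopula Q v 1 t = t := by
  have := nullSingletonClass_of_ac hX
  have hms : ∀ s : ℝ, MeasurableSet {x | cdf (lawX Q) x ≤ s} := fun s =>
    measurableSet_le (monotone_cdf (lawX Q)).measurable measurable_const
  have key : ∀ j : Fin 2, ∀ s ∈ Icc (0 : ℝ) 1,
      Q.real ({d | adjustedY Q j d ≤ t} ∩ {d | unifX Q d ≤ s}) = t * s := fun j s hs => by
    have h := real_adjustedY_le_inter (hYX j) ht (hms s)
    rw [real_cdf_le_of_mem_Icc _ hs] at h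
    exact h
  have hder : derivWithin (fun s => t * s) (Icc 0 1) v = t := by
    have := ((hasDerivAt_id v).const_mul t).hasDerivWithinAt (s := Icc 0 1)
    rw [mul_one] at this
    exact this.derivWithin (uniqueDiffOn_Icc one_pos v hv)
  have hle : ∀ j d, adjustedY Q j d ≤ 1 := fun j d => cdf_le_one _ _
  have e₀ : ∀ s ∈ Icc (0 : ℝ) 1, copula Q ![t, 1, s] = t * s := fun s hs => by
    rw [copula_eq]
    simp only [hle, and_true]
    exact key 0 s hs
  have e₁ : ∀ s ∈ Icc (0 : ℝ) 1, copula Q ![1, t, s] = t * s := fun s hs => by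
    rw [copula_eq]
    simp only [hle, true_and]
    exact key 1 s hs
  rw [condCopula, condCopula, derivWithin_congr e₀ (e₀ v hv), derivWithin_congr e₁ (e₁ v hv)]
  exact ⟨hder, hder⟩

theorem ae_unifX_le_iff (hX : lawX Q ≪ volume) (a : ℝ) :
    ∀ᵐ d ∂Q, (unifX Q d ≤ cdf (lawX Q) a ↔ d.2 ≤ a) := by
  have := nullSingletonClass_of_ac hX
  exact ae_of_ae_map measurable_snd.aemeasurable (ae_cdf_le_iff (lawX Q) a)

theorem ae_unifY_le_iff {j : Fin 2} (hY : lawY Q j ≪ volume) (a : ℝ) :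
    ∀ᵐ d ∂Q, (unifY Q j d ≤ cdf (lawY Q j) a ↔ d.1 j ≤ a) := by
  have := nullSingletonClass_of_ac hY
  exact ae_of_ae_map (f := fun d : (Fin 2 → ℝ) × ℝ => d.1 j)
    (by fun_prop : Measurable fun d : (Fin 2 → ℝ) × ℝ => d.1 j).aemeasurable
    (ae_cdf_le_iff (lawY Q j) a)

/-- Conditioning on `X` is the same as conditioning on `F_X(X)`. -/
theorem ae_condLaw_eq_condDistrib (hX : lawX Q ≪ volume) (j : Fin 2) (y : ℝ) :
    ∀ᵐ d ∂Q, condLaw Q j d.2 (Iic y) = condDistrib id (unifX Q) Q (unifX Q d) {d | d.1 j ≤ y} := by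
  have hB : MeasurableSet {d : (Fin 2 → ℝ) × ℝ | d.1 j ≤ y} :=
    measurableSet_le (by fun_prop) measurable_const
  have hYm : Measurable fun d : (Fin 2 → ℝ) × ℝ => d.1 j := by fun_prop
  set f₁ : ℝ → ℝ≥0∞ := fun x => condLaw Q j x (Iic y) with hf₁
  set f₂ : ℝ → ℝ≥0∞ := fun x =>
    condDistrib id (unifX Q) Q (cdf (lawX Q) x) {d | d.1 j ≤ y} with hf₂
  have hm₁ : Measurable f₁ := (condLaw Q j).measurable_coe measurableSet_Iic
  have hm₂ : Measurable f₂ := ((condDistrib id (unifX Q) Q).measurable_coe hB).comp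
    (monotone_cdf (lawX Q)).measurable
  have hfin : ∫⁻ x, f₁ x ∂(lawX Q) ≠ ∞ := by
    refine ne_top_of_le_ne_top ENNReal.one_ne_top ?_
    calc ∫⁻ x, f₁ x ∂(lawX Q) ≤ ∫⁻ _, 1 ∂(lawX Q) := lintegral_mono fun x => prob_le_one
      _ = 1 := by simp
  -- Both densities have the same integrals over half-lines, because `X ≤ a` and `F_X(X) ≤ F_X(a)`
  -- are almost surely the same event.
  have heq : (lawX Q).withDensity f₁ = (lawX Q).withDensity f₂ := by
    have : IsFiniteMeasure ((lawX Q).withDensity f₁) := isFiniteMeasure_withDensity hfin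
    refine Measure.ext_of_Iic _ _ fun a => ?_
    rw [withDensity_apply _ measurableSet_Iic, withDensity_apply _ measurableSet_Iic, lawX,
      setLIntegral_map measurableSet_Iic hm₁ measurable_snd,
      setLIntegral_map measurableSet_Iic hm₂ measurable_snd]
    have h1 := setLIntegral_preimage_condDistrib (μ := Q) measurable_snd hYm.aemeasurable
      (measurableSet_Iic (a := y)) (measurableSet_Iic (a := a))
    have h2 := setLIntegral_preimage_condDistrib (μ := Q) (measurable_unifX Q)
      (aemeasurable_id (μ := Q)) hB (measurableSet_Iic (a := cdf (lawX Q) a))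
    have h3 : (unifX Q ⁻¹' Iic (cdf (lawX Q) a)) =ᵐ[Q] (Prod.snd ⁻¹' Iic a) := by
      refine Filter.eventuallyEq_set.2 ?_
      filter_upwards [ae_unifX_le_iff hX a] with d hd using hd
    calc ∫⁻ d in Prod.snd ⁻¹' Iic a, f₁ d.2 ∂Q
        = Q (Prod.snd ⁻¹' Iic a ∩ (fun d : (Fin 2 → ℝ) × ℝ => d.1 j) ⁻¹' Iic y) := h1
      _ = Q (unifX Q ⁻¹' Iic (cdf (lawX Q) a) ∩ id ⁻¹' {d | d.1 j ≤ y}) :=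
          measure_congr (h3.symm.inter (ae_eq_refl _))
      _ = ∫⁻ d in Prod.snd ⁻¹' Iic a, f₂ d.2 ∂Q := by
          rw [← h2]
          exact setLIntegral_congr h3
  have hae := (withDensity_eq_iff hm₁.aemeasurable hm₂.aemeasurable hfin).1 heq
  exact ae_of_ae_map measurable_snd.aemeasurable hae

/-- The covariate-adjusted response is `∂_v C_j` evaluated at the transformed data. -/
theorem ae_adjustedY_eq (hX : lawX Q ≪ volume) {j : Fin 2} (hY : lawY Q j ≪ volume)
    (hdiff : ∀ w ∈ Icc (0 : ℝ) 1, DifferentiableOn ℝ (pairCopula Q j w) (Ioo 0 1))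
    (hcont : ContinuousOn (fun q : ℝ × ℝ => deriv (pairCopula Q j q.1) q.2)
      (Icc 0 1 ×ˢ Ioo 0 1)) :
    ∀ᵐ d ∂Q, adjustedY Q j d = deriv (pairCopula Q j (unifY Q j d)) (unifX Q d) := by
  have hnull := nullSingletonClass_of_ac hY
  -- The exceptional null set depends on the level, so only rational levels are treated.
  -- Right-continuity of the conditional distribution function and continuity of the derivative then
  -- reach the level `d.1 j` itself.
  have hrat : ∀ᵐ d ∂Q, ∀ y : ℚ, cdf (condLaw Q j d.2) y =
      deriv (pairCopula Q j (cdf (lawY Q j) y)) (unifX Q d) := by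
    rw [ae_all_iff]
    intro y
    have hB : MeasurableSet {d : (Fin 2 → ℝ) × ℝ | d.1 j ≤ y} :=
      measurableSet_le (by fun_prop) measurable_const
    have hset : ∀ s, Q.real ({d | d.1 j ≤ y} ∩ {d | unifX Q d ≤ s}) =
        Q.real ({d | unifY Q j d ≤ cdf (lawY Q j) y} ∩ {d | unifX Q d ≤ s}) := by
      intro s
      refine measureReal_congr (Filter.EventuallyEq.inter ?_ (ae_eq_refl _))
      refine Filter.eventuallyEq_set.2 ?_
      filter_upwards [ae_unifY_le_iff hY (y : ℝ)] with d hd using hd.symm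
    have h1 := condDistrib_ae_eq_deriv (measurable_unifX Q) (map_unifX hX) hB
      (p := deriv (pairCopula Q j (cdf (lawY Q j) y))) (fun t ht => by
        simp only [hset]
        exact hasDerivAt_pairCopula (hdiff _ ⟨cdf_nonneg _ _, cdf_le_one _ _⟩) ht)
    filter_upwards [h1, ae_condLaw_eq_condDistrib hX j y] with d hd1 hd2
    rw [← hd1, cdf_eq_real, measureReal_def, hd2, measureReal_def]
  filter_upwards [hrat, ae_mem_Ioo_of_unif (measurable_unifX Q) (map_unifX hX)] with d hd hV
  have hl : Tendsto (fun y : ℝ => cdf (condLaw Q j d.2) y) (𝓝[>] (d.1 j))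
      (𝓝 (cdf (condLaw Q j d.2) (d.1 j))) :=
    ((cdf (condLaw Q j d.2)).right_continuous (d.1 j)).mono_left
      (nhdsWithin_mono _ Ioi_subset_Ici_self)
  have hr : Tendsto (fun y : ℝ => deriv (pairCopula Q j (cdf (lawY Q j) y)) (unifX Q d))
      (𝓝[>] (d.1 j)) (𝓝 (deriv (pairCopula Q j (cdf (lawY Q j) (d.1 j))) (unifX Q d))) := by
    have hc : Continuous fun y : ℝ => deriv (pairCopula Q j (cdf (lawY Q j) y)) (unifX Q d) :=
      hcont.comp_continuous (f := fun y : ℝ => (cdf (lawY Q j) y, unifX Q d))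
        ((continuous_cdf (lawY Q j)).prodMk continuous_const)
        fun y => ⟨⟨cdf_nonneg _ _, cdf_le_one _ _⟩, hV⟩
    exact hc.continuousAt.tendsto.mono_left nhdsWithin_le_nhds
  refine tendsto_nhds_unique_of_frequently_eq hl hr ?_
  rw [(nhdsGT_basis (d.1 j)).frequently_iff]
  intro b hb
  obtain ⟨y, hy1, hy2⟩ := exists_rat_btwn hb
  exact ⟨y, ⟨hy1, hy2⟩, hd y⟩

end Population

/-! ### Ranks of observations and of pseudo-observations -/

theorem GC.rankClose {S : ℕ → ℝ} (hGC : GC S) (hS : ∀ i, S i ∈ Ioo (0 : ℝ) 1) {η : ℝ}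
    (hη : 0 < η) : ∀ᶠ n : ℕ in atTop, ∀ i : Fin n,
      RankClose (fun i : Fin n => S i) (fun i : Fin n => S i) η i := by
  filter_upwards [hGC η hη, hGC.countLT hη] with n h1 h2 i
  have hi : S i ∈ Icc (0 : ℝ) 1 := Ioo_subset_Icc_self (hS i)
  have e1 := abs_le.1 (h1 _ hi)
  have e2 := abs_le.1 (h2 _ hi)
  constructor
  · linarith [e1.2]
  · linarith [e2.1]

/-- Absence of ties after the transform rules out that it merges two data points, so its
monotonicity is strict on the sample. -/
theorem lt_iff_of_monotone {ι : Type*} {x : ι → ℝ} {f : ℝ → ℝ} (hf : Monotone f)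
    (hinj : Function.Injective fun i => f (x i)) (i j : ι) : x i < x j ↔ f (x i) < f (x j) := by
  refine ⟨fun h => (hf h.le).lt_of_ne fun he => ?_, fun h => ?_⟩
  · rw [hinj he] at h
    exact lt_irrefl _ h
  · by_contra h'
    exact absurd (hf (not_lt.1 h')) (not_le.2 h)

theorem injective_of_lt_iff {ι : Type*} {x y : ι → ℝ} (h : ∀ i j, x i < x j ↔ y i < y j)
    (hy : Function.Injective y) : Function.Injective x := by
  intro i j hij
  refine hy (le_antisymm ?_ ?_)
  · rw [← not_lt, ← h, hij]; exact lt_irrefl _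
  · rw [← not_lt, ← h, hij]; exact lt_irrefl _

/-- If approximations `Z` of uniform variables `U` are accurate for most observations, so are their
ranks. -/
theorem rankClose_of_approx {U V : ℕ → ℝ} (hU : ∀ i, U i ∈ Ioo (0 : ℝ) 1) (hGU : GC U)
    (hGV : GC V) {Z : ∀ n : ℕ, Fin n → ℝ}
    (hZ : ∀ ε > (0 : ℝ), ∀ δ > (0 : ℝ), ∀ᶠ n : ℕ in atTop, ∀ i : Fin n,
      V i ∈ Icc δ (1 - δ) → |Z n i - U i| ≤ ε) {η δ : ℝ} (hη : 0 < η) (hδ : 0 < δ) :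
    ∀ᶠ n : ℕ in atTop, ∀ i : Fin n, V i ∈ Icc δ (1 - δ) →
      RankClose (Z n) (fun i : Fin n => U i) η i := by
  -- The total rank error is `5 e + 2 d`, at most `η` for `e = η / 10` and `d ≤ η / 4`.
  set d := min (min δ (η / 4)) (1 / 2) with hd
  have hd0 : 0 < d := lt_min (lt_min hδ (by positivity)) (by norm_num)
  have hdδ : d ≤ δ := (min_le_left _ _).trans (min_le_left _ _)
  have hdη : d ≤ η / 4 := (min_le_left _ _).trans (min_le_right _ _)
  have hd2 : d ≤ 1 / 2 := min_le_right _ _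
  set e := η / 10 with he
  have he0 : 0 < e := by positivity
  filter_upwards [hZ e he0 d hd0, hGU e he0, hGU.countLT he0, hGV e he0, hGV.countLT he0] with
    n hZn hU1 hU2 hV1 hV2 i hi
  have hmid : V i ∈ Icc d (1 - d) := ⟨hdδ.trans hi.1, by linarith [hi.2]⟩
  have hZi := abs_le.1 (hZn i hmid)
  have hn0 : (0 : ℝ) ≤ n := by positivity
  -- Nothing is known about `Z` at extreme covariates. There are about `2 d n` of these, and they
  -- can shift any rank by at most their number.
  set bad : Finset (Fin n) := Finset.univ.filter fun k => ¬ (V k ∈ Icc d (1 - d)) with hbad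
  have hbadc : (bad.card : ℝ) ≤ n * (2 * d + 2 * e) := by
    have h1 : bad.card ≤ countLT (fun k : Fin n => V k) d +
        (n - countLE (fun k : Fin n => V k) (1 - d)) := by
      have hc : (Finset.univ.filter fun k : Fin n => ¬ V k ≤ 1 - d).card =
          n - countLE (fun k : Fin n => V k) (1 - d) := by
        have := Finset.card_filter_add_card_filter_not (s := (Finset.univ : Finset (Fin n)))
          (fun k : Fin n => V k ≤ 1 - d)
        rw [countLE_eq]
        simp only [Finset.card_univ, Fintype.card_fin] at this
        omega
      rw [← hc, countLT_eq]
      refine (Finset.card_le_card fun k hk => ?_).trans (Finset.card_union_le _ _)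
      simp only [hbad, Finset.mem_filter, Finset.mem_univ, true_and, Finset.mem_union,
        Set.mem_Icc, not_and_or, not_le] at hk ⊢
      exact hk
    have h2 := countLE_le (fun k : Fin n => V k) (1 - d)
    have h3 : (bad.card : ℝ) ≤ countLT (fun k : Fin n => V k) d +
        (n - countLE (fun k : Fin n => V k) (1 - d)) := by
      have : (bad.card : ℝ) ≤ ((countLT (fun k : Fin n => V k) d +
        (n - countLE (fun k : Fin n => V k) (1 - d)) : ℕ) : ℝ) := by exact_mod_cast h1
      rwa [Nat.cast_add, Nat.cast_sub h2] at this
    have h4 := (abs_le.1 (hV2 d ⟨hd0.le, by linarith⟩)).2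
    have h5 := (abs_le.1 (hV1 (1 - d) ⟨by linarith, by linarith⟩)).1
    nlinarith
  constructor
  · have h1 : countLE (Z n) (Z n i) ≤ countLE (fun k : Fin n => U k) (U i + 2 * e) + bad.card := by
      rw [countLE_eq, countLE_eq]
      refine (Finset.card_le_card fun k hk => ?_).trans (Finset.card_union_le _ _)
      simp only [hbad, Finset.mem_filter, Finset.mem_univ, true_and, Finset.mem_union] at hk ⊢
      by_cases hk' : V k ∈ Icc d (1 - d)
      · left
        linarith [(abs_le.1 (hZn k hk')).1, hZi.2]
      · exact Or.inr hk'
    have h2 : (countLE (fun k : Fin n => U k) (U i + 2 * e) : ℝ) ≤ n * (U i + 3 * e) := by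
      by_cases h : U i + 2 * e ≤ 1
      · have := (abs_le.1 (hU1 (U i + 2 * e) ⟨by linarith [(hU i).1], h⟩)).2
        linarith
      · have h3 : (countLE (fun k : Fin n => U k) (U i + 2 * e) : ℝ) ≤ n := by
          exact_mod_cast countLE_le _ _
        nlinarith
    have h3 : (countLE (Z n) (Z n i) : ℝ) ≤ countLE (fun k : Fin n => U k) (U i + 2 * e) +
        bad.card := by exact_mod_cast h1
    have h4 : n * (U i + 3 * e) + n * (2 * d + 2 * e) ≤ n * (U i + η) := by
      rw [← mul_add]
      exact mul_le_mul_of_nonneg_left (by linarith) hn0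
    linarith
  · by_cases h : 0 ≤ U i - 2 * e
    · have h1 : countLT (fun k : Fin n => U k) (U i - 2 * e) ≤ countLT (Z n) (Z n i) +
          bad.card := by
        rw [countLT_eq, countLT_eq]
        refine (Finset.card_le_card fun k hk => ?_).trans (Finset.card_union_le _ _)
        simp only [hbad, Finset.mem_filter, Finset.mem_univ, true_and, Finset.mem_union] at hk ⊢
        by_cases hk' : V k ∈ Icc d (1 - d)
        · left
          linarith [(abs_le.1 (hZn k hk')).2, hZi.1]
        · exact Or.inr hk'
      have h2 := (abs_le.1 (hU2 (U i - 2 * e) ⟨h, by linarith [(hU i).2]⟩)).1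
      have h3 : (countLT (fun k : Fin n => U k) (U i - 2 * e) : ℝ) ≤ countLT (Z n) (Z n i) +
          bad.card := by exact_mod_cast h1
      have h4 : n * (U i - η) ≤ n * (U i - 2 * e) - e * n - n * (2 * d + 2 * e) := by
        have : n * (U i - 2 * e) - e * n - n * (2 * d + 2 * e) = n * (U i - 5 * e - 2 * d) := by
          ring
        rw [this]
        exact mul_le_mul_of_nonneg_left (by linarith) hn0
      linarith
    · have h1 : n * (U i - η) ≤ 0 := mul_nonpos_of_nonneg_of_nonpos hn0 (by linarith)
      exact h1.trans (by positivity)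

theorem abs_modifiedECDF_sub_le {S : ℕ → ℝ} (hGC : GC S) (hS : ∀ i, S i ∈ Ioo (0 : ℝ) 1) {τ : ℝ}
    (hτ : 0 < τ) : ∀ᶠ n : ℕ in atTop, ∀ i : Fin n,
      |modifiedECDF (fun k : Fin n => S k) (S i) - S i| ≤ τ := by
  obtain ⟨N, hN⟩ := exists_nat_gt (2 / τ)
  filter_upwards [hGC (τ / 2) (half_pos hτ), eventually_ge_atTop N] with n hn hnN i
  have h1 := abs_le.1 (hn (S i) (Ioo_subset_Icc_self (hS i)))
  have hn1 : (0 : ℝ) < n + 1 := by positivity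
  have hNn : (N : ℝ) ≤ n := by exact_mod_cast hnN
  rw [div_lt_iff₀ hτ] at hN
  have h2 : modifiedECDF (fun k : Fin n => S k) (S i) - S i =
      ((countLE (fun k : Fin n => S k) (S i) : ℝ) - (n + 1) * S i) / (n + 1) := by
    rw [modifiedECDF]; field_simp
  rw [h2, abs_div, abs_of_pos hn1, div_le_iff₀ hn1, abs_le]
  have h3 := hS i
  constructor <;> nlinarith [h3.1, h3.2, h1.1, h1.2]

theorem modifiedECDF_congr {n : ℕ} {x y : Fin n → ℝ} (h : ∀ i j, x i < x j ↔ y i < y j)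
    (i : Fin n) : modifiedECDF x (x i) = modifiedECDF y (y i) := by
  rw [modifiedECDF, modifiedECDF, countLE_congr h]

theorem modifiedECDF_mem_Icc {n : ℕ} (x : Fin n → ℝ) (t : ℝ) :
    modifiedECDF x t ∈ Icc (0 : ℝ) 1 := by
  refine ⟨by unfold modifiedECDF; positivity, div_le_one_of_le₀ ?_ (by positivity)⟩
  have : (countLE x t : ℝ) ≤ n := by exact_mod_cast countLE_le x t
  linarith

open Classical in
/-- The estimated conditional distribution functions, evaluated at the data, are uniformly close to
`P (S i) (V i)`, except at the extreme values of the covariate. -/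
theorem condCDFEstimate_close {X Y V S : ℕ → ℝ} (hXV : ∀ i j, X i < X j ↔ V i < V j)
    (hYS : ∀ i j, Y i < Y j ↔ S i < S j) {P : ℝ → ℝ → ℝ} {v₀ : ℝ} (hv₀ : v₀ ∈ Icc (0 : ℝ) 1)
    (hV : ∀ i, V i ∈ Ioo (0 : ℝ) 1) (hinj : Function.Injective V) (hGV : GC V)
    (hS : ∀ i, S i ∈ Ioo (0 : ℝ) 1) (hGS : GC S)
    (hP : ContinuousOn (fun q : ℝ × ℝ => P q.1 q.2) (Icc 0 1 ×ˢ Ioo 0 1))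
    (hP01 : ∀ w ∈ Icc (0 : ℝ) 1, ∀ v ∈ Ioo (0 : ℝ) 1, P w v ∈ Icc (0 : ℝ) 1)
    (hlln : ∀ J : ℕ, 1 ≤ J → ∀ j₁ ≤ J, ∀ j₂ ≤ J, LocalLLN V
      (fun i => if S i ≤ j₁ / J ∧ S i ≤ j₂ / J then 1 else 0)
      (fun i => P (min (j₁ / J) (j₂ / J)) (V i)) v₀)
    {g m : ℕ → ℕ} (hg : Tendsto g atTop atTop) (hm : Tendsto m atTop atTop) {β : ℝ} (hβ : β < 1)
    (hmβ : ∀ᶠ n : ℕ in atTop, (m n : ℝ) ≤ (n : ℝ) ^ β) {ε δ : ℝ} (hε : 0 < ε) (hδ : 0 < δ) :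
    ∀ᶠ n : ℕ in atTop, ∀ i : Fin n, V i ∈ Icc δ (1 - δ) →
      |condCDFEstimate (g n) (m n) (fun k : Fin n => Y k) (fun k : Fin n => X k) (X i) (Y i) -
        P (S i) (V i)| ≤ ε := by
  have hmin : ∀ u₁ ∈ Icc (0 : ℝ) 1, ∀ u₂ ∈ Icc (0 : ℝ) 1, min u₁ u₂ ∈ Icc (0 : ℝ) 1 :=
    fun u₁ h₁ u₂ h₂ => ⟨le_min h₁.1 h₂.1, (min_le_left _ _).trans h₁.2⟩
  -- The bivariate problem is the trivariate one with both responses equal to `S`: the joint event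
  -- is `S ≤ min u₁ u₂`, and evaluating at `u₂ = 1` removes the second factor.
  obtain ⟨η, hη, K, hK, hcons⟩ := consistency (p := fun u₁ u₂ v => P (min u₁ u₂) v) hv₀ hV hinj
    hGV hS hS (hP.comp (f := fun x : ℝ × ℝ × ℝ => (min x.1 x.2.1, x.2.2)) (by fun_prop)
      fun x hx => ⟨hmin _ hx.1 _ hx.2.1, hx.2.2⟩)
    (fun u₁ h₁ u₂ h₂ v hv => hP01 _ (hmin _ h₁ _ h₂) _ hv) hlln (half_pos hε) (half_pos hδ) hβ
  have hsub : Icc (δ / 2) (1 - δ / 2) ⊆ Ioo (0 : ℝ) 1 := fun x hx =>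
    ⟨by linarith [hx.1], by linarith [hx.2]⟩
  have huc := (isCompact_Icc.prod isCompact_Icc).uniformContinuousOn_of_continuous
    (hP.mono (Set.prod_mono le_rfl hsub))
  rw [Metric.uniformContinuousOn_iff] at huc
  obtain ⟨r, hr0, hr⟩ := huc (ε / 2) (half_pos hε)
  set τ := min (r / 2) (δ / 2) with hτ
  have hτ0 : 0 < τ := lt_min (half_pos hr0) (half_pos hδ)
  have hτr : τ < r := (min_le_left _ _).trans_lt (by linarith)
  have hτδ : τ ≤ δ / 2 := min_le_right _ _
  filter_upwards [hcons, hGS.rankClose hS hη, abs_modifiedECDF_sub_le hGV hV hτ0,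
    abs_modifiedECDF_sub_le hGS hS hτ0, hmβ, hm.eventually_ge_atTop K,
    hg.eventually_ge_atTop K] with n hn hrank hVn hSn hmn hmK hgK i hi
  have hXV' : ∀ k l : Fin n, X k < X l ↔ V k < V l := fun k l => hXV k l
  have hYS' : ∀ k l : Fin n, Y k < Y l ↔ S k < S l := fun k l => hYS k l
  have eV : modifiedECDF (fun k : Fin n => X k) (X i) = modifiedECDF (fun k : Fin n => V k) (V i) :=
    modifiedECDF_congr hXV' i
  have eS : modifiedECDF (fun k : Fin n => Y k) (Y i) = modifiedECDF (fun k : Fin n => S k) (S i) :=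
    modifiedECDF_congr hYS' i
  rw [condCDFEstimate_eq (hK.trans hmK), vWeight_congr hXV', cellCDF_congr hYS', eV, eS]
  set w := modifiedECDF (fun k : Fin n => S k) (S i) with hw
  set k := countLE (fun k : Fin n => V k) (V i) with hk
  -- Observation `i` counts itself, so its modified empirical distribution value is one of the nodes
  -- `k / (n + 1)`, not the special node `v₀`.
  have hk0 : k ≠ 0 := by
    have := countLT_lt_countLE (fun k : Fin n => V k) i
    omega
  have hnode : modifiedECDF (fun k : Fin n => V k) (V i) = node v₀ n k := by
    rw [node, if_neg hk0, modifiedECDF]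
  have hVi := abs_le.1 (hVn i)
  have hw01 : w ∈ Icc (0 : ℝ) 1 := modifiedECDF_mem_Icc _ _
  rw [hnode] at hVi ⊢
  have hnm : node v₀ n k ∈ Icc (δ / 2) (1 - δ / 2) :=
    ⟨by linarith [hi.1, hVi.1], by linarith [hi.2, hVi.2]⟩
  have h1 := hn (m n) hmK hmn k (countLE_le _ _) hnm (g n) hgK (g n) hgK
    (fun k : Fin n => S k) (fun k : Fin n => S k) (fun k _ => ⟨hrank k, hrank k⟩) w hw01 1 (by simp)
  simp only [bern_at_one (hK.trans hgK), cellCDF_at_one, mul_one, min_eq_left hw01.2] at h1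
  -- The estimate is evaluated at empirical ranks; uniform continuity of `P` replaces these by `S i`
  -- and `V i`.
  have h2 := hr (w, node v₀ n k) ⟨hw01, hnm⟩ (S i, V i) ⟨Ioo_subset_Icc_self (hS i),
    ⟨by linarith [hi.1], by linarith [hi.2]⟩⟩ (by
      rw [Prod.dist_eq, Real.dist_eq, Real.dist_eq]
      exact max_lt ((hSn i).trans_lt hτr) ((abs_le.2 hVi).trans_lt hτr))
  rw [Real.dist_eq] at h2
  have h3 := abs_add_le (∑ x : Fin n, vWeight (m n) (node v₀ n k) (fun i : Fin n => V i) x *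
    bern (g n) (cellCDF (fun k : Fin n => S k) x) w - P w (node v₀ n k))
    (P w (node v₀ n k) - P (S i) (V i))
  rw [sub_add_sub_cancel] at h3
  simp only at h2
  linarith

open Classical in
-- Common end of both parts: `consistency` at the node `k = 0`, which is `v` itself, feeds
-- `tendsto_expectedError`. What remains is closeness of the ranks away from extreme covariates.
theorem tendsto_expectedError_of_rankClose {V S₁ S₂ : ℕ → ℝ} {p : ℝ → ℝ → ℝ → ℝ} {v : ℝ}
    (hv : v ∈ Ioo (0 : ℝ) 1)
    (hV : ∀ i, V i ∈ Ioo (0 : ℝ) 1) (hinj : Function.Injective V) (hGC : GC V)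
    (hS₁ : ∀ i, S₁ i ∈ Ioo (0 : ℝ) 1) (hS₂ : ∀ i, S₂ i ∈ Ioo (0 : ℝ) 1)
    (hp : ContinuousOn (fun x : ℝ × ℝ × ℝ => p x.1 x.2.1 x.2.2)
      (Icc 0 1 ×ˢ Icc 0 1 ×ˢ Ioo 0 1))
    (hp01 : ∀ u₁ ∈ Icc (0 : ℝ) 1, ∀ u₂ ∈ Icc (0 : ℝ) 1, ∀ v ∈ Ioo (0 : ℝ) 1,
      p u₁ u₂ v ∈ Icc (0 : ℝ) 1)
    (hp₁ : ∀ t ∈ Icc (0 : ℝ) 1, p t 1 v = t) (hp₂ : ∀ t ∈ Icc (0 : ℝ) 1, p 1 t v = t)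
    (hlln : ∀ J : ℕ, 1 ≤ J → ∀ j₁ ≤ J, ∀ j₂ ≤ J, LocalLLN V
      (fun i => if S₁ i ≤ j₁ / J ∧ S₂ i ≤ j₂ / J then 1 else 0)
      (fun i => p (j₁ / J) (j₂ / J) (V i)) v)
    {z : ∀ n : ℕ, Fin n → Fin 3 → ℝ} (hzV : ∀ n i j, z n i 2 < z n j 2 ↔ V i < V j)
    (hz : ∀ η > (0 : ℝ), ∀ δ > (0 : ℝ), ∀ᶠ n : ℕ in atTop, ∀ i : Fin n, V i ∈ Icc δ (1 - δ) →
      RankClose (fun i => z n i 0) (fun i : Fin n => S₁ i) η i ∧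
      RankClose (fun i => z n i 1) (fun i : Fin n => S₂ i) η i) :
    Tendsto (fun n => expectedError (z n) (fun u₁ u₂ => p u₁ u₂ v) v) atTop (𝓝 0) := by
  have hv01 := Ioo_subset_Icc_self hv
  refine tendsto_expectedError hv01 (fun n => injective_of_lt_iff (hzV n)
    (hinj.comp Fin.val_injective)) (fun u₁ h₁ u₂ h₂ => hp01 u₁ h₁ u₂ h₂ v hv) hp₁ hp₂
    (hp.comp (f := fun x : ℝ × ℝ => (x.1, x.2, v)) (by fun_prop)
      fun x hx => ⟨hx.1, hx.2, hv⟩) fun ε hε => ?_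
  set δ := min v (1 - v) with hδ
  have hδ0 : 0 < δ := lt_min hv.1 (by linarith [hv.2])
  obtain ⟨η, hη, K, hK, hcons⟩ := consistency hv01 hV hinj hGC hS₁ hS₂ hp hp01 hlln hε hδ0
    (by norm_num : (3 / 4 : ℝ) < 1)
  refine ⟨K, ?_⟩
  filter_upwards [hcons, hz η hη (δ / 2) (half_pos hδ0)] with n hn hzn l h0 h1 h2 hl u₁ hu₁ u₂ hu₂
  have hnode : node v n 0 = v := if_pos rfl
  have h3 := hn (l 2) h2 hl 0 (Nat.zero_le _) (by
    rw [hnode]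
    exact ⟨min_le_left _ _, by linarith [min_le_right v (1 - v)]⟩) (l 0) h0 (l 1) h1
    (fun i => z n i 0) (fun i => z n i 1) hzn u₁ hu₁ u₂ hu₂
  rw [hnode] at h3
  rw [ecbcDeriv_eq (hK.trans h2), vWeight_congr (hzV n)]
  exact h3

theorem continuousOn_uncurry_of_cube {p : ℝ → ℝ → ℝ → ℝ}
    (h : ContinuousOn (fun w : Fin 3 → ℝ => p (w 2) (w 0) (w 1)) (Icc 0 1)) :
    ContinuousOn (fun x : ℝ × ℝ × ℝ => p x.2.2 x.1 x.2.1) (Icc 0 1 ×ˢ Icc 0 1 ×ˢ Ioo 0 1) := by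
  have hc : Continuous fun x : ℝ × ℝ × ℝ => (![x.1, x.2.1, x.2.2] : Fin 3 → ℝ) := by
    refine continuous_pi fun k => ?_
    fin_cases k
    · exact continuous_fst
    · exact continuous_fst.comp continuous_snd
    · exact continuous_snd.comp continuous_snd
  refine h.comp hc.continuousOn fun x ⟨h1, h2, h3⟩ => Set.mem_Icc.2 ⟨fun k => ?_, fun k => ?_⟩
  · fin_cases k
    · exact h1.1
    · exact h2.1
    · exact h3.1.le
  · fin_cases k
    · exact h1.2
    · exact h2.2
    · exact h3.2.le

end ECBC

end

/-! ### The theorem: adjusted sample and pseudo-observations -/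

theorem theorem1
    {Ω : Type*} [MeasurableSpace Ω] (μ : Measure Ω) [IsProbabilityMeasure μ]
    -- the population law of `((Y₁, Y₂), X)` and an i.i.d. sequence of observations from it
    (Q : Measure ((Fin 2 → ℝ) × ℝ)) [IsProbabilityMeasure Q]
    (D : ℕ → Ω → (Fin 2 → ℝ) × ℝ) (hmeas : ∀ i, Measurable (D i))
    (hindep : iIndepFun D μ) (hlaw : ∀ i, μ.map (D i) = Q)
    -- absolutely continuous margins and conditional margins
    (hY : ∀ j, lawY Q j ≪ volume) (hX : lawX Q ≪ volume)
    (hYX : ∀ j, ∀ᵐ x ∂(lawX Q), condLaw Q j x ≪ volume)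
    -- the copula of `(U₁, U₂, V)` is absolutely continuous
    (hC : adjustedLaw Q ≪ volume)
    -- its derivative with respect to `v` exists and is Lipschitz on the unit cube
    (hdiff : ∀ u₁ ∈ Icc (0 : ℝ) 1, ∀ u₂ ∈ Icc (0 : ℝ) 1,
      DifferentiableOn ℝ (fun t => copula Q ![u₁, u₂, t]) (Icc 0 1))
    (hLip : ∃ K : ℝ≥0, LipschitzOnWith K
      (fun w : Fin 3 → ℝ => condCopula Q (w 2) (w 0) (w 1)) (Icc 0 1))
    (v : ℝ) (hv : v ∈ Ioo (0 : ℝ) 1) :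
    -- the estimator computed from the covariate-adjusted sample `(U_{i1}, U_{i2}, V_i)`
    (∀ᵐ ω ∂μ, Tendsto
      (fun n : ℕ => expectedError (fun i : Fin n => adjust Q (D i ω)) (condCopula Q v) v)
      atTop (𝓝 0)) ∧
    -- the estimator computed from the pseudo-observations `(Û_{i1}, Û_{i2}, V̂_i)`, for any
    -- (possibly data-dependent) degrees of the estimated conditional margins
    (∀ g m : ℕ → Ω → Fin 2 → ℕ,
      (∀ j, ∀ w ∈ Icc (0 : ℝ) 1, DifferentiableOn ℝ (pairCopula Q j w) (Ioo 0 1)) →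
      (∀ j, ContinuousOn (fun q : ℝ × ℝ => deriv (pairCopula Q j q.1) q.2)
        (Icc 0 1 ×ˢ Ioo 0 1)) →
      (∀ j, ∀ᵐ ω ∂μ, Tendsto (fun n => g n ω j) atTop atTop) →
      (∀ j, ∀ᵐ ω ∂μ, Tendsto (fun n => m n ω j) atTop atTop) →
      (∀ j, ∀ᵐ ω ∂μ, ∃ β < (1 : ℝ), ∀ᶠ n : ℕ in atTop, (m n ω j : ℝ) ≤ (n : ℝ) ^ β) →
      ∀ᵐ ω ∂μ, Tendsto
        (fun n : ℕ => expectedError (pseudoSample (g n ω) (m n ω) (fun i : Fin n => D i ω))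
          (condCopula Q v) v)
        atTop (𝓝 0)) := by
  have hVm := measurable_unifX Q
  have hVu := map_unifX hX
  have hv01 := Ioo_subset_Icc_self hv
  have hUm := measurable_adjustedY Q
  have hUu := fun j => map_adjustedY (hYX j)
  have hp : ContinuousOn (fun x : ℝ × ℝ × ℝ => condCopula Q x.2.2 x.1 x.2.1)
      (Icc 0 1 ×ˢ Icc 0 1 ×ˢ Ioo 0 1) := by
    obtain ⟨K, hK⟩ := hLip
    exact continuousOn_uncurry_of_cube hK.continuousOn
  have hder : ∀ u₁ ∈ Icc (0 : ℝ) 1, ∀ u₂ ∈ Icc (0 : ℝ) 1, ∀ t ∈ Ioo (0 : ℝ) 1, HasDerivAt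
      (fun s => Q.real ({d | adjustedY Q 0 d ≤ u₁ ∧ adjustedY Q 1 d ≤ u₂} ∩ {d | unifX Q d ≤ s}))
      (condCopula Q t u₁ u₂) t :=
    fun u₁ h₁ u₂ h₂ t ht => hasDerivAt_copula (hdiff u₁ h₁ u₂ h₂) ht
  have hp01 : ∀ u₁ ∈ Icc (0 : ℝ) 1, ∀ u₂ ∈ Icc (0 : ℝ) 1, ∀ t ∈ Ioo (0 : ℝ) 1,
      condCopula Q t u₁ u₂ ∈ Icc (0 : ℝ) 1 :=
    fun u₁ h₁ u₂ h₂ t ht => deriv_mem_Icc hVm hVu ht (hder u₁ h₁ u₂ h₂ t ht)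
  have hgrid : ∀ j J : ℕ, j ≤ J → (j / J : ℝ) ∈ Icc (0 : ℝ) 1 := fun j J hj =>
    ⟨by positivity, div_le_one_of_le₀ (by exact_mod_cast hj) (by positivity)⟩
  classical
  -- Only rational grid levels occur, so countably many null sets are discarded.
  have hlln : ∀ᵐ ω ∂μ, ∀ J : ℕ, 1 ≤ J → ∀ j₁ ≤ J, ∀ j₂ ≤ J, LocalLLN (fun i => unifX Q (D i ω))
      (fun i => if adjustedY Q 0 (D i ω) ≤ j₁ / J ∧ adjustedY Q 1 (D i ω) ≤ j₂ / J then 1 else 0)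
      (fun i => condCopula Q (unifX Q (D i ω)) (j₁ / J) (j₂ / J)) v := by
    rw [ae_all_iff]; intro J; refine ae_all_iff.2 fun hJ => ?_
    rw [ae_all_iff]; intro j₁; refine ae_all_iff.2 fun hj₁ => ?_
    rw [ae_all_iff]; intro j₂; refine ae_all_iff.2 fun hj₂ => ?_
    have := ae_localLLN hmeas hindep hlaw hVm hVu
      (B := {d | adjustedY Q 0 d ≤ j₁ / J ∧ adjustedY Q 1 d ≤ j₂ / J})
      ((measurableSet_le (hUm 0) measurable_const).inter
        (measurableSet_le (hUm 1) measurable_const))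
      (hder _ (hgrid j₁ J hj₁) _ (hgrid j₂ J hj₂)) hv01
    filter_upwards [this] with ω hω
    simpa only [Set.indicator_apply, Set.mem_ofPred_eq, Pi.one_apply] using hω
  have hVinj := ae_injective hmeas hindep hlaw hVm (fun t => by rw [hVu]; simp)
  have hVIoo := ae_of_law hmeas hlaw (ae_mem_Ioo_of_unif hVm hVu)
  have hUIoo := fun j => ae_of_law hmeas hlaw (ae_mem_Ioo_of_unif (hUm j) (hUu j))
  have hVGC := ae_GC hmeas hindep hlaw hVm hVu
  have hUGC := fun j => ae_GC hmeas hindep hlaw (hUm j) (hUu j)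
  constructor
  · filter_upwards [hlln, hVinj, hVIoo, hUIoo 0, hUIoo 1, hVGC, hUGC 0, hUGC 1] with
      ω h1 h2 h3 h4 h5 h6 h7 h8
    refine tendsto_expectedError_of_rankClose (p := fun u₁ u₂ v => condCopula Q v u₁ u₂) hv h3 h2
      h6 h4 h5 hp hp01 (fun t ht => (condCopula_right hX hYX hv01 ht).1)
      (fun t ht => (condCopula_right hX hYX hv01 ht).2) h1
      (z := fun n (i : Fin n) => adjust Q (D i ω)) (fun n i j => Iff.rfl) fun η hη δ hδ => ?_
    filter_upwards [h7.rankClose h4 hη, h8.rankClose h5 hη] with n e1 e2 i _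
    exact ⟨e1 i, e2 i⟩
  · intro g m hpd hpc hg hm hmβ
    have hSm := measurable_unifY Q
    have hSu := fun j => map_unifY (hY j)
    have hSinj := fun j => ae_injective hmeas hindep hlaw (hSm j)
      (fun t => by rw [hSu j]; simp)
    have hSIoo := fun j => ae_of_law hmeas hlaw (ae_mem_Ioo_of_unif (hSm j) (hSu j))
    have hSGC := fun j => ae_GC hmeas hindep hlaw (hSm j) (hSu j)
    have hP01 : ∀ j, ∀ w ∈ Icc (0 : ℝ) 1, ∀ t ∈ Ioo (0 : ℝ) 1,
        deriv (pairCopula Q j w) t ∈ Icc (0 : ℝ) 1 := fun j w hw t ht =>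
      deriv_mem_Icc hVm hVu ht (hasDerivAt_pairCopula (hpd j w hw) ht)
    have hPlln : ∀ j, ∀ᵐ ω ∂μ, ∀ J : ℕ, 1 ≤ J → ∀ j₁ ≤ J, ∀ j₂ ≤ J, LocalLLN (fun i => unifX Q (D i ω))
        (fun i => if unifY Q j (D i ω) ≤ j₁ / J ∧ unifY Q j (D i ω) ≤ j₂ / J then 1 else 0)
        (fun i => deriv (pairCopula Q j (min (j₁ / J) (j₂ / J))) (unifX Q (D i ω))) v := by
      intro j
      rw [ae_all_iff]; intro J; refine ae_all_iff.2 fun hJ => ?_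
      rw [ae_all_iff]; intro j₁; refine ae_all_iff.2 fun hj₁ => ?_
      rw [ae_all_iff]; intro j₂; refine ae_all_iff.2 fun hj₂ => ?_
      have := ae_localLLN hmeas hindep hlaw hVm hVu
        (B := {d | unifY Q j d ≤ min (j₁ / J : ℝ) (j₂ / J)})
        (measurableSet_le (hSm j) measurable_const)
        (fun t ht => hasDerivAt_pairCopula (hpd j (min (j₁ / J : ℝ) (j₂ / J))
          ⟨le_min (hgrid j₁ J hj₁).1 (hgrid j₂ J hj₂).1,
            (min_le_left _ _).trans (hgrid j₁ J hj₁).2⟩) ht) hv01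
      filter_upwards [this] with ω hω
      simpa only [Set.indicator_apply, Set.mem_ofPred_eq, Pi.one_apply, le_min_iff] using hω
    have hUS := fun j => ae_of_law hmeas hlaw (ae_adjustedY_eq hX (hY j) (hpd j) (hpc j))
    -- For each fixed outcome the degrees are deterministic sequences, and the law of large numbers
    -- is uniform over degrees; hence data-dependent degrees cause no difficulty.
    have hclose : ∀ j, ∀ᵐ ω ∂μ, ∀ ε > (0 : ℝ), ∀ δ > (0 : ℝ), ∀ᶠ n : ℕ in atTop, ∀ i : Fin n,
        unifX Q (D i ω) ∈ Icc δ (1 - δ) → |condCDFEstimate (g n ω j) (m n ω j)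
          (fun k : Fin n => (D k ω).1 j) (fun k : Fin n => (D k ω).2) (D i ω).2 ((D i ω).1 j) -
          adjustedY Q j (D i ω)| ≤ ε := by
      intro j
      filter_upwards [hPlln j, hVinj, hVIoo, hVGC, hSinj j, hSIoo j, hSGC j, hUS j, hg j, hm j,
        hmβ j] with ω h1 h2 h3 h4 h5 h6 h7 h8 h9 h10 ⟨β, hβ, h11⟩ ε hε δ hδ
      have := condCDFEstimate_close (X := fun i => (D i ω).2) (Y := fun i => (D i ω).1 j)
        (P := fun w t => deriv (pairCopula Q j w) t)
        (lt_iff_of_monotone (monotone_cdf (lawX Q)) h2)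
        (lt_iff_of_monotone (monotone_cdf (lawY Q j)) h5) hv01 h3 h2 h4 h6 h7 (hpc j) (hP01 j) h1
        h9 h10 hβ h11 hε hδ
      filter_upwards [this] with n hn i hi
      rw [h8 i]
      exact hn i hi
    filter_upwards [hlln, hVinj, hVIoo, hUIoo 0, hUIoo 1, hVGC, hUGC 0, hUGC 1, hclose 0,
      hclose 1] with ω h1 h2 h3 h4 h5 h6 h7 h8 h9 h10
    refine tendsto_expectedError_of_rankClose (p := fun u₁ u₂ v => condCopula Q v u₁ u₂) hv h3 h2
      h6 h4 h5 hp hp01 (fun t ht => (condCopula_right hX hYX hv01 ht).1)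
      (fun t ht => (condCopula_right hX hYX hv01 ht).2) h1
      (z := fun n => pseudoSample (g n ω) (m n ω) (fun i : Fin n => D i ω)) (fun n i j => ?_)
      fun η hη δ hδ => ?_
    · exact (modifiedECDF_lt_iff (fun k : Fin n => (D k ω).2) i j).trans
        (lt_iff_of_monotone (x := fun i => (D i ω).2) (monotone_cdf (lawX Q)) h2 i j)
    · filter_upwards [rankClose_of_approx h4 h7 h6 h9 hη hδ,
        rankClose_of_approx h5 h8 h6 h10 hη hδ] with n e1 e2 i hi
      exact ⟨e1 i hi, e2 i hi⟩
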